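/- Let $U\subseteq\mathbb R^N$ be open with coordinates $u=(u^1,\dots,u^N)$. All indices run from $1$ to $N$ and repeated indices are summed. For smooth functions $g^{ij},b^{ij}_k$ on $U$ and a constant $K\in\mathbb R$, the Mokhov--Ferapontov bracket with coefficients $(g,b,K)$ of two functionals $I,J$ of smooth fields $u:\mathbb R\to U$ is $$\{I,J\}=\int \frac{\delta I}{\delta u^i(x)}\Big(g^{ij}(u(x))\frac{d}{dx}+b^{ij}_k(u(x))\,u^k_x+K\,u^i_x\Big(\frac{d}{dx}\Big)^{-1}u^j_x\Big)\frac{\delta J}{\delta u^j(x)}\,dx ,$$ where $\big((d/dx)^{-1}f\big)(x)=\tfrac12\int_{\mathbb R}\operatorname{sgn}(x-y)f(y)\,dy$. The functionals considered are the smooth ones, that is, those whose variational derivative $\delta I/\delta u^i(x)$ exists at every field, is smooth in $x$, is supported in an interval of the $x$-line that is bounded independently of $u$, depends smoothly on parameters along smooth finite-parameter families of fields, and gives the derivative of $I$ along smooth curves of fields. The bracket is a Poisson bracket if it maps pairs of smooth functionals to smooth functionals, is bilinear and skew-symmetric, and satisfies the Leibniz rule and the Jacobi identity. Two brackets are compatible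 if every linear combination of them with constant real coefficients is a Poisson bracket. Let $(\eta^{ij})$ be a constant symmetric real matrix with $\det(\eta^{ij})\neq0$, and let $$\{I,J\}_2=\int\frac{\delta I}{\delta u^i(x)}\,\eta^{ij}\frac{d}{dx}\,\frac{\delta J}{\delta u^j(x)}\,dx .$$ Let $\{\cdot,\cdot\}_1$ be a Mokhov--Ferapontov bracket with smooth coefficients $g_1^{ij}(u)$, $b^{ij}_{1,k}(u)$ on $U$ and constant $K_1$ which is a Poisson bracket; the matrix $g_1^{ij}$ may be degenerate. Then $\{\cdot,\cdot\}_1$ is compatible with $\{\cdot,\cdot\}_2$ if and only if locally, that is, in a neighbourhood of each point of $U$, there are smooth functions $H^1(u),\dots,H^N(u)$ such that $$g_1^{ij}=\eta^{is}\frac{\partial H^j}{\partial u^s}+\eta^{js}\frac{\partial H^i}{\partial u^s}-K_1u^iu^j,\qquad b^{ij}_{1,k}=\eta^{is}\frac{\partial^2H^j}{\partial u^s\partial u^k}-K_1\delta^i_k\,u^j .$$ -/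

import Mathlib

open scoped ContDiff Topology

noncomputable section

namespace HydroBracket

/-- A real-valued functional of `N` fields `u¹(x), …, uᴺ(x)` of one variable `x ∈ ℝ`.
Only its values on fields `ℝ → U` (see `IsField`) are ever used. -/
abbrev Functional (N : ℕ) : Type := (ℝ → Fin N → ℝ) → ℝ

/-- A field: a smooth map from the line to the coordinate domain `U ⊆ ℝᴺ`. -/
def IsField {N : ℕ} (U : Set (Fin N → ℝ)) (u : ℝ → Fin N → ℝ) : Prop :=
  ContDiff ℝ ∞ u ∧ ∀ x, u x ∈ U

/-- `ξ = (ξ₁, …, ξ_N)` is the variational derivative `δF/δu(x)` of `F` at `u`: it is smooth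
and compactly supported, and the first variation of `F` at `u` in the direction of any smooth
compactly supported `φ` is `∫ ξᵢ(x) φⁱ(x) dx`. -/
def HasVarDeriv {N : ℕ} (F : Functional N) (u ξ : ℝ → Fin N → ℝ) : Prop :=
  ContDiff ℝ ∞ ξ ∧ HasCompactSupport ξ ∧
    ∀ φ : ℝ → Fin N → ℝ, ContDiff ℝ ∞ φ → HasCompactSupport φ →
      HasDerivAt (fun ε : ℝ => F (u + ε • φ)) (∫ x, ∑ i, ξ x i * φ x i) 0

open Classical in
/-- The variational derivative `δF/δuⁱ(x)`, as a function of `x` and `i`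
(it is unique if it exists; the value is `0` if it does not exist). -/
def varDeriv {N : ℕ} (F : Functional N) (u : ℝ → Fin N → ℝ) : ℝ → Fin N → ℝ :=
  if h : ∃ ξ, HasVarDeriv F u ξ then h.choose else 0

/-- Smooth functionals on the space of fields `ℝ → U`: the variational derivative exists at
every field, vanishes outside one bounded interval of the `x`-line, depends smoothly on
parameters along every smooth finite-parameter family of fields, and computes the derivative
of `F` along every smooth curve of fields.  Every local functional
`∫ f(x, u, uₓ, uₓₓ, …) dx` with a smooth density of bounded support in `x` is of this kind. -/
structure IsSmoothFunctional {N : ℕ} (U : Set (Fin N → ℝ)) (F : Functional N) : Prop where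
  exists_varDeriv : ∀ u, IsField U u → ∃ ξ, HasVarDeriv F u ξ
  bounded_support : ∃ R : ℝ, ∀ u, IsField U u → ∀ x, R < |x| → varDeriv F u x = 0
  smooth_family : ∀ (m : ℕ) (w : (Fin m → ℝ) × ℝ → Fin N → ℝ), ContDiff ℝ ∞ w →
    ∀ t₀ : Fin m → ℝ, (∀ᶠ t in 𝓝 t₀, ∀ x, w (t, x) ∈ U) → ∀ x₀ : ℝ,
      ContDiffAt ℝ ∞
        (fun p : (Fin m → ℝ) × ℝ => varDeriv F (fun x => w (p.1, x)) p.2) (t₀, x₀)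
  hasDerivAt_curve : ∀ w : ℝ × ℝ → Fin N → ℝ, ContDiff ℝ ∞ w →
    ∀ t₀ : ℝ, (∀ᶠ t in 𝓝 t₀, ∀ x, w (t, x) ∈ U) →
      HasDerivAt (fun t : ℝ => F (fun x => w (t, x)))
        (∫ x, ∑ i, varDeriv F (fun y => w (t₀, y)) x i * deriv (fun t => w (t, x) i) t₀) t₀

/-- `B` is a Poisson bracket on the algebra of smooth functionals of fields `ℝ → U`: it maps
smooth functionals to smooth functionals, is bilinear (linear in the first argument and skew),
satisfies the Leibniz rule and the Jacobi identity. -/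
structure IsPoissonBracket {N : ℕ} (U : Set (Fin N → ℝ))
    (B : Functional N → Functional N → Functional N) : Prop where
  smooth : ∀ I J, IsSmoothFunctional U I → IsSmoothFunctional U J →
    IsSmoothFunctional U (B I J)
  add_left : ∀ I J L, IsSmoothFunctional U I → IsSmoothFunctional U J →
    IsSmoothFunctional U L → ∀ u, IsField U u → B (I + J) L u = B I L u + B J L u
  smul_left : ∀ (c : ℝ) (I J), IsSmoothFunctional U I → IsSmoothFunctional U J →
    ∀ u, IsField U u → B (c • I) J u = c * B I J u
  skew : ∀ I J, IsSmoothFunctional U I → IsSmoothFunctional U J →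
    ∀ u, IsField U u → B I J u = - B J I u
  leibniz : ∀ I J L, IsSmoothFunctional U I → IsSmoothFunctional U J →
    IsSmoothFunctional U L → ∀ u, IsField U u →
      B (I * J) L u = I u * B J L u + B I L u * J u
  jacobi : ∀ I J L, IsSmoothFunctional U I → IsSmoothFunctional U J →
    IsSmoothFunctional U L → ∀ u, IsField U u →
      B (B I J) L u + B (B J L) I u + B (B L I) J u = 0

/-- Two brackets are compatible if every linear combination of them is a Poisson bracket. -/
def Compatible {N : ℕ} (U : Set (Fin N → ℝ))
    (B₁ B₂ : Functional N → Functional N → Functional N) : Prop :=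
  ∀ c₁ c₂ : ℝ, IsPoissonBracket U (fun I J u => c₁ * B₁ I J u + c₂ * B₂ I J u)

/-- The skew-adjoint inverse `(d/dx)⁻¹` of `d/dx` on the line,
`f ↦ ½ ∫ sgn(x - y) f(y) dy`, applied to compactly supported functions. -/
def dxInv (f : ℝ → ℝ) (x : ℝ) : ℝ :=
  (1 / 2) * ((∫ y in Set.Iic x, f y) - ∫ y in Set.Ioi x, f y)

/-- The `i`-th component at `x` of
`(gⁱʲ(u) d/dx + bⁱʲₖ(u) uᵏₓ + K uⁱₓ (d/dx)⁻¹ uʲₓ) ξⱼ`; here `b v i j k` is `bⁱʲₖ(v)`. -/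
def operator {N : ℕ} (g : (Fin N → ℝ) → Fin N → Fin N → ℝ)
    (b : (Fin N → ℝ) → Fin N → Fin N → Fin N → ℝ) (K : ℝ)
    (u ξ : ℝ → Fin N → ℝ) (x : ℝ) (i : Fin N) : ℝ :=
  ∑ j, (g (u x) i j * deriv (fun y => ξ y j) x
    + (∑ k, b (u x) i j k * deriv (fun y => u y k) x) * ξ x j
    + K * deriv (fun y => u y i) x * dxInv (fun y => deriv (fun z => u z j) y * ξ y j) x)

/-- The Mokhov–Ferapontov bracket with coefficients `gⁱʲ(u)`, `bⁱʲₖ(u)` and constant `K`. -/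
def bracket {N : ℕ} (g : (Fin N → ℝ) → Fin N → Fin N → ℝ)
    (b : (Fin N → ℝ) → Fin N → Fin N → Fin N → ℝ) (K : ℝ) (I J : Functional N) :
    Functional N :=
  fun u => ∫ x, ∑ i, varDeriv I u x i * operator g b K u (varDeriv J u) x i

/-- The partial derivative `∂f/∂uˢ`. -/
def pderiv {N : ℕ} (s : Fin N) (f : (Fin N → ℝ) → ℝ) (v : Fin N → ℝ) : ℝ :=
  fderiv ℝ f v (Pi.single s 1)

end HydroBracket

end

open scoped ContDiff Topology

noncomputable section

set_option linter.unusedSectionVars false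

namespace HydroBracket

/-! Put `Gⁱʲ = g₁ⁱʲ + K₁uⁱuʲ` and `Γⁱʲₖ = b₁ⁱʲₖ + K₁δⁱₖuʲ`; the formulas to be proved say that `Γ`
is `η` times the Hessians of the `Hʲ`, and that `G` is `η∂H` plus its transpose. These combinations
come from the bracket itself. Writing `uⁱₓξᵢ = (uⁱξᵢ)' - uⁱξᵢ'` on both sides of `(d/dx)⁻¹` and
integrating by parts moves the local remainders into `G` and `Γ`, and leaves the nonlocal term
`K₁∫(uⁱξᵢ')(d/dx)⁻¹(uʲζⱼ')` (`pairing_eq_shift`).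

The Jacobi identity for `c₁{,}₁ + c₂{,}₂` is quadratic in `(c₁, c₂)`. Its square terms are the
Jacobi identities of the two brackets, so compatibility amounts to the mixed term. Since `{F, L}₂`
is the derivative of `F` along `η d/dx (δL/δu)`, the mixed term can be computed without a formula
for the variational derivative of `{I, J}₁`. The terms with second variations cancel, by symmetry of
the second variation (`secondVar_symm`) and skewness. What is left is `cyclicVariation`: the cyclic
sum of the variations of the pairing along `ηθ'` with the covectors held fixed. Its nonlocal part
vanishes (`nonlocalVariation_cyclic`), because `η` is symmetric and `(d/dx)⁻¹` is skew.

Skewness of the first bracket gives `gⁱʲ = gʲⁱ` and `∂ₖgⁱʲ = bⁱʲₖ + bʲⁱₖ`, and the second relation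
passes to `G` and `Γ`. One more integration by parts (`integral_localVariation`) leaves terms
trilinear in the covectors with coefficients `Γⁱʲₛηˢᵗ`, and terms with `∂ₛΓⁱʲₖ - ∂ₖΓⁱʲₛ`. The cyclic
sum vanishes for all fields and covectors exactly when `Γⁱʲₛηˢᵗ` is symmetric in `i, t` and the curl
is zero. Necessity is tested on covectors with one component: constant fields isolate the symmetry,
fields moving in one coordinate isolate the curl (`shiftB_symm_of_cyclic`, `curl_shiftB_of_cyclic`).

These two conditions are integrability conditions. With the first index lowered by `η⁻¹`, `Γ`
becomes a closed form in `k` that is symmetric in its two lower indices, so the Poincaré lemma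
applied twice yields `H` (`exists_potentials_of_structure`). Then `G` agrees with `η∂H` plus its
transpose up to a constant symmetric matrix, which is absorbed into the linear part of `H`.
Conversely, equality of mixed partials gives both conditions (`structure_of_potentials`). -/

open MeasureTheory Filter

/-! ### Parameter families of functions on the line: joint smoothness and uniform supports. -/

section Families

variable {E F : Type*} [NormedAddCommGroup E] [NormedSpace ℝ E]
  [NormedAddCommGroup F] [NormedSpace ℝ F]

/-- A family `f (t, x)` of functions of `x ∈ ℝ` is jointly smooth for parameters `t` near `t₀`. -/
def SmoothNear (f : E × ℝ → F) (t₀ : E) : Prop :=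
  ∀ᶠ t in 𝓝 t₀, ∀ x, ContDiffAt ℝ ∞ f (t, x)

/-- The functions `f (t, ·)` vanish outside one bounded interval for `t` near `t₀`. -/
def SuppNear (f : E × ℝ → F) (t₀ : E) : Prop :=
  ∃ R : ℝ, ∀ᶠ t in 𝓝 t₀, ∀ x, R < |x| → f (t, x) = 0

theorem SmoothNear.eventually {f : E × ℝ → F} {t₀ : E} (h : SmoothNear f t₀) :
    ∀ᶠ t in 𝓝 t₀, SmoothNear f t :=
  eventually_eventually_nhds.2 h

theorem SmoothNear.self {f : E × ℝ → F} {t₀ : E} (h : SmoothNear f t₀) (x : ℝ) :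
    ContDiffAt ℝ ∞ f (t₀, x) :=
  h.self_of_nhds x

theorem _root_.ContDiff.smoothNear {f : E × ℝ → F} (h : ContDiff ℝ ∞ f) (t₀ : E) :
    SmoothNear f t₀ :=
  Eventually.of_forall fun _ _ => h.contDiffAt

theorem _root_.ContDiff.smoothNear_snd {f : ℝ → F} (h : ContDiff ℝ ∞ f) (t₀ : E) :
    SmoothNear (fun p : E × ℝ => f p.2) t₀ :=
  (h.comp contDiff_snd).smoothNear t₀

theorem SmoothNear.congr {f g : E × ℝ → F} {t₀ : E} (h : SmoothNear f t₀)
    (he : ∀ᶠ t in 𝓝 t₀, ∀ x, g (t, x) = f (t, x)) : SmoothNear g t₀ := by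
  filter_upwards [h, he.eventually_nhds] with t ht het x
  refine (ht x).congr_of_eventuallyEq ?_
  filter_upwards [het.prod_inl_nhds x] with p hp
  exact hp p.2

theorem SmoothNear.add {f g : E × ℝ → F} {t₀ : E} (hf : SmoothNear f t₀)
    (hg : SmoothNear g t₀) : SmoothNear (fun p => f p + g p) t₀ := by
  filter_upwards [hf, hg] with t h1 h2 x using (h1 x).add (h2 x)

theorem SmoothNear.sub {f g : E × ℝ → F} {t₀ : E} (hf : SmoothNear f t₀)
    (hg : SmoothNear g t₀) : SmoothNear (fun p => f p - g p) t₀ := by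
  filter_upwards [hf, hg] with t h1 h2 x using (h1 x).sub (h2 x)

theorem SmoothNear.smul {c : E × ℝ → ℝ} {g : E × ℝ → F} {t₀ : E} (hf : SmoothNear c t₀)
    (hg : SmoothNear g t₀) : SmoothNear (fun p => c p • g p) t₀ := by
  filter_upwards [hf, hg] with t h1 h2 x using (h1 x).smul (h2 x)

theorem SmoothNear.mul {f g : E × ℝ → ℝ} {t₀ : E} (hf : SmoothNear f t₀)
    (hg : SmoothNear g t₀) : SmoothNear (fun p => f p * g p) t₀ := by
  filter_upwards [hf, hg] with t h1 h2 x using (h1 x).mul (h2 x)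

theorem SmoothNear.const (c : F) (t₀ : E) : SmoothNear (fun _ : E × ℝ => c) t₀ :=
  contDiff_const.smoothNear t₀

theorem SmoothNear.sum {ι : Type*} {s : Finset ι} {f : ι → E × ℝ → F} {t₀ : E}
    (hf : ∀ i ∈ s, SmoothNear (f i) t₀) : SmoothNear (fun p => ∑ i ∈ s, f i p) t₀ := by
  have : ∀ᶠ t in 𝓝 t₀, ∀ i ∈ s, ∀ x, ContDiffAt ℝ ∞ (f i) (t, x) :=
    (Finset.eventually_all s).2 hf
  filter_upwards [this] with t ht x
  exact ContDiffAt.sum fun i hi => ht i hi x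

theorem SmoothNear.apply {N : ℕ} {f : E × ℝ → Fin N → ℝ} {t₀ : E} (hf : SmoothNear f t₀)
    (i : Fin N) : SmoothNear (fun p => f p i) t₀ := by
  filter_upwards [hf] with t h1 x using contDiffAt_pi.1 (h1 x) i

theorem SmoothNear.pi {N : ℕ} {f : E × ℝ → Fin N → ℝ} {t₀ : E}
    (hf : ∀ i, SmoothNear (fun p => f p i) t₀) : SmoothNear f t₀ := by
  filter_upwards [eventually_all.2 hf] with t h1 x using contDiffAt_pi.2 fun i => h1 i x

theorem SmoothNear.hasDerivAt_snd {f : E × ℝ → F} {t₀ : E} (h : SmoothNear f t₀) (x : ℝ) :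
    HasDerivAt (fun y => f (t₀, y)) (fderiv ℝ f (t₀, x) (0, 1)) x := by
  have h1 := ((h.self x).differentiableAt (by simp)).hasFDerivAt
  have h2 : HasDerivAt (fun y : ℝ => (t₀, y)) ((0 : E), (1 : ℝ)) x :=
    (hasDerivAt_const x t₀).prodMk (hasDerivAt_id x)
  exact h1.comp_hasDerivAt x h2

/-- The partial derivative in `x` is the joint Fréchet derivative evaluated on `(0, 1)`, which is
again jointly smooth. -/
theorem SmoothNear.dx {f : E × ℝ → F} {t₀ : E} (h : SmoothNear f t₀) :
    SmoothNear (fun p => deriv (fun y => f (p.1, y)) p.2) t₀ := by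
  have : SmoothNear (fun p => fderiv ℝ f p ((0 : E), (1 : ℝ))) t₀ := by
    filter_upwards [h] with t ht x
    exact ((ht x).fderiv_right (m := ∞) (by simp)).clm_apply contDiffAt_const
  refine this.congr ?_
  filter_upwards [h.eventually] with t ht x
  exact (ht.hasDerivAt_snd x).deriv

theorem SmoothNear.contDiff_slice {f : E × ℝ → F} {t₀ : E} (h : SmoothNear f t₀) :
    ContDiff ℝ ∞ fun x => f (t₀, x) :=
  contDiff_iff_contDiffAt.2 fun x =>
    (h.self x).comp x (contDiff_prodMk_right t₀).contDiffAt

theorem SuppNear.slice {f : E × ℝ → F} {t₀ : E} (h : SuppNear f t₀) :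
    HasCompactSupport fun x => f (t₀, x) := by
  obtain ⟨R, hR⟩ := h
  refine HasCompactSupport.intro (isCompact_Icc (a := -R) (b := R)) fun x hx => ?_
  refine hR.self_of_nhds x ?_
  by_contra! hle
  exact hx (abs_le.1 hle)

theorem SuppNear.eventually {f : E × ℝ → F} {t₀ : E} (h : SuppNear f t₀) :
    ∀ᶠ t in 𝓝 t₀, SuppNear f t := by
  obtain ⟨R, hR⟩ := h
  exact (eventually_eventually_nhds.2 hR).mono fun t ht => ⟨R, ht⟩

theorem SuppNear.dx {f : E × ℝ → F} {t₀ : E} (h : SuppNear f t₀) :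
    SuppNear (fun p => deriv (fun y => f (p.1, y)) p.2) t₀ := by
  obtain ⟨R, hR⟩ := h
  refine ⟨R, ?_⟩
  filter_upwards [hR] with t ht x hx
  have : (fun y => f (t, y)) =ᶠ[𝓝 x] fun _ => 0 := by
    filter_upwards [continuous_abs.continuousAt.eventually (lt_mem_nhds hx)] with y hy
    exact ht y hy
  simp [this.deriv_eq]

theorem SuppNear.of_imp {F' : Type*} [NormedAddCommGroup F'] {f : E × ℝ → F} {g : E × ℝ → F'}
    {t₀ : E} (h : SuppNear f t₀)
    (hfg : ∀ p, f p = 0 → g p = 0) : SuppNear g t₀ := by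
  obtain ⟨R, hR⟩ := h
  exact ⟨R, hR.mono fun t ht x hx => hfg _ (ht x hx)⟩

theorem SuppNear.apply {N : ℕ} {f : E × ℝ → Fin N → ℝ} {t₀ : E} (hf : SuppNear f t₀)
    (i : Fin N) : SuppNear (fun p => f p i) t₀ :=
  hf.of_imp fun p hp => by simp [hp]

theorem SuppNear.mul_right {f : E × ℝ → ℝ} {t₀ : E} (hf : SuppNear f t₀) (g : E × ℝ → ℝ) :
    SuppNear (fun p => f p * g p) t₀ :=
  hf.of_imp fun p hp => by simp [hp]

theorem SuppNear.mul_left {f : E × ℝ → ℝ} {t₀ : E} (hf : SuppNear f t₀) (g : E × ℝ → ℝ) :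
    SuppNear (fun p => g p * f p) t₀ :=
  hf.of_imp fun p hp => by simp [hp]

theorem SuppNear.add {f g : E × ℝ → F} {t₀ : E} (hf : SuppNear f t₀) (hg : SuppNear g t₀) :
    SuppNear (fun p => f p + g p) t₀ := by
  obtain ⟨R, hR⟩ := hf
  obtain ⟨S, hS⟩ := hg
  refine ⟨max R S, ?_⟩
  filter_upwards [hR, hS] with t h1 h2 x hx
  rw [h1 x ((le_max_left _ _).trans_lt hx), h2 x ((le_max_right _ _).trans_lt hx), add_zero]

theorem SuppNear.sum {ι : Type*} {s : Finset ι} {f : ι → E × ℝ → F} {t₀ : E}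
    (hf : ∀ i ∈ s, SuppNear (f i) t₀) : SuppNear (fun p => ∑ i ∈ s, f i p) t₀ := by
  classical
  induction s using Finset.induction_on with
  | empty => exact ⟨0, by simp⟩
  | insert a s ha ih =>
    simp only [Finset.sum_insert ha]
    exact (hf a (Finset.mem_insert_self _ _)).add
      (ih fun i hi => hf i (Finset.mem_insert_of_mem hi))

theorem SuppNear.pi {N : ℕ} {f : E × ℝ → Fin N → ℝ} {t₀ : E}
    (hf : ∀ i, SuppNear (fun p => f p i) t₀) : SuppNear f t₀ := by
  choose R hR using hf
  refine ⟨∑ i, |R i|, ?_⟩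
  filter_upwards [eventually_all.2 hR] with t ht x hx
  ext i
  exact ht i x ((le_abs_self _).trans_lt
    ((Finset.single_le_sum (f := fun i => |R i|) (fun j _ => abs_nonneg _)
      (Finset.mem_univ i)).trans_lt hx))

theorem suppNear_snd {f : ℝ → F} (h : HasCompactSupport f) (t₀ : E) :
    SuppNear (fun p : E × ℝ => f p.2) t₀ := by
  obtain ⟨R, hR⟩ := h.isCompact.isBounded.exists_norm_le
  refine ⟨R, Eventually.of_forall fun t x hx => ?_⟩
  by_contra hne
  exact absurd (hR x (subset_tsupport _ hne)) (not_le.2 hx)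

end Families

theorem SmoothNear.hasDerivAt_fst {F : Type*} [NormedAddCommGroup F] [NormedSpace ℝ F]
    {f : ℝ × ℝ → F} {t₀ : ℝ} (h : SmoothNear f t₀) (x : ℝ) :
    HasDerivAt (fun t => f (t, x)) (fderiv ℝ f (t₀, x) (1, 0)) t₀ := by
  have h1 := ((h.self x).differentiableAt (by simp)).hasFDerivAt
  have h2 : HasDerivAt (fun t : ℝ => (t, x)) ((1 : ℝ), (0 : ℝ)) t₀ :=
    (hasDerivAt_id t₀).prodMk (hasDerivAt_const t₀ x)
  exact h1.comp_hasDerivAt t₀ h2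

theorem SmoothNear.dt {F : Type*} [NormedAddCommGroup F] [NormedSpace ℝ F]
    {f : ℝ × ℝ → F} {t₀ : ℝ} (h : SmoothNear f t₀) :
    SmoothNear (fun p => deriv (fun t => f (t, p.2)) p.1) t₀ := by
  have : SmoothNear (fun p => fderiv ℝ f p ((1 : ℝ), (0 : ℝ))) t₀ := by
    filter_upwards [h] with t ht x
    exact ((ht x).fderiv_right (m := ∞) (by simp)).clm_apply contDiffAt_const
  refine this.congr ?_
  filter_upwards [h.eventually] with t ht x
  exact (ht.hasDerivAt_fst x).deriv

theorem SuppNear.dt {F : Type*} [NormedAddCommGroup F] [NormedSpace ℝ F]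
    {f : ℝ × ℝ → F} {t₀ : ℝ} (h : SuppNear f t₀) :
    SuppNear (fun p => deriv (fun t => f (t, p.2)) p.1) t₀ := by
  obtain ⟨R, hR⟩ := h
  refine ⟨R, ?_⟩
  filter_upwards [hR.eventually_nhds] with t ht x hx
  have : (fun t => f (t, x)) =ᶠ[𝓝 t] fun _ => 0 := ht.mono fun s hs => hs x hx
  simp [this.deriv_eq]

/-- Mixed partial derivatives commute. -/
theorem SmoothNear.hasDerivAt_dx {F : Type*} [NormedAddCommGroup F] [NormedSpace ℝ F]
    {f : ℝ × ℝ → F} {t₀ : ℝ} (h : SmoothNear f t₀) (x : ℝ) :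
    HasDerivAt (fun t => deriv (fun y => f (t, y)) x)
      (deriv (fun y => deriv (fun t => f (t, y)) t₀) x) t₀ := by
  have hd : HasFDerivAt (fderiv ℝ f) (fderiv ℝ (fderiv ℝ f) (t₀, x)) (t₀, x) :=
    (((h.self x).fderiv_right (m := ∞) (by simp)).differentiableAt (by simp)).hasFDerivAt
  have hsymm := (h.self x).isSymmSndFDerivAt
    (by rw [minSmoothness_of_isRCLikeNormedField]; exact WithTop.coe_le_coe.2 le_top) (1, 0) (0, 1)
  have h1 : HasDerivAt (fun t => fderiv ℝ f (t, x) ((0 : ℝ), (1 : ℝ)))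
      (fderiv ℝ (fderiv ℝ f) (t₀, x) (1, 0) (0, 1)) t₀ := by
    have h2 : HasDerivAt (fun t : ℝ => (t, x)) ((1 : ℝ), (0 : ℝ)) t₀ :=
      (hasDerivAt_id t₀).prodMk (hasDerivAt_const t₀ x)
    have h5 : HasDerivAt (fun t => fderiv ℝ f (t, x))
        (fderiv ℝ (fderiv ℝ f) (t₀, x) (1, 0)) t₀ := hd.comp_hasDerivAt t₀ h2
    simpa using h5.clm_apply (hasDerivAt_const t₀ ((0 : ℝ), (1 : ℝ)))
  have h3 : HasDerivAt (fun y => fderiv ℝ f (t₀, y) ((1 : ℝ), (0 : ℝ)))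
      (fderiv ℝ (fderiv ℝ f) (t₀, x) (0, 1) (1, 0)) x := by
    have h2 : HasDerivAt (fun y : ℝ => (t₀, y)) ((0 : ℝ), (1 : ℝ)) x :=
      (hasDerivAt_const x t₀).prodMk (hasDerivAt_id x)
    have h5 : HasDerivAt (fun y => fderiv ℝ f (t₀, y))
        (fderiv ℝ (fderiv ℝ f) (t₀, x) (0, 1)) x := hd.comp_hasDerivAt x h2
    simpa using h5.clm_apply (hasDerivAt_const x ((1 : ℝ), (0 : ℝ)))
  have h4 : (fun y => deriv (fun t => f (t, y)) t₀) =
      fun y => fderiv ℝ f (t₀, y) ((1 : ℝ), (0 : ℝ)) :=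
    funext fun y => (h.hasDerivAt_fst y).deriv
  rw [h4, h3.deriv, ← hsymm]
  refine h1.congr_of_eventuallyEq ?_
  filter_upwards [h.eventually] with t ht
  exact (ht.hasDerivAt_snd x).deriv

/-! ### Differentiation under the integral sign. -/

section ParametricIntegral

variable {E Z : Type*} [NormedAddCommGroup E] [NormedSpace ℝ E]
  [NormedAddCommGroup Z] [NormedSpace ℝ Z] [MeasurableSpace Z] [BorelSpace Z]
  [SecondCountableTopology Z] {μ : Measure Z} [IsFiniteMeasureOnCompacts μ]

/-- Differentiation under the integral sign for a family with common compact support, with a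
bounded measurable weight `s`. -/
theorem hasFDerivAt_integral_weight {f : E × Z → ℝ} {s : Z → ℝ} {t₀ : E} {k : Set Z}
    (hk : IsCompact k) (hs : Measurable s) (hs1 : ∀ z, |s z| ≤ 1)
    (hf : ∀ᶠ t in 𝓝 t₀, ∀ z, ContDiffAt ℝ 1 f (t, z))
    (hsupp : ∀ᶠ t in 𝓝 t₀, ∀ z, z ∉ k → f (t, z) = 0) :
    Integrable (fun z => s z • (fderiv ℝ f (t₀, z)).comp (ContinuousLinearMap.inl ℝ E Z)) μ ∧
    HasFDerivAt (fun t => ∫ z, s z * f (t, z) ∂μ)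
      (∫ z, s z • (fderiv ℝ f (t₀, z)).comp (ContinuousLinearMap.inl ℝ E Z) ∂μ) t₀ := by
  set f' : E → Z → E →L[ℝ] ℝ :=
    fun t z => (fderiv ℝ f (t, z)).comp (ContinuousLinearMap.inl ℝ E Z) with hf'
  have hcont : ∀ᶠ t in 𝓝 t₀, Continuous fun z => f (t, z) := by
    filter_upwards [hf] with t ht
    exact continuous_iff_continuousAt.2 fun z => (ht z).continuousAt.comp
      (Continuous.prodMk_right t).continuousAt
  have hderiv : ∀ᶠ t in 𝓝 t₀, ∀ z, HasFDerivAt (fun t => f (t, z)) (f' t z) t := by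
    filter_upwards [hf] with t ht z
    exact ((ht z).differentiableAt (by simp)).hasFDerivAt.comp t (hasFDerivAt_prodMk_left t z)
  have hcont' : ∀ z, ContinuousAt (fun p : E × Z => f' p.1 p.2) (t₀, z) := by
    intro z
    have h1 : ContinuousAt (fderiv ℝ f) (t₀, z) :=
      ((hf.self_of_nhds z).fderiv_right (m := 0) (by simp)).continuousAt
    exact h1.clm_comp continuousAt_const
  have hzero : ∀ᶠ t in 𝓝 t₀, ∀ z, z ∉ k → f' t z = 0 := by
    filter_upwards [hsupp.eventually_nhds, hderiv] with t ht h2 z hz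
    have : (fun t => f (t, z)) =ᶠ[𝓝 t] fun _ => 0 := ht.mono fun s hs => hs z hz
    rw [← (h2 z).fderiv, this.fderiv_eq]
    simp
  have hcs : Continuous (f' t₀) := continuous_iff_continuousAt.2 fun z =>
    (hcont' z).comp (f := fun z => (t₀, z)) (Continuous.prodMk_right t₀).continuousAt
  obtain ⟨C, hC⟩ : ∃ C, ∀ z ∈ k, ‖f' t₀ z‖ ≤ C := hk.exists_bound_of_continuousOn hcs.continuousOn
  -- Compactness of `k` turns the pointwise bound at `t₀` into a bound valid for all `t` near `t₀`;
  -- this supplies the dominating function.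
  have hbd : ∀ᶠ t in 𝓝 t₀, ∀ z ∈ k, ‖f' t z‖ ≤ C + 1 := by
    refine hk.eventually_forall_of_forall_eventually fun z hz => ?_
    have := (hcont' z).norm.eventually (gt_mem_nhds ((hC z hz).trans_lt (lt_add_one C)))
    exact this.mono fun p hp => hp.le
  have hC0 : 0 ≤ C + 1 ∨ k = ∅ := by
    rcases k.eq_empty_or_nonempty with h | ⟨z, hz⟩
    · exact Or.inr h
    · exact Or.inl (by linarith [norm_nonneg (f' t₀ z), hC z hz])
  obtain ⟨S, hS, hS'⟩ := eventually_iff_exists_mem.1 (hderiv.and (hzero.and hbd))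
  have hbound_int : Integrable (k.indicator fun _ => C + 1) μ :=
    (integrable_indicator_iff hk.measurableSet).2 (integrableOn_const hk.measure_lt_top.ne)
  have hle : ∀ t ∈ S, ∀ z, ‖s z • f' t z‖ ≤ k.indicator (fun _ => C + 1) z := by
    intro t ht z
    by_cases hz : z ∈ k
    · rw [Set.indicator_of_mem hz, norm_smul, Real.norm_eq_abs]
      calc |s z| * ‖f' t z‖ ≤ 1 * (C + 1) :=
            mul_le_mul (hs1 z) ((hS' t ht).2.2 z hz) (norm_nonneg _) zero_le_one
        _ = C + 1 := one_mul _
    · rw [Set.indicator_of_notMem hz, (hS' t ht).2.1 z hz]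
      simp
  have hmeas : AEStronglyMeasurable (fun z => s z • f' t₀ z) μ :=
    hs.aestronglyMeasurable.smul hcs.aestronglyMeasurable
  refine ⟨hbound_int.mono' hmeas (Eventually.of_forall (hle t₀ (mem_of_mem_nhds hS))), ?_⟩
  refine hasFDerivAt_integral_of_dominated_of_fderiv_le (bound := k.indicator fun _ => C + 1)
    (F' := fun t z => s z • f' t z) hS ?_ ?_ hmeas ?_ hbound_int ?_
  · filter_upwards [hcont] with t ht
    exact hs.aestronglyMeasurable.mul ht.aestronglyMeasurable
  · have hc := hcont.self_of_nhds
    have hint : Integrable (fun z => f (t₀, z)) μ :=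
      hc.integrable_of_hasCompactSupport (HasCompactSupport.intro hk hsupp.self_of_nhds)
    refine hint.bdd_mul (c := 1) hs.aestronglyMeasurable (Eventually.of_forall fun z => ?_)
    simpa using hs1 z
  · exact Eventually.of_forall fun z t ht => hle t ht z
  · exact Eventually.of_forall fun z t ht => ((hS' t ht).1 z).const_mul (s z)

theorem hasDerivAt_integral_weight {f : ℝ × Z → ℝ} {s f' : Z → ℝ} {t₀ : ℝ} {k : Set Z}
    (hk : IsCompact k) (hs : Measurable s) (hs1 : ∀ z, |s z| ≤ 1)
    (hf : ∀ᶠ t in 𝓝 t₀, ∀ z, ContDiffAt ℝ 1 f (t, z))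
    (hsupp : ∀ᶠ t in 𝓝 t₀, ∀ z, z ∉ k → f (t, z) = 0)
    (hf' : ∀ z, HasDerivAt (fun t => f (t, z)) (f' z) t₀) :
    HasDerivAt (fun t => ∫ z, s z * f (t, z) ∂μ) (∫ z, s z * f' z ∂μ) t₀ := by
  obtain ⟨hi, hd⟩ := hasFDerivAt_integral_weight (μ := μ) hk hs hs1 hf hsupp
  refine hd.hasDerivAt.congr_deriv ?_
  rw [ContinuousLinearMap.integral_apply hi]
  refine integral_congr_ae (Eventually.of_forall fun z => ?_)
  have h1 : HasFDerivAt (fun t => f (t, z))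
      ((fderiv ℝ f (t₀, z)).comp (ContinuousLinearMap.inl ℝ ℝ Z)) t₀ :=
    ((hf.self_of_nhds z).differentiableAt (by simp)).hasFDerivAt.comp t₀
      (hasFDerivAt_prodMk_left t₀ z)
  simp [← (hf' z).unique h1.hasDerivAt]

end ParametricIntegral

theorem SmoothNear.hasFDerivAt_integral {E : Type*} [NormedAddCommGroup E] [NormedSpace ℝ E]
    {f : E × ℝ → ℝ} {t₀ : E} (hf : SmoothNear f t₀) (hs : SuppNear f t₀) :
    Integrable (fun x => (fderiv ℝ f (t₀, x)).comp (ContinuousLinearMap.inl ℝ E ℝ)) ∧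
    HasFDerivAt (fun t => ∫ x, f (t, x))
      (∫ x, (fderiv ℝ f (t₀, x)).comp (ContinuousLinearMap.inl ℝ E ℝ)) t₀ := by
  obtain ⟨R, hR⟩ := hs
  have := hasFDerivAt_integral_weight (μ := volume) (f := f) (s := fun _ => 1)
    (isCompact_Icc (a := -R) (b := R)) measurable_const (by simp)
    (hf.mono fun t ht x => (ht x).of_le (by simp))
    (hR.mono fun t ht x hx => ht x (by by_contra! hle; exact hx (abs_le.1 hle)))
  simpa using this

theorem SmoothNear.hasDerivAt_integral {f : ℝ × ℝ → ℝ} {f' : ℝ → ℝ} {t₀ : ℝ}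
    (hf : SmoothNear f t₀) (hs : SuppNear f t₀)
    (hf' : ∀ x, HasDerivAt (fun t => f (t, x)) (f' x) t₀) :
    HasDerivAt (fun t => ∫ x, f (t, x)) (∫ x, f' x) t₀ := by
  obtain ⟨R, hR⟩ := hs
  have := hasDerivAt_integral_weight (μ := volume) (f := f) (s := fun _ => 1)
    (isCompact_Icc (a := -R) (b := R)) measurable_const (by simp)
    (hf.mono fun t ht x => (ht x).of_le (by simp))
    (hR.mono fun t ht x hx => ht x (by by_contra! hle; exact hx (abs_le.1 hle))) hf'
  simpa using this

/-! ### Variational derivatives and linear functionals. -/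

section VarDeriv

variable {N : ℕ}

theorem integrable_pairing {ξ φ : ℝ → Fin N → ℝ} (hξ : Continuous ξ) (hs : HasCompactSupport ξ)
    (hφ : Continuous φ) : Integrable fun x => ∑ i, ξ x i * φ x i := by
  refine Continuous.integrable_of_hasCompactSupport (by fun_prop) ?_
  refine hs.mono' fun x hx => subset_tsupport _ fun h0 => hx ?_
  simp [h0]

theorem eq_zero_of_integral_mul_self {f : ℝ → ℝ} (hf : Continuous f) (hs : HasCompactSupport f)
    (h : ∫ x, f x * f x = 0) : f = 0 := by
  have h1 : (fun x => f x * f x) =ᵐ[volume] 0 := by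
    refine (integral_eq_zero_iff_of_nonneg (fun x => mul_self_nonneg _) ?_).1 h
    exact (hf.mul hf).integrable_of_hasCompactSupport hs.mul_right
  have h2 := (Continuous.ae_eq_iff_eq volume (hf.mul hf) continuous_const).1 h1
  ext x
  exact mul_self_eq_zero.1 (congrFun h2 x)

theorem eq_zero_of_integral_pairing_self {f : ℝ → Fin N → ℝ} (hf : Continuous f)
    (hs : HasCompactSupport f) (h : ∫ x, ∑ i, f x i * f x i = 0) : f = 0 := by
  have h1 : (fun x => ∑ i, f x i * f x i) =ᵐ[volume] 0 :=
    (integral_eq_zero_iff_of_nonneg (fun x => Finset.sum_nonneg fun i _ => mul_self_nonneg _)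
      (integrable_pairing hf hs hf)).1 h
  have h2 := (Continuous.ae_eq_iff_eq volume (by fun_prop) continuous_const).1 h1
  ext x i
  exact mul_self_eq_zero.1 ((Finset.sum_eq_zero_iff_of_nonneg fun i _ => mul_self_nonneg _).1
    (congrFun h2 x) i (Finset.mem_univ i))

/-- The difference of two candidates is itself an admissible direction; pairing it with itself gives
a vanishing integral of squares. -/
theorem HasVarDeriv.unique {F : Functional N} {u ξ ξ' : ℝ → Fin N → ℝ}
    (h : HasVarDeriv F u ξ) (h' : HasVarDeriv F u ξ') : ξ = ξ' := by
  have hd : ContDiff ℝ ∞ (ξ - ξ') := h.1.sub h'.1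
  have hc : HasCompactSupport (ξ - ξ') := h.2.1.sub h'.2.1
  have he := (h.2.2 _ hd hc).unique (h'.2.2 _ hd hc)
  refine sub_eq_zero.1 (eq_zero_of_integral_pairing_self hd.continuous hc ?_)
  rw [← sub_eq_zero, ← integral_sub (integrable_pairing h.1.continuous h.2.1 hd.continuous)
    (integrable_pairing h'.1.continuous h'.2.1 hd.continuous)] at he
  rw [← he]
  refine integral_congr_ae (Eventually.of_forall fun x => ?_)
  simp only [← Finset.sum_sub_distrib]
  exact Finset.sum_congr rfl fun i _ => by simp only [Pi.sub_apply]; ring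

theorem HasVarDeriv.varDeriv_eq {F : Functional N} {u ξ : ℝ → Fin N → ℝ}
    (h : HasVarDeriv F u ξ) : varDeriv F u = ξ := by
  have he : ∃ ξ, HasVarDeriv F u ξ := ⟨ξ, h⟩
  rw [varDeriv, dif_pos he]
  exact he.choose_spec.unique h

theorem IsSmoothFunctional.hasVarDeriv {U : Set (Fin N → ℝ)} {F : Functional N}
    (hF : IsSmoothFunctional U F) {u : ℝ → Fin N → ℝ} (hu : IsField U u) :
    HasVarDeriv F u (varDeriv F u) := by
  obtain ⟨ξ, hξ⟩ := hF.exists_varDeriv u hu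
  rwa [hξ.varDeriv_eq]

theorem HasVarDeriv.add {F G : Functional N} {u ξ ζ : ℝ → Fin N → ℝ}
    (hF : HasVarDeriv F u ξ) (hG : HasVarDeriv G u ζ) : HasVarDeriv (F + G) u (ξ + ζ) := by
  refine ⟨hF.1.add hG.1, hF.2.1.add hG.2.1, fun φ hφ hφs => ?_⟩
  refine ((hF.2.2 φ hφ hφs).add (hG.2.2 φ hφ hφs)).congr_deriv ?_
  rw [← integral_add (integrable_pairing hF.1.continuous hF.2.1 hφ.continuous)
    (integrable_pairing hG.1.continuous hG.2.1 hφ.continuous)]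
  refine integral_congr_ae (Eventually.of_forall fun x => ?_)
  simp [add_mul, Finset.sum_add_distrib]

theorem HasVarDeriv.smul {F : Functional N} {u ξ : ℝ → Fin N → ℝ} (c : ℝ)
    (hF : HasVarDeriv F u ξ) : HasVarDeriv (c • F) u (c • ξ) := by
  refine ⟨hF.1.const_smul c, hF.2.1.smul_left (f := fun _ => c), fun φ hφ hφs => ?_⟩
  refine ((hF.2.2 φ hφ hφs).const_mul c).congr_deriv ?_
  rw [← integral_const_mul]
  simp [Finset.mul_sum, mul_assoc]

theorem HasVarDeriv.mul {F G : Functional N} {u ξ ζ : ℝ → Fin N → ℝ}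
    (hF : HasVarDeriv F u ξ) (hG : HasVarDeriv G u ζ) :
    HasVarDeriv (F * G) u (G u • ξ + F u • ζ) := by
  have h := (hF.smul (G u)).add (hG.smul (F u))
  refine ⟨h.1, h.2.1, fun φ hφ hφs => ?_⟩
  have h1 := (hF.2.2 φ hφ hφs).mul (hG.2.2 φ hφ hφs)
  refine h1.congr_deriv (((h.2.2 φ hφ hφs).unique ?_).symm)
  have h2 := ((hF.2.2 φ hφ hφs).const_mul (G u)).add ((hG.2.2 φ hφ hφs).const_mul (F u))
  refine h2.congr_deriv ?_
  simp
  ring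

/-- The linear functional `u ↦ ∫ ξᵢ(x) uⁱ(x) dx`. -/
def linFunctional (ξ : ℝ → Fin N → ℝ) : Functional N := fun u => ∫ x, ∑ i, ξ x i * u x i

theorem hasVarDeriv_linFunctional {ξ u : ℝ → Fin N → ℝ} (hξ : ContDiff ℝ ∞ ξ)
    (hs : HasCompactSupport ξ) (hu : Continuous u) : HasVarDeriv (linFunctional ξ) u ξ := by
  refine ⟨hξ, hs, fun φ hφ _ => ?_⟩
  have he : (fun ε : ℝ => linFunctional ξ (u + ε • φ)) =
      fun ε => linFunctional ξ u + ε * ∫ x, ∑ i, ξ x i * φ x i := by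
    ext ε
    rw [linFunctional, linFunctional, ← integral_const_mul,
      ← integral_add (integrable_pairing hξ.continuous hs hu)
        ((integrable_pairing hξ.continuous hs hφ.continuous).const_mul ε)]
    refine integral_congr_ae (Eventually.of_forall fun x => ?_)
    simp only [Pi.add_apply, Pi.smul_apply, smul_eq_mul, Finset.mul_sum,
      ← Finset.sum_add_distrib]
    exact Finset.sum_congr rfl fun i _ => by ring
  rw [he]
  simpa using ((hasDerivAt_id (0 : ℝ)).mul_const _).const_add (linFunctional ξ u)

end VarDeriv

/-! ### Families of fields, and smooth functionals evaluated along them. -/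

section FieldFamilies

variable {N : ℕ} {E : Type*} [NormedAddCommGroup E] [NormedSpace ℝ E]

/-- `w (t, ·)` is a jointly smooth family of fields for `t` near `t₀`. -/
def FieldNear (U : Set (Fin N → ℝ)) (w : E × ℝ → Fin N → ℝ) (t₀ : E) : Prop :=
  SmoothNear w t₀ ∧ ∀ᶠ t in 𝓝 t₀, ∀ x, w (t, x) ∈ U

variable {U : Set (Fin N → ℝ)}

theorem FieldNear.eventually {w : E × ℝ → Fin N → ℝ} {t₀ : E} (h : FieldNear U w t₀) :
    ∀ᶠ t in 𝓝 t₀, FieldNear U w t :=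
  h.1.eventually.and (eventually_eventually_nhds.2 h.2)

theorem FieldNear.isField {w : E × ℝ → Fin N → ℝ} {t₀ : E} (h : FieldNear U w t₀) :
    IsField U fun x => w (t₀, x) :=
  ⟨h.1.contDiff_slice, h.2.self_of_nhds⟩

/-- A family of fields may be shifted in the direction of a compactly supported family. -/
theorem FieldNear.add_smul (hU : IsOpen U) {w ψ : E × ℝ → Fin N → ℝ} {t₀ : E}
    (hw : FieldNear U w t₀) (hψ : SmoothNear ψ t₀) (hs : SuppNear ψ t₀) :
    FieldNear U (fun p : (E × ℝ) × ℝ => w (p.1.1, p.2) + p.1.2 • ψ (p.1.1, p.2)) (t₀, 0) := by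
  have key : ∀ {f : E × ℝ → Fin N → ℝ} {t : E} {s x : ℝ}, ContDiffAt ℝ ∞ f (t, x) →
      ContDiffAt ℝ ∞ (fun p : (E × ℝ) × ℝ => f (p.1.1, p.2)) ((t, s), x) := by
    intro f t s x hf
    exact ContDiffAt.comp (g := f) (f := fun p : (E × ℝ) × ℝ => (p.1.1, p.2)) ((t, s), x) hf
      (by fun_prop)
  have hsm : SmoothNear (fun p : (E × ℝ) × ℝ => w (p.1.1, p.2) + p.1.2 • ψ (p.1.1, p.2))
      (t₀, 0) := by
    have := (hw.1.and hψ).prod_inl_nhds (0 : ℝ)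
    filter_upwards [this] with p hp x
    have hsnd : ContDiffAt ℝ ∞ (fun q : (E × ℝ) × ℝ => q.1.2) (p, x) := by fun_prop
    exact (key (hp.1 x)).add (hsnd.smul (key (hp.2 x)))
  refine ⟨hsm, ?_⟩
  obtain ⟨R, hR⟩ := hs
  -- Only the compact interval carrying `ψ` needs the openness of `U`; outside it the field is
  -- unchanged. Since the interval is compact, one neighbourhood of parameters works for all its
  -- points.
  have h1 : ∀ᶠ p in 𝓝 (t₀, (0 : ℝ)), ∀ x ∈ Set.Icc (-R) R,
      w (p.1, x) + p.2 • ψ (p.1, x) ∈ U := by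
    refine isCompact_Icc.eventually_forall_of_forall_eventually fun x _ => ?_
    refine (hsm.self x).continuousAt.eventually (hU.mem_nhds ?_)
    simpa using hw.2.self_of_nhds x
  filter_upwards [h1, (hw.2.and hR).prod_inl_nhds (0 : ℝ)] with p hp1 hp2 x
  by_cases hx : x ∈ Set.Icc (-R) R
  · exact hp1 x hx
  · have : ψ (p.1, x) = 0 := hp2.2 x (by by_contra! hle; exact hx (abs_le.1 hle))
    simpa [this] using hp2.1 x

theorem IsField.fieldNear {u φ : ℝ → Fin N → ℝ} (hU : IsOpen U) (hu : IsField U u)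
    (hφ : ContDiff ℝ ∞ φ) (hφs : HasCompactSupport φ) :
    FieldNear U (fun p : ℝ × ℝ => u p.2 + p.1 • φ p.2) 0 := by
  have h0 : FieldNear U (fun p : ℝ × ℝ => u p.2) 0 :=
    ⟨hu.1.smoothNear_snd _, Eventually.of_forall fun _ => hu.2⟩
  have h := FieldNear.add_smul hU h0 (hφ.smoothNear_snd 0) (suppNear_snd hφs 0)
  have ht : Tendsto (fun t : ℝ => ((0 : ℝ), t)) (𝓝 0) (𝓝 ((0 : ℝ), (0 : ℝ))) :=
    (Continuous.prodMk_right (0 : ℝ)).tendsto' _ _ rfl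
  refine ⟨ContDiff.smoothNear ?_ 0, ht.eventually h.2⟩
  have h1 := hu.1
  fun_prop

/-- The map `t₀ + ρ(t)(t - t₀)` with a bump function `ρ` is the identity near `t₀` and never leaves
a ball inside `S`. Precomposing with it makes a family that is defined and smooth only near `t₀`
globally smooth, as the definition of a smooth functional requires. -/
theorem exists_smooth_retraction [FiniteDimensional ℝ E] {t₀ : E} {S : Set E} (hS : S ∈ 𝓝 t₀) :
    ∃ r : E → E, ContDiff ℝ ∞ r ∧ r =ᶠ[𝓝 t₀] id ∧ ∀ t, r t ∈ S := by
  obtain ⟨δ, hδ, hball⟩ := Metric.mem_nhds_iff.1 hS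
  let ρ : ContDiffBump t₀ := ⟨δ / 2, δ, half_pos hδ, half_lt_self hδ⟩
  refine ⟨fun t => t₀ + ρ t • (t - t₀), ?_, ?_, fun t => ?_⟩
  · exact contDiff_const.add (ρ.contDiff.smul (contDiff_id.sub contDiff_const))
  · filter_upwards [ρ.eventuallyEq_one] with t ht
    simp [ht]
  · by_cases ht : t ∈ Metric.ball t₀ δ
    · refine hball ?_
      rw [Metric.mem_ball, dist_eq_norm] at ht ⊢
      rw [add_sub_cancel_left, norm_smul, Real.norm_of_nonneg ρ.nonneg]
      calc ρ t * ‖t - t₀‖ ≤ 1 * ‖t - t₀‖ := by gcongr; exact ρ.le_one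
        _ < δ := by simpa using ht
    · have h0 : ρ t = 0 := by
        rw [← Function.notMem_support, ρ.support_eq]
        exact ht
      simpa [h0] using mem_of_mem_nhds hS

/-- Near `t₀` a family of fields coincides with a globally smooth one. -/
theorem FieldNear.exists_global [FiniteDimensional ℝ E] {w : E × ℝ → Fin N → ℝ} {t₀ : E}
    (h : FieldNear U w t₀) : ∃ W : E × ℝ → Fin N → ℝ, ContDiff ℝ ∞ W ∧ (∀ p, W p ∈ U) ∧
      ∀ᶠ t in 𝓝 t₀, ∀ x, W (t, x) = w (t, x) := by
  obtain ⟨r, hr, hid, hrS⟩ := exists_smooth_retraction (h.1.and h.2)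
  refine ⟨fun p => w (r p.1, p.2), ?_, fun p => (hrS p.1).2 p.2, ?_⟩
  · refine contDiff_iff_contDiffAt.2 fun p => ?_
    exact ContDiffAt.comp (g := w) (f := fun p : E × ℝ => (r p.1, p.2)) p ((hrS p.1).1 p.2)
      ((hr.comp contDiff_fst).prodMk contDiff_snd).contDiffAt
  · filter_upwards [hid] with t ht x
    simp [ht]

/-- The definition of a smooth functional tests globally smooth families with parameters in `Fin m →
ℝ`. Globalising the family and choosing linear coordinates on `E` extends it to families that are
smooth only near `t₀`, over any finite-dimensional parameter space. -/
theorem IsSmoothFunctional.smoothNear_varDeriv [FiniteDimensional ℝ E] {F : Functional N}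
    (hF : IsSmoothFunctional U F) {w : E × ℝ → Fin N → ℝ} {t₀ : E} (h : FieldNear U w t₀) :
    SmoothNear (fun p => varDeriv F (fun x => w (p.1, x)) p.2) t₀ := by
  have key : ∀ᶠ t in 𝓝 t₀, FieldNear U w t := h.eventually
  filter_upwards [key] with t₁ h₁ x₀
  obtain ⟨W, hW, hWU, hWw⟩ := h₁.exists_global
  let e : E ≃L[ℝ] (Fin (Module.finrank ℝ E) → ℝ) := ContinuousLinearEquiv.ofFinrankEq (by simp)
  have h2 := hF.smooth_family _ (fun p => W (e.symm p.1, p.2)) (hW.comp (by fun_prop)) (e t₁)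
    (Eventually.of_forall fun _ _ => hWU _) x₀
  have h3 : ContDiffAt ℝ ∞ (fun p : E × ℝ => varDeriv F (fun x => W (p.1, x)) p.2) (t₁, x₀) := by
    have := ContDiffAt.comp (f := fun p : E × ℝ => (e p.1, p.2)) (t₁, x₀) h2 (by fun_prop)
    simpa [Function.comp_def] using this
  refine h3.congr_of_eventuallyEq ?_
  filter_upwards [hWw.prod_inl_nhds x₀] with p hp
  have : (fun x => w (p.1, x)) = fun x => W (p.1, x) := funext fun x => (hp x).symm
  rw [this]

theorem IsSmoothFunctional.suppNear_varDeriv {F : Functional N}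
    (hF : IsSmoothFunctional U F) {w : E × ℝ → Fin N → ℝ} {t₀ : E} (h : FieldNear U w t₀) :
    SuppNear (fun p => varDeriv F (fun x => w (p.1, x)) p.2) t₀ := by
  obtain ⟨R, hR⟩ := hF.bounded_support
  exact ⟨R, h.eventually.mono fun t ht x hx => hR _ ht.isField x hx⟩

theorem IsSmoothFunctional.hasDerivAt {F : Functional N}
    (hF : IsSmoothFunctional U F) {w : ℝ × ℝ → Fin N → ℝ} {t₀ : ℝ} (h : FieldNear U w t₀) :
    HasDerivAt (fun t => F fun x => w (t, x))
      (∫ x, ∑ i, varDeriv F (fun y => w (t₀, y)) x i * deriv (fun t => w (t, x) i) t₀) t₀ := by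
  obtain ⟨W, hW, hWU, hWw⟩ := h.exists_global
  have h2 := hF.hasDerivAt_curve W hW t₀ (Eventually.of_forall fun _ _ => hWU _)
  have h0 : (fun y => W (t₀, y)) = fun y => w (t₀, y) := funext hWw.self_of_nhds
  have h1 : ∀ x i, deriv (fun t => W (t, x) i) t₀ = deriv (fun t => w (t, x) i) t₀ := by
    intro x i
    refine EventuallyEq.deriv_eq ?_
    filter_upwards [hWw] with t ht
    rw [ht x]
  simp only [h0, h1] at h2
  refine h2.congr_of_eventuallyEq ?_
  filter_upwards [hWw] with t ht
  exact congrArg F (funext fun x => (ht x).symm)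

theorem IsSmoothFunctional.contDiff_varDeriv {F : Functional N} (hF : IsSmoothFunctional U F)
    {u : ℝ → Fin N → ℝ} (hu : IsField U u) : ContDiff ℝ ∞ (varDeriv F u) :=
  (hF.hasVarDeriv hu).1

theorem IsSmoothFunctional.hasCompactSupport_varDeriv {F : Functional N}
    (hF : IsSmoothFunctional U F) {u : ℝ → Fin N → ℝ} (hu : IsField U u) :
    HasCompactSupport (varDeriv F u) :=
  (hF.hasVarDeriv hu).2.1

theorem isSmoothFunctional_linFunctional (U : Set (Fin N → ℝ)) {ξ : ℝ → Fin N → ℝ}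
    (hξ : ContDiff ℝ ∞ ξ) (hs : HasCompactSupport ξ) :
    IsSmoothFunctional U (linFunctional ξ) := by
  have hv : ∀ u : ℝ → Fin N → ℝ, Continuous u → varDeriv (linFunctional ξ) u = ξ :=
    fun u hu => (hasVarDeriv_linFunctional hξ hs hu).varDeriv_eq
  refine ⟨fun u hu => ⟨ξ, hasVarDeriv_linFunctional hξ hs hu.1.continuous⟩, ?_, ?_, ?_⟩
  · obtain ⟨R, hR⟩ := suppNear_snd hs (0 : ℝ)
    exact ⟨R, fun u hu x hx => by rw [hv u hu.1.continuous]; exact hR.self_of_nhds x hx⟩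
  · intro m w hw t₀ _ x₀
    have : (fun p : (Fin m → ℝ) × ℝ => varDeriv (linFunctional ξ) (fun x => w (p.1, x)) p.2) =
        fun p => ξ p.2 := by
      ext1 p
      rw [hv (fun x => w (p.1, x)) (by have := hw.continuous; fun_prop)]
    rw [this]
    exact (hξ.comp contDiff_snd).contDiffAt
  · intro w hw t₀ _
    rw [hv (fun x => w (t₀, x)) (by have := hw.continuous; fun_prop)]
    have hwi := fun i => (hw.smoothNear t₀).apply i
    refine SmoothNear.hasDerivAt_integral (f := fun p => ∑ i, ξ p.2 i * w p i) ?_ ?_ fun x => ?_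
    · exact SmoothNear.sum fun i _ => ((hξ.smoothNear_snd t₀).apply i).mul (hwi i)
    · exact SuppNear.sum fun i _ => ((suppNear_snd hs t₀).apply i).mul_right _
    · refine HasDerivAt.fun_sum fun i _ => ?_
      refine HasDerivAt.const_mul (ξ x i) (d := fun t => w (t, x) i) ?_
      exact ((hwi i).hasDerivAt_fst x).differentiableAt.hasDerivAt

theorem IsSmoothFunctional.smul {F : Functional N} (hF : IsSmoothFunctional U F) (c : ℝ) :
    IsSmoothFunctional U (c • F) := by
  have hv : ∀ u, IsField U u → varDeriv (c • F) u = c • varDeriv F u :=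
    fun u hu => ((hF.hasVarDeriv hu).smul c).varDeriv_eq
  refine ⟨fun u hu => ⟨_, (hF.hasVarDeriv hu).smul c⟩, ?_, ?_, ?_⟩
  · obtain ⟨R, hR⟩ := hF.bounded_support
    exact ⟨R, fun u hu x hx => by rw [hv u hu, Pi.smul_apply, hR u hu x hx, smul_zero]⟩
  · intro m w hw t₀ hU x₀
    have hw' : FieldNear U w t₀ := ⟨hw.smoothNear t₀, hU⟩
    have h1 := (SmoothNear.const c t₀).smul (hF.smoothNear_varDeriv hw')
    exact (h1.congr (hw'.eventually.mono fun t ht x => by rw [hv _ ht.isField]; rfl)).self x₀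
  · intro w hw t₀ hU
    have hw' : FieldNear U w t₀ := ⟨hw.smoothNear t₀, hU⟩
    rw [hv _ hw'.isField]
    refine ((hF.hasDerivAt hw').const_mul c).congr_deriv ?_
    rw [← integral_const_mul]
    simp [Finset.mul_sum, mul_assoc]

theorem SmoothNear.deriv_apply {w : ℝ × ℝ → Fin N → ℝ} {t₀ : ℝ} (hw : SmoothNear w t₀) (x : ℝ)
    (i : Fin N) : deriv (fun t => w (t, x) i) t₀ = deriv (fun t => w (t, x)) t₀ i :=
  (((hasDerivAt_pi.1 (hw.hasDerivAt_fst x).differentiableAt.hasDerivAt) i).deriv)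

theorem IsSmoothFunctional.add {F G : Functional N} (hF : IsSmoothFunctional U F)
    (hG : IsSmoothFunctional U G) : IsSmoothFunctional U (F + G) := by
  have hv : ∀ u, IsField U u → varDeriv (F + G) u = varDeriv F u + varDeriv G u :=
    fun u hu => ((hF.hasVarDeriv hu).add (hG.hasVarDeriv hu)).varDeriv_eq
  refine ⟨fun u hu => ⟨_, (hF.hasVarDeriv hu).add (hG.hasVarDeriv hu)⟩, ?_, ?_, ?_⟩
  · obtain ⟨R, hR⟩ := hF.bounded_support
    obtain ⟨S, hS⟩ := hG.bounded_support
    refine ⟨max R S, fun u hu x hx => ?_⟩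
    rw [hv u hu, Pi.add_apply, hR u hu x ((le_max_left _ _).trans_lt hx),
      hS u hu x ((le_max_right _ _).trans_lt hx), add_zero]
  · intro m w hw t₀ hU x₀
    have hw' : FieldNear U w t₀ := ⟨hw.smoothNear t₀, hU⟩
    have h1 := (hF.smoothNear_varDeriv hw').add (hG.smoothNear_varDeriv hw')
    exact (h1.congr (hw'.eventually.mono fun t ht x => by rw [hv _ ht.isField]; rfl)).self x₀
  · intro w hw t₀ hU
    have hw' : FieldNear U w t₀ := ⟨hw.smoothNear t₀, hU⟩
    rw [hv _ hw'.isField]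
    refine ((hF.hasDerivAt hw').add (hG.hasDerivAt hw')).congr_deriv ?_
    have hc : Continuous fun x => deriv (fun t => w (t, x)) t₀ :=
      hw'.1.dt.contDiff_slice.continuous
    simp only [hw'.1.deriv_apply]
    rw [← integral_add (integrable_pairing (hF.contDiff_varDeriv hw'.isField).continuous
        (hF.hasCompactSupport_varDeriv hw'.isField) hc)
      (integrable_pairing (hG.contDiff_varDeriv hw'.isField).continuous
        (hG.hasCompactSupport_varDeriv hw'.isField) hc)]
    simp [add_mul, Finset.sum_add_distrib]

end FieldFamilies

/-! ### The second variation and its symmetry. -/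

section SecondVariation

variable {N : ℕ} {E E' : Type*} [NormedAddCommGroup E] [NormedSpace ℝ E]
  [NormedAddCommGroup E'] [NormedSpace ℝ E'] {U : Set (Fin N → ℝ)}

/-- The derivative of `δF/δu(x)` in the direction of the variation `ψ` of the field `u`. -/
def secondVar (F : Functional N) (u ψ : ℝ → Fin N → ℝ) (x : ℝ) : Fin N → ℝ :=
  deriv (fun s : ℝ => varDeriv F (u + s • ψ) x) 0

theorem SmoothNear.comp_fst {F : Type*} [NormedAddCommGroup F] [NormedSpace ℝ F]
    {f : E × ℝ → F} {a : E' → E} {t₀ : E'} (ha : ContDiff ℝ ∞ a) (hf : SmoothNear f (a t₀)) :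
    SmoothNear (fun p : E' × ℝ => f (a p.1, p.2)) t₀ := by
  filter_upwards [ha.continuous.continuousAt.eventually hf] with t ht x
  exact ContDiffAt.comp (g := f) (f := fun p : E' × ℝ => (a p.1, p.2)) (t, x) (ht x)
    ((ha.comp contDiff_fst).prodMk contDiff_snd).contDiffAt

theorem SuppNear.comp_fst {F : Type*} [NormedAddCommGroup F]
    {f : E × ℝ → F} {a : E' → E} {t₀ : E'} (ha : Continuous a) (hf : SuppNear f (a t₀)) :
    SuppNear (fun p : E' × ℝ => f (a p.1, p.2)) t₀ := by
  obtain ⟨R, hR⟩ := hf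
  exact ⟨R, ha.continuousAt.eventually hR⟩

theorem FieldNear.comp_fst {w : E × ℝ → Fin N → ℝ} {a : E' → E} {t₀ : E'}
    (ha : ContDiff ℝ ∞ a) (hw : FieldNear U w (a t₀)) :
    FieldNear U (fun p : E' × ℝ => w (a p.1, p.2)) t₀ :=
  ⟨hw.1.comp_fst ha, ha.continuous.continuousAt.eventually hw.2⟩

/-- The shift size `s` is adjoined as one more parameter. The second variation is then a partial
derivative at `s = 0` of a jointly smooth family. -/
theorem IsSmoothFunctional.smoothNear_secondVar [FiniteDimensional ℝ E] (hU : IsOpen U)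
    {F : Functional N} (hF : IsSmoothFunctional U F) {w ψ : E × ℝ → Fin N → ℝ} {t₀ : E}
    (hw : FieldNear U w t₀) (hψ : SmoothNear ψ t₀) (hs : SuppNear ψ t₀) :
    SmoothNear (fun p => secondVar F (fun x => w (p.1, x)) (fun x => ψ (p.1, x)) p.2) t₀ := by
  have hsm := hF.smoothNear_varDeriv (FieldNear.add_smul hU hw hψ hs)
  set Ξ : (E × ℝ) × ℝ → Fin N → ℝ := fun q =>
    varDeriv F (fun x => w (q.1.1, x) + q.1.2 • ψ (q.1.1, x)) q.2 with hΞ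
  have h1 : SmoothNear (fun q => fderiv ℝ Ξ q (((0 : E), (1 : ℝ)), (0 : ℝ))) (t₀, (0 : ℝ)) := by
    filter_upwards [hsm] with t ht x
    exact ((ht x).fderiv_right (m := ∞) (by simp)).clm_apply contDiffAt_const
  have h2 := SmoothNear.comp_fst (a := fun t : E => (t, (0 : ℝ))) (t₀ := t₀)
    (contDiff_id.prodMk contDiff_const) h1
  refine h2.congr ?_
  have ht : Tendsto (fun t : E => (t, (0 : ℝ))) (𝓝 t₀) (𝓝 (t₀, (0 : ℝ))) :=
    (Continuous.prodMk_left (0 : ℝ)).tendsto' _ _ rfl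
  filter_upwards [ht.eventually hsm] with t ht x
  have h3 : HasDerivAt (fun s : ℝ => ((t, s), x)) (((0 : E), (1 : ℝ)), (0 : ℝ)) 0 :=
    ((hasDerivAt_const _ t).prodMk (hasDerivAt_id _)).prodMk (hasDerivAt_const _ x)
  exact (((ht x).differentiableAt (by simp)).hasFDerivAt.comp_hasDerivAt (0 : ℝ) h3).deriv

theorem IsField.add_smul_eventually {u ψ : ℝ → Fin N → ℝ} (hU : IsOpen U) (hu : IsField U u)
    (hψ : ContDiff ℝ ∞ ψ) (hs : HasCompactSupport ψ) :
    ∀ᶠ s in 𝓝 (0 : ℝ), IsField U (u + s • ψ) :=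
  (hu.fieldNear hU hψ hs).eventually.mono fun _ ht => ht.isField

theorem IsSmoothFunctional.secondVar_eq_zero (hU : IsOpen U) {F : Functional N} {R : ℝ}
    (hR : ∀ u, IsField U u → ∀ x, R < |x| → varDeriv F u x = 0) {u ψ : ℝ → Fin N → ℝ}
    (hu : IsField U u) (hψ : ContDiff ℝ ∞ ψ) (hs : HasCompactSupport ψ) {x : ℝ}
    (hx : R < |x|) : secondVar F u ψ x = 0 := by
  have : (fun s : ℝ => varDeriv F (u + s • ψ) x) =ᶠ[𝓝 0] fun _ => 0 :=
    (hu.add_smul_eventually hU hψ hs).mono fun s hs => hR _ hs x hx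
  rw [secondVar, this.deriv_eq]
  simp

theorem IsSmoothFunctional.contDiff_secondVar (hU : IsOpen U) {F : Functional N}
    (hF : IsSmoothFunctional U F) {u ψ : ℝ → Fin N → ℝ} (hu : IsField U u)
    (hψ : ContDiff ℝ ∞ ψ) (hs : HasCompactSupport ψ) : ContDiff ℝ ∞ (secondVar F u ψ) := by
  have h0 : FieldNear U (fun p : ℝ × ℝ => u p.2) 0 :=
    ⟨hu.1.smoothNear_snd _, Eventually.of_forall fun _ => hu.2⟩
  exact (hF.smoothNear_secondVar hU h0 (hψ.smoothNear_snd 0) (suppNear_snd hs 0)).contDiff_slice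

theorem IsSmoothFunctional.hasCompactSupport_secondVar (hU : IsOpen U) {F : Functional N}
    (hF : IsSmoothFunctional U F) {u ψ : ℝ → Fin N → ℝ} (hu : IsField U u)
    (hψ : ContDiff ℝ ∞ ψ) (hs : HasCompactSupport ψ) :
    HasCompactSupport (secondVar F u ψ) := by
  obtain ⟨R, hR⟩ := hF.bounded_support
  refine HasCompactSupport.intro (isCompact_Icc (a := -R) (b := R)) fun x hx => ?_
  exact IsSmoothFunctional.secondVar_eq_zero hU hR hu hψ hs
    (by by_contra! hle; exact hx (abs_le.1 hle))

/-- Symmetry of the second variation of a smooth functional. -/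
theorem IsSmoothFunctional.secondVar_symm (hU : IsOpen U) {F : Functional N}
    (hF : IsSmoothFunctional U F) {w : ℝ × ℝ → Fin N → ℝ} {t₀ : ℝ} (hw : FieldNear U w t₀)
    {ψ : ℝ → Fin N → ℝ} (hψ : ContDiff ℝ ∞ ψ) (hs : HasCompactSupport ψ) :
    ∫ x, ∑ i, deriv (fun t => varDeriv F (fun y => w (t, y)) x) t₀ i * ψ x i =
      ∫ x, ∑ i, secondVar F (fun y => w (t₀, y)) ψ x i * deriv (fun t => w (t, x) i) t₀ := by
  -- For the two-parameter family `W = w(t) + sψ`, the functions `q` and `p` below are the `t`- and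
  -- `s`-derivatives of `F(W)`. The claim is the equality of the mixed derivatives at `(t₀, 0)`.
  have hW := FieldNear.add_smul hU hw (hψ.smoothNear_snd t₀) (suppNear_snd hs t₀)
  set W : (ℝ × ℝ) × ℝ → Fin N → ℝ := fun p => w (p.1.1, p.2) + p.1.2 • ψ p.2 with hWdef
  have hΞ := hF.smoothNear_varDeriv hW
  have hΞs := hF.suppNear_varDeriv hW
  set Ξ : (ℝ × ℝ) × ℝ → Fin N → ℝ := fun q => varDeriv F (fun x => W (q.1, x)) q.2 with hΞdef
  have hfst : ContDiff ℝ ∞ (Prod.fst : ℝ × ℝ → ℝ) := contDiff_fst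
  have hwd : SmoothNear (fun p : (ℝ × ℝ) × ℝ => deriv (fun t => w (t, p.2)) p.1.1)
      (t₀, (0 : ℝ)) := SmoothNear.comp_fst (t₀ := (t₀, (0 : ℝ))) hfst hw.1.dt
  have hwdi : SmoothNear (fun p : (ℝ × ℝ) × ℝ => ∑ i, Ξ p i * deriv (fun t => w (t, p.2)) p.1.1 i)
      (t₀, (0 : ℝ)) := SmoothNear.sum fun i _ => (hΞ.apply i).mul (hwd.apply i)
  have hwds : SuppNear (fun p : (ℝ × ℝ) × ℝ => ∑ i, Ξ p i * deriv (fun t => w (t, p.2)) p.1.1 i)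
      (t₀, (0 : ℝ)) := SuppNear.sum fun i _ => (hΞs.apply i).mul_right _
  have hpi : SmoothNear (fun p : (ℝ × ℝ) × ℝ => ∑ i, Ξ p i * ψ p.2 i)
      (t₀, (0 : ℝ)) := SmoothNear.sum fun i _ => (hΞ.apply i).mul ((hψ.smoothNear_snd _).apply i)
  have hps : SuppNear (fun p : (ℝ × ℝ) × ℝ => ∑ i, Ξ p i * ψ p.2 i)
      (t₀, (0 : ℝ)) := SuppNear.sum fun i _ => (hΞs.apply i).mul_right _
  set q : ℝ × ℝ → ℝ := fun v => ∫ x, ∑ i, Ξ (v, x) i * deriv (fun t => w (t, x)) v.1 i with hq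
  set p : ℝ × ℝ → ℝ := fun v => ∫ x, ∑ i, Ξ (v, x) i * ψ x i with hp
  have hqd : ∀ᶠ v in 𝓝 (t₀, (0 : ℝ)), DifferentiableAt ℝ q v :=
    (hwdi.eventually.and hwds.eventually).mono fun v hv =>
      (hv.1.hasFDerivAt_integral hv.2).2.differentiableAt
  have hpd : ∀ᶠ v in 𝓝 (t₀, (0 : ℝ)), DifferentiableAt ℝ p v :=
    (hpi.eventually.and hps.eventually).mono fun v hv =>
      (hv.1.hasFDerivAt_integral hv.2).2.differentiableAt
  have hfstE : ∀ᶠ v in 𝓝 (t₀, (0 : ℝ)), FieldNear U w v.1 :=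
    hw.eventually.prod_inl_nhds (0 : ℝ)
  have h₁ : ∀ᶠ v in 𝓝 (t₀, (0 : ℝ)),
      HasDerivAt (fun t => F fun x => W ((t, v.2), x)) (q v) v.1 := by
    filter_upwards [hW.eventually, hfstE] with v hv hv1
    have ha : ContDiff ℝ ∞ fun t : ℝ => (t, v.2) := by fun_prop
    refine (hF.hasDerivAt (FieldNear.comp_fst (t₀ := v.1) ha hv)).congr_deriv ?_
    refine integral_congr_ae (Eventually.of_forall fun x => Finset.sum_congr rfl fun i _ => ?_)
    have : HasDerivAt (fun t => W ((t, v.2), x) i) (deriv (fun t => w (t, x)) v.1 i) v.1 := by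
      have hd := hasDerivAt_pi.1 (hv1.1.hasDerivAt_fst x).differentiableAt.hasDerivAt i
      simpa [hWdef] using hd.add_const (v.2 * ψ x i)
    rw [this.deriv]
  have h₂ : ∀ᶠ v in 𝓝 (t₀, (0 : ℝ)),
      HasDerivAt (fun s => F fun x => W ((v.1, s), x)) (p v) v.2 := by
    filter_upwards [hW.eventually] with v hv
    have ha : ContDiff ℝ ∞ fun s : ℝ => (v.1, s) := by fun_prop
    refine (hF.hasDerivAt (FieldNear.comp_fst (t₀ := v.2) ha hv)).congr_deriv ?_
    refine integral_congr_ae (Eventually.of_forall fun x => Finset.sum_congr rfl fun i _ => ?_)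
    have : HasDerivAt (fun s => W ((v.1, s), x) i) (ψ x i) v.2 := by
      simpa [hWdef] using ((hasDerivAt_id v.2).mul_const (ψ x i)).const_add (w (v.1, x) i)
    rw [this.deriv]
  have hf : ∀ᶠ v in 𝓝 (t₀, (0 : ℝ)), HasFDerivAt (fun v : ℝ × ℝ => F fun x => W (v, x))
      (q v • ContinuousLinearMap.fst ℝ ℝ ℝ + p v • ContinuousLinearMap.snd ℝ ℝ ℝ) v := by
    -- Only derivatives along curves are given. Continuity of the two partial derivatives `q` and
    -- `p` upgrades them to a Fréchet derivative in `(t, s)`.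
    filter_upwards [h₁.eventually_nhds, h₂.eventually_nhds, hqd, hpd] with v hv1 hv2 hv3 hv4
    have := hasStrictFDerivAt_uncurry_coprod (𝕜 := ℝ) (u := v)
      (f := fun t s => F fun x => W ((t, s), x))
      (f₁ := fun t s => ContinuousLinearMap.toSpanSingleton ℝ (q (t, s)))
      (f₂ := fun t s => ContinuousLinearMap.toSpanSingleton ℝ (p (t, s)))
      (hv1.mono fun z hz => hz.hasFDerivAt) (hv2.mono fun z hz => hz.hasFDerivAt)
      ((ContinuousLinearMap.toSpanSingletonCLE (𝕜 := ℝ) (E := ℝ)).continuous.continuousAt.comp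
        hv3.continuousAt)
      ((ContinuousLinearMap.toSpanSingletonCLE (𝕜 := ℝ) (E := ℝ)).continuous.continuousAt.comp
        hv4.continuousAt)
    refine this.hasFDerivAt.congr_fderiv ?_
    ext <;> simp [Function.HasUncurry.uncurry]
  have hq0 := hqd.self_of_nhds.hasFDerivAt
  have hp0 := hpd.self_of_nhds.hasFDerivAt
  have hsymm := second_derivative_symmetric_of_eventually hf
    ((hq0.smul_const (ContinuousLinearMap.fst ℝ ℝ ℝ)).add
      (hp0.smul_const (ContinuousLinearMap.snd ℝ ℝ ℝ))) (1, 0) (0, 1)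
  simp at hsymm
  have ha1 : ContDiff ℝ ∞ fun t : ℝ => (t, (0 : ℝ)) := by fun_prop
  have ha2 : ContDiff ℝ ∞ fun s : ℝ => (t₀, s) := by fun_prop
  have e1 : HasDerivAt (fun t : ℝ => p (t, 0)) (fderiv ℝ p (t₀, 0) (1, 0)) t₀ :=
    HasFDerivAt.comp_hasDerivAt (f := fun t : ℝ => (t, (0 : ℝ))) t₀ hp0 ((hasDerivAt_id t₀).prodMk (hasDerivAt_const t₀ (0 : ℝ)))
  have e2 : HasDerivAt (fun s : ℝ => q (t₀, s)) (fderiv ℝ q (t₀, 0) (0, 1)) 0 :=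
    HasFDerivAt.comp_hasDerivAt (f := fun s : ℝ => (t₀, s)) (0 : ℝ) hq0 ((hasDerivAt_const (0 : ℝ) t₀).prodMk (hasDerivAt_id (0 : ℝ)))
  have hΞ1 := SmoothNear.comp_fst (t₀ := t₀) ha1 hΞ
  have hΞ2 := SmoothNear.comp_fst (t₀ := (0 : ℝ)) ha2 hΞ
  have e3 : HasDerivAt (fun t : ℝ => p (t, 0))
      (∫ x, ∑ i, deriv (fun t => Ξ ((t, 0), x)) t₀ i * ψ x i) t₀ := by
    refine SmoothNear.hasDerivAt_integral (SmoothNear.comp_fst (t₀ := t₀) ha1 hpi)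
      (SuppNear.comp_fst (t₀ := t₀) ha1.continuous hps) fun x => ?_
    refine HasDerivAt.fun_sum fun i _ => ?_
    exact (hasDerivAt_pi.1 (hΞ1.hasDerivAt_fst x).differentiableAt.hasDerivAt i).mul_const (ψ x i)
  have e4 : HasDerivAt (fun s : ℝ => q (t₀, s))
      (∫ x, ∑ i, deriv (fun s => Ξ ((t₀, s), x)) 0 i * deriv (fun t => w (t, x)) t₀ i) 0 := by
    refine SmoothNear.hasDerivAt_integral (SmoothNear.comp_fst (t₀ := (0 : ℝ)) ha2 hwdi)
      (SuppNear.comp_fst (t₀ := (0 : ℝ)) ha2.continuous hwds) fun x => ?_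
    refine HasDerivAt.fun_sum fun i _ => ?_
    exact (hasDerivAt_pi.1 (hΞ2.hasDerivAt_fst x).differentiableAt.hasDerivAt i).mul_const
      (deriv (fun t => w (t, x)) t₀ i)
  have hfin := (e3.unique e1).trans (hsymm.trans (e2.unique e4))
  simp only [hw.1.deriv_apply]
  have hz : ∀ t x, Ξ ((t, 0), x) = varDeriv F (fun y => w (t, y)) x := by
    intro t x
    simp [hΞdef, hWdef]
  simp only [hz] at hfin
  exact hfin

end SecondVariation

/-! ### The constant bracket: skewness, Leibniz rule and variational derivative. -/

section ConstBracket

variable {N : ℕ} {U : Set (Fin N → ℝ)} {η : Matrix (Fin N) (Fin N) ℝ}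

theorem integral_eq_zero_of_hasDerivAt {f f' : ℝ → ℝ} (hf : ∀ x, HasDerivAt f (f' x) x)
    (hc : Continuous f') (hs : HasCompactSupport f) : ∫ x, f' x = 0 := by
  have hd : deriv f = f' := funext fun x => (hf x).deriv
  have h1 : HasCompactSupport f' := hd ▸ hs.deriv
  exact integral_eq_zero_of_hasDerivAt_of_integrable hf (hc.integrable_of_hasCompactSupport h1)
    ((continuous_iff_continuousAt.2 fun x => (hf x).continuousAt).integrable_of_hasCompactSupport
      hs)

theorem hasDerivAt_apply {ζ : ℝ → Fin N → ℝ} (hζ : ContDiff ℝ ∞ ζ) (j : Fin N) (x : ℝ) :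
    HasDerivAt (fun y => ζ y j) (deriv (fun y => ζ y j) x) x :=
  ((contDiff_pi.1 hζ j).differentiable (by simp) x).hasDerivAt

theorem contDiff_deriv_apply {ζ : ℝ → Fin N → ℝ} (hζ : ContDiff ℝ ∞ ζ) (j : Fin N) :
    ContDiff ℝ ∞ (deriv fun y => ζ y j) :=
  (contDiff_pi.1 hζ j).deriv'

theorem hasCompactSupport_apply {ζ : ℝ → Fin N → ℝ} (hs : HasCompactSupport ζ) (j : Fin N) :
    HasCompactSupport fun y => ζ y j :=
  hs.comp_left (g := fun v : Fin N → ℝ => v j) rfl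

/-- The operator `ηⁱʲ d/dx`. -/
def etaD (η : Matrix (Fin N) (Fin N) ℝ) (ζ : ℝ → Fin N → ℝ) (x : ℝ) (i : Fin N) : ℝ :=
  ∑ j, η i j * deriv (fun y => ζ y j) x

theorem operator_const (η : Matrix (Fin N) (Fin N) ℝ) (u ζ : ℝ → Fin N → ℝ) :
    operator (fun _ i j => η i j) (fun _ _ _ _ => 0) 0 u ζ = etaD η ζ := by
  ext x i
  simp [operator, etaD]

/-- The bracket with the constant operator `ηⁱʲ d/dx`. -/
abbrev constBracket (η : Matrix (Fin N) (Fin N) ℝ) :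
    Functional N → Functional N → Functional N :=
  bracket (fun _ i j => η i j) (fun _ _ _ _ => 0) 0

theorem constBracket_apply (I J : Functional N) (u : ℝ → Fin N → ℝ) :
    constBracket η I J u = ∫ x, ∑ i, varDeriv I u x i * etaD η (varDeriv J u) x i := by
  simp only [bracket, operator_const]

theorem contDiff_etaD {ζ : ℝ → Fin N → ℝ} (hζ : ContDiff ℝ ∞ ζ) : ContDiff ℝ ∞ (etaD η ζ) :=
  contDiff_pi.2 fun _ => ContDiff.sum fun j _ => contDiff_const.mul (contDiff_deriv_apply hζ j)

theorem hasCompactSupport_etaD {ζ : ℝ → Fin N → ℝ} (hs : HasCompactSupport ζ) :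
    HasCompactSupport (etaD η ζ) := by
  have h0 : SuppNear (fun p : ℝ × ℝ => etaD η (fun x => ζ x) p.2) 0 :=
    SuppNear.pi fun i => SuppNear.sum fun j _ =>
      (((suppNear_snd hs (0 : ℝ)).apply j).dx).mul_left _
  exact h0.slice

/-- Because `η` is symmetric, the sum of the two integrands is the total derivative of `ηⁱʲξᵢζⱼ`. -/
theorem integral_mul_etaD (hη : η.IsSymm) {ξ ζ : ℝ → Fin N → ℝ} (hξ : ContDiff ℝ ∞ ξ)
    (hξs : HasCompactSupport ξ) (hζ : ContDiff ℝ ∞ ζ) (hζs : HasCompactSupport ζ) :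
    ∫ x, ∑ i, ξ x i * etaD η ζ x i = -∫ x, ∑ i, ζ x i * etaD η ξ x i := by
  have h0 : ∫ x, (∑ i, ξ x i * etaD η ζ x i + ∑ i, ζ x i * etaD η ξ x i) = 0 := by
    refine integral_eq_zero_of_hasDerivAt
      (f := fun x => ∑ i, ∑ j, η i j * (ξ x i * ζ x j)) (fun x => ?_) ?_ ?_
    · have : ∑ i, ξ x i * etaD η ζ x i + ∑ i, ζ x i * etaD η ξ x i =
          ∑ i, ∑ j, η i j * (deriv (fun y => ξ y i) x * ζ x j +
            ξ x i * deriv (fun y => ζ y j) x) := by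
        simp only [etaD, mul_add, Finset.sum_add_distrib, Finset.mul_sum]
        rw [add_comm]
        congr 1
        · rw [Finset.sum_comm]
          refine Finset.sum_congr rfl fun i _ => Finset.sum_congr rfl fun j _ => ?_
          rw [hη.apply i j]
          ring
        · exact Finset.sum_congr rfl fun i _ => Finset.sum_congr rfl fun j _ => by ring
      rw [this]
      refine HasDerivAt.fun_sum fun i _ => HasDerivAt.fun_sum fun j _ => HasDerivAt.const_mul _ ?_
      exact (hasDerivAt_apply hξ i x).mul (hasDerivAt_apply hζ j x)
    · have h1 := (contDiff_etaD (η := η) hζ).continuous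
      have h2 := (contDiff_etaD (η := η) hξ).continuous
      have h3 := hξ.continuous
      have h4 := hζ.continuous
      fun_prop
    · refine hξs.mono' fun x hx => subset_tsupport _ fun h0 => hx ?_
      simp [h0]
  rw [integral_add (integrable_pairing hξ.continuous hξs (contDiff_etaD hζ).continuous)
    (integrable_pairing hζ.continuous hζs (contDiff_etaD hξ).continuous)] at h0
  linarith

theorem SmoothNear.etaD {E : Type*} [NormedAddCommGroup E] [NormedSpace ℝ E]
    {ζ : E × ℝ → Fin N → ℝ} {t₀ : E} (hζ : SmoothNear ζ t₀) :
    SmoothNear (fun p => etaD η (fun x => ζ (p.1, x)) p.2) t₀ :=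
  SmoothNear.pi fun _ => SmoothNear.sum fun j _ => (SmoothNear.const _ t₀).mul (hζ.apply j).dx

theorem SuppNear.etaD {E : Type*} [NormedAddCommGroup E] [NormedSpace ℝ E]
    {ζ : E × ℝ → Fin N → ℝ} {t₀ : E} (hζ : SuppNear ζ t₀) :
    SuppNear (fun p => etaD η (fun x => ζ (p.1, x)) p.2) t₀ :=
  SuppNear.pi fun _ => SuppNear.sum fun j _ => (hζ.apply j).dx.mul_left _

/-- The variational derivative of the constant bracket of two functionals. -/
def constBracketVar (η : Matrix (Fin N) (Fin N) ℝ) (I J : Functional N) (u : ℝ → Fin N → ℝ) :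
    ℝ → Fin N → ℝ :=
  secondVar I u (etaD η (varDeriv J u)) - secondVar J u (etaD η (varDeriv I u))

/-- Differentiation hits each of the two variational derivatives. Skew-adjointness of `η d/dx`
brings both terms to the form of a varied `δI/δu` or `δJ/δu` paired with a fixed test field.
Symmetry of the second variation then transfers the variation onto that test field, leaving a
pairing with the velocity of `w`. -/
theorem constBracket_hasDerivAt (hU : IsOpen U) (hη : η.IsSymm) {I J : Functional N}
    (hI : IsSmoothFunctional U I) (hJ : IsSmoothFunctional U J) {w : ℝ × ℝ → Fin N → ℝ} {t₀ : ℝ}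
    (hw : FieldNear U w t₀) :
    HasDerivAt (fun t => constBracket η I J fun x => w (t, x))
      (∫ x, ∑ i, constBracketVar η I J (fun y => w (t₀, y)) x i *
        deriv (fun t => w (t, x) i) t₀) t₀ := by
  set u : ℝ → Fin N → ℝ := fun y => w (t₀, y) with hu
  have hξ := hI.smoothNear_varDeriv hw
  have hξs := hI.suppNear_varDeriv hw
  have hζ := hJ.smoothNear_varDeriv hw
  have hζs := hJ.suppNear_varDeriv hw
  set ξ : ℝ × ℝ → Fin N → ℝ := fun p => varDeriv I (fun x => w (p.1, x)) p.2 with hξdef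
  set ζ : ℝ × ℝ → Fin N → ℝ := fun p => varDeriv J (fun x => w (p.1, x)) p.2 with hζdef
  set ξ' : ℝ → Fin N → ℝ := fun x => deriv (fun t => ξ (t, x)) t₀ with hξ'
  set ζ' : ℝ → Fin N → ℝ := fun x => deriv (fun t => ζ (t, x)) t₀ with hζ'
  have hξ'c : ContDiff ℝ ∞ ξ' := hξ.dt.contDiff_slice
  have hξ's : HasCompactSupport ξ' := hξs.dt.slice
  have hζ'c : ContDiff ℝ ∞ ζ' := hζ.dt.contDiff_slice
  have hζ's : HasCompactSupport ζ' := hζs.dt.slice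
  have hξc : ContDiff ℝ ∞ (varDeriv I u) := hξ.contDiff_slice
  have hζc : ContDiff ℝ ∞ (varDeriv J u) := hζ.contDiff_slice
  have hξcs : HasCompactSupport (varDeriv I u) := hξs.slice
  have hζcs : HasCompactSupport (varDeriv J u) := hζs.slice
  have hd : HasDerivAt (fun t => constBracket η I J fun x => w (t, x))
      (∫ x, (∑ i, ξ' x i * etaD η (varDeriv J u) x i +
        ∑ i, varDeriv I u x i * etaD η ζ' x i)) t₀ := by
    simp only [constBracket_apply]
    refine SmoothNear.hasDerivAt_integral
      (f := fun p => ∑ i, ξ p i * etaD η (fun x => ζ (p.1, x)) p.2 i)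
      (SmoothNear.sum fun i _ => (hξ.apply i).mul (hζ.etaD.apply i))
      (SuppNear.sum fun i _ => (hξs.apply i).mul_right _) fun x => ?_
    rw [← Finset.sum_add_distrib]
    refine HasDerivAt.fun_sum fun i _ => ?_
    have h1 := hasDerivAt_pi.1 (hξ.hasDerivAt_fst x).differentiableAt.hasDerivAt i
    refine h1.mul (d := fun t => etaD η (fun x => ζ (t, x)) x i) ?_
    refine HasDerivAt.fun_sum fun j _ => HasDerivAt.const_mul _ ?_
    refine ((hζ.apply j).hasDerivAt_dx x).congr_deriv ?_
    simp only [hζ.deriv_apply, hζ']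
  refine hd.congr_deriv ?_
  have hdw : Continuous fun x => fun i => deriv (fun t => w (t, x) i) t₀ := by
    simp only [hw.1.deriv_apply]
    exact hw.1.dt.contDiff_slice.continuous
  have huF : IsField U u := hw.isField
  have s1 := hI.secondVar_symm hU hw (contDiff_etaD (η := η) hζc) (hasCompactSupport_etaD hζcs)
  have s2 := hJ.secondVar_symm hU hw (contDiff_etaD (η := η) hξc) (hasCompactSupport_etaD hξcs)
  rw [integral_add (integrable_pairing hξ'c.continuous hξ's (contDiff_etaD hζc).continuous)
    (integrable_pairing hξc.continuous hξcs (contDiff_etaD hζ'c).continuous),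
    integral_mul_etaD hη hξc hξcs hζ'c hζ's, ← sub_eq_add_neg]
  refine (congrArg₂ (· - ·) s1 s2).trans ?_
  have i1 := integrable_pairing (hI.contDiff_secondVar hU huF (contDiff_etaD (η := η) hζc)
    (hasCompactSupport_etaD hζcs)).continuous (hI.hasCompactSupport_secondVar hU huF
      (contDiff_etaD (η := η) hζc) (hasCompactSupport_etaD hζcs)) hdw
  have i2 := integrable_pairing (hJ.contDiff_secondVar hU huF (contDiff_etaD (η := η) hξc)
    (hasCompactSupport_etaD hξcs)).continuous (hJ.hasCompactSupport_secondVar hU huF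
      (contDiff_etaD (η := η) hξc) (hasCompactSupport_etaD hξcs)) hdw
  refine (integral_sub i1 i2).symm.trans ?_
  refine integral_congr_ae (Eventually.of_forall fun x => ?_)
  simp only [constBracketVar, Pi.sub_apply, sub_mul, Finset.sum_sub_distrib]

theorem constBracket_hasVarDeriv (hU : IsOpen U) (hη : η.IsSymm) {I J : Functional N}
    (hI : IsSmoothFunctional U I) (hJ : IsSmoothFunctional U J) {u : ℝ → Fin N → ℝ}
    (hu : IsField U u) : HasVarDeriv (constBracket η I J) u (constBracketVar η I J u) := by
  have hξc := hI.contDiff_varDeriv hu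
  have hζc := hJ.contDiff_varDeriv hu
  have hξs := hI.hasCompactSupport_varDeriv hu
  have hζs := hJ.hasCompactSupport_varDeriv hu
  refine ⟨(hI.contDiff_secondVar hU hu (contDiff_etaD hζc) (hasCompactSupport_etaD hζs)).sub
    (hJ.contDiff_secondVar hU hu (contDiff_etaD hξc) (hasCompactSupport_etaD hξs)),
    (hI.hasCompactSupport_secondVar hU hu (contDiff_etaD hζc) (hasCompactSupport_etaD hζs)).sub
    (hJ.hasCompactSupport_secondVar hU hu (contDiff_etaD hξc) (hasCompactSupport_etaD hξs)),
    fun φ hφ hφs => ?_⟩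
  have h := constBracket_hasDerivAt hU hη hI hJ (hu.fieldNear hU hφ hφs)
  simp only [zero_smul, add_zero] at h
  refine h.congr_deriv ?_
  refine integral_congr_ae (Eventually.of_forall fun x => Finset.sum_congr rfl fun i _ => ?_)
  have : HasDerivAt (fun t : ℝ => (u x + t • φ x) i) (φ x i) 0 := by
    simpa using ((hasDerivAt_id (0 : ℝ)).mul_const (φ x i)).const_add (u x i)
  rw [this.deriv]

theorem isSmoothFunctional_constBracket (hU : IsOpen U) (hη : η.IsSymm) {I J : Functional N}
    (hI : IsSmoothFunctional U I) (hJ : IsSmoothFunctional U J) :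
    IsSmoothFunctional U (constBracket η I J) := by
  have hv : ∀ u, IsField U u → varDeriv (constBracket η I J) u = constBracketVar η I J u :=
    fun u hu => (constBracket_hasVarDeriv hU hη hI hJ hu).varDeriv_eq
  refine ⟨fun u hu => ⟨_, constBracket_hasVarDeriv hU hη hI hJ hu⟩, ?_, ?_, ?_⟩
  · obtain ⟨R, hR⟩ := hI.bounded_support
    obtain ⟨S, hS⟩ := hJ.bounded_support
    refine ⟨max R S, fun u hu x hx => ?_⟩
    rw [hv u hu, constBracketVar, Pi.sub_apply,
      IsSmoothFunctional.secondVar_eq_zero hU hR hu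
        (contDiff_etaD (hJ.contDiff_varDeriv hu))
        (hasCompactSupport_etaD (hJ.hasCompactSupport_varDeriv hu))
        ((le_max_left _ _).trans_lt hx),
      IsSmoothFunctional.secondVar_eq_zero hU hS hu
        (contDiff_etaD (hI.contDiff_varDeriv hu))
        (hasCompactSupport_etaD (hI.hasCompactSupport_varDeriv hu))
        ((le_max_right _ _).trans_lt hx), sub_zero]
  · intro m w hw t₀ hwU x₀
    have hw' : FieldNear U w t₀ := ⟨hw.smoothNear t₀, hwU⟩
    have h1 := (hI.smoothNear_secondVar hU hw'
      (hJ.smoothNear_varDeriv hw').etaD ((hJ.suppNear_varDeriv hw').etaD (η := η))).sub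
      (hJ.smoothNear_secondVar hU hw'
      (hI.smoothNear_varDeriv hw').etaD ((hI.suppNear_varDeriv hw').etaD (η := η)))
    exact (h1.congr (hw'.eventually.mono fun t ht x => by rw [hv _ ht.isField]; rfl)).self x₀
  · intro w hw t₀ hwU
    have hw' : FieldNear U w t₀ := ⟨hw.smoothNear t₀, hwU⟩
    rw [hv _ hw'.isField]
    exact constBracket_hasDerivAt hU hη hI hJ hw'

theorem constBracket_skew (hη : η.IsSymm) {I J : Functional N}
    (hI : IsSmoothFunctional U I) (hJ : IsSmoothFunctional U J) {u : ℝ → Fin N → ℝ}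
    (hu : IsField U u) : constBracket η I J u = -constBracket η J I u := by
  rw [constBracket_apply, constBracket_apply]
  exact integral_mul_etaD hη (hI.contDiff_varDeriv hu) (hI.hasCompactSupport_varDeriv hu)
    (hJ.contDiff_varDeriv hu) (hJ.hasCompactSupport_varDeriv hu)

theorem constBracket_add_left {I J L : Functional N}
    (hI : IsSmoothFunctional U I) (hJ : IsSmoothFunctional U J) (hL : IsSmoothFunctional U L)
    {u : ℝ → Fin N → ℝ} (hu : IsField U u) :
    constBracket η (I + J) L u = constBracket η I L u + constBracket η J L u := by
  have hω := (contDiff_etaD (η := η) (hL.contDiff_varDeriv hu)).continuous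
  rw [constBracket_apply, constBracket_apply, constBracket_apply,
    ((hI.hasVarDeriv hu).add (hJ.hasVarDeriv hu)).varDeriv_eq,
    ← integral_add (integrable_pairing (hI.contDiff_varDeriv hu).continuous
      (hI.hasCompactSupport_varDeriv hu) hω)
    (integrable_pairing (hJ.contDiff_varDeriv hu).continuous
      (hJ.hasCompactSupport_varDeriv hu) hω)]
  simp [add_mul, Finset.sum_add_distrib]

theorem constBracket_smul_left (c : ℝ) {I L : Functional N}
    (hI : IsSmoothFunctional U I)
    {u : ℝ → Fin N → ℝ} (hu : IsField U u) :
    constBracket η (c • I) L u = c * constBracket η I L u := by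
  rw [constBracket_apply, constBracket_apply, ((hI.hasVarDeriv hu).smul c).varDeriv_eq,
    ← integral_const_mul]
  simp [Finset.mul_sum, mul_assoc]

theorem constBracket_leibniz {I J L : Functional N}
    (hI : IsSmoothFunctional U I) (hJ : IsSmoothFunctional U J) (hL : IsSmoothFunctional U L)
    {u : ℝ → Fin N → ℝ} (hu : IsField U u) :
    constBracket η (I * J) L u = I u * constBracket η J L u + constBracket η I L u * J u := by
  have hω := (contDiff_etaD (η := η) (hL.contDiff_varDeriv hu)).continuous
  rw [constBracket_apply, constBracket_apply, constBracket_apply,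
    ((hI.hasVarDeriv hu).mul (hJ.hasVarDeriv hu)).varDeriv_eq,
    mul_comm _ (J u), ← integral_const_mul, ← integral_const_mul, add_comm (J u • _),
    ← integral_add ((integrable_pairing (hJ.contDiff_varDeriv hu).continuous
      (hJ.hasCompactSupport_varDeriv hu) hω).const_mul _)
    ((integrable_pairing (hI.contDiff_varDeriv hu).continuous
      (hI.hasCompactSupport_varDeriv hu) hω).const_mul _)]
  simp [add_mul, Finset.sum_add_distrib, Finset.mul_sum, mul_assoc]

end ConstBracket

/-! ### The nonlocal operator and its bilinear pairing. -/

section Nonlocal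

/-- The kernel of `(d/dx)⁻¹`. -/
def halfSign (z : ℝ × ℝ) : ℝ := if z.2 ≤ z.1 then 1 / 2 else -(1 / 2)

theorem measurable_halfSign : Measurable halfSign :=
  Measurable.ite (measurableSet_le measurable_snd measurable_fst) measurable_const
    measurable_const

theorem abs_halfSign_le (z : ℝ × ℝ) : |halfSign z| ≤ 1 := by
  unfold halfSign
  split_ifs <;> norm_num [abs_of_pos]

theorem dxInv_eq_integral {q : ℝ → ℝ} (hq : Integrable q) (x : ℝ) :
    dxInv q x = ∫ y, halfSign (x, y) * q y := by
  have hint : Integrable fun y => halfSign (x, y) * q y :=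
    hq.bdd_mul (c := 1) (measurable_halfSign.comp measurable_prodMk_left).aestronglyMeasurable
      (Eventually.of_forall fun y => by simpa using abs_halfSign_le (x, y))
  have h1 : ∫ y in Set.Iic x, halfSign (x, y) * q y = ∫ y in Set.Iic x, (1 / 2) * q y :=
    setIntegral_congr_fun measurableSet_Iic fun y hy => by
      simp only [halfSign, if_pos (Set.mem_Iic.1 hy)]
  have h2 : ∫ y in Set.Ioi x, halfSign (x, y) * q y = ∫ y in Set.Ioi x, (-(1 / 2)) * q y :=
    setIntegral_congr_fun measurableSet_Ioi fun y hy => by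
      simp only [halfSign, if_neg (not_le.2 (Set.mem_Ioi.1 hy))]
  rw [← integral_add_compl measurableSet_Iic hint (s := Set.Iic x), Set.compl_Iic, dxInv, h1, h2,
    integral_const_mul, integral_const_mul]
  ring

theorem dxInv_deriv {f : ℝ → ℝ} (hf : ContDiff ℝ 1 f) (hs : HasCompactSupport f) :
    dxInv (deriv f) = f := by
  ext x
  rw [dxInv, hs.integral_Iic_deriv_eq hf, hs.integral_Ioi_deriv_eq hf]
  ring

/-- The pairing `∫ p(x) ((d/dx)⁻¹ q)(x) dx`. -/
def nonlocalPairing (p q : ℝ → ℝ) : ℝ := ∫ x, p x * dxInv q x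

theorem integrable_halfSign_mul {p q : ℝ → ℝ} (hp : Integrable p) (hq : Integrable q) :
    Integrable (fun z : ℝ × ℝ => halfSign z * (p z.1 * q z.2)) (volume.prod volume) :=
  (hp.mul_prod hq).bdd_mul (c := 1) measurable_halfSign.aestronglyMeasurable
    (Eventually.of_forall fun z => by simpa using abs_halfSign_le z)

theorem mul_dxInv_eq {p q : ℝ → ℝ} (hq : Integrable q) (x : ℝ) :
    p x * dxInv q x = ∫ y, halfSign (x, y) * (p x * q y) := by
  rw [dxInv_eq_integral hq, ← integral_const_mul]
  exact integral_congr_ae (Eventually.of_forall fun y => by ring)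

theorem integrable_mul_dxInv {p q : ℝ → ℝ} (hp : Integrable p) (hq : Integrable q) :
    Integrable fun x => p x * dxInv q x := by
  simp only [mul_dxInv_eq hq]
  exact (integrable_halfSign_mul hp hq).integral_prod_left

theorem nonlocalPairing_eq_prod {p q : ℝ → ℝ} (hp : Integrable p) (hq : Integrable q) :
    nonlocalPairing p q = ∫ z : ℝ × ℝ, halfSign z * (p z.1 * q z.2) := by
  rw [nonlocalPairing, Measure.volume_eq_prod, integral_prod _ (integrable_halfSign_mul hp hq)]
  simp only [mul_dxInv_eq hq]

/-- Fubini, together with antisymmetry of the kernel `½ sgn(x - y)`. -/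
theorem nonlocalPairing_skew {p q : ℝ → ℝ} (hp : Integrable p) (hq : Integrable q) :
    nonlocalPairing p q = -nonlocalPairing q p := by
  rw [nonlocalPairing, nonlocalPairing, ← integral_neg]
  simp only [mul_dxInv_eq hq, mul_dxInv_eq hp]
  rw [integral_integral_swap (f := fun x y => halfSign (x, y) * (p x * q y))
    (integrable_halfSign_mul hp hq)]
  refine integral_congr_ae (Eventually.of_forall fun y => ?_)
  simp only [← integral_neg]
  -- `halfSign` equals `1/2` on the diagonal, so antisymmetry fails there; for fixed `y` this is one
  -- point, a null set.
  have hne : ∀ᵐ x : ℝ, x ≠ y := by simp [ae_iff]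
  refine integral_congr_ae (hne.mono fun x hx => ?_)
  have : halfSign (x, y) = -halfSign (y, x) := by
    rcases lt_or_gt_of_ne hx with h | h
    · simp [halfSign, h.le, not_le.2 h]
    · simp [halfSign, h.le, not_le.2 h]
  simp only [this]
  ring

theorem nonlocalPairing_add_left {p p' q : ℝ → ℝ} (hp : Integrable p) (hp' : Integrable p')
    (hq : Integrable q) :
    nonlocalPairing (fun x => p x + p' x) q = nonlocalPairing p q + nonlocalPairing p' q := by
  rw [nonlocalPairing, nonlocalPairing, nonlocalPairing,
    ← integral_add (integrable_mul_dxInv hp hq) (integrable_mul_dxInv hp' hq)]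
  simp only [add_mul]

theorem nonlocalPairing_add_right {p q q' : ℝ → ℝ} (hp : Integrable p) (hq : Integrable q)
    (hq' : Integrable q') :
    nonlocalPairing p (fun x => q x + q' x) = nonlocalPairing p q + nonlocalPairing p q' := by
  rw [nonlocalPairing_skew (q := fun x => q x + q' x) hp (hq.add hq'), nonlocalPairing_skew hp hq,
    nonlocalPairing_skew hp hq', nonlocalPairing_add_left hq hq' hp]
  ring

theorem nonlocalPairing_sum_left {ι : Type*} {s : Finset ι} {p : ι → ℝ → ℝ} {q : ℝ → ℝ}
    (hp : ∀ i ∈ s, Integrable (p i)) (hq : Integrable q) :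
    nonlocalPairing (fun x => ∑ i ∈ s, p i x) q = ∑ i ∈ s, nonlocalPairing (p i) q := by
  simp only [nonlocalPairing, Finset.sum_mul]
  exact integral_finsetSum _ fun i hi => integrable_mul_dxInv (hp i hi) hq

theorem nonlocalPairing_sum_right {ι : Type*} {s : Finset ι} {p : ℝ → ℝ} {q : ι → ℝ → ℝ}
    (hp : Integrable p) (hq : ∀ i ∈ s, Integrable (q i)) :
    nonlocalPairing p (fun x => ∑ i ∈ s, q i x) = ∑ i ∈ s, nonlocalPairing p (q i) := by
  rw [nonlocalPairing_skew hp (integrable_finsetSum _ hq), nonlocalPairing_sum_left hq hp,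
    ← Finset.sum_neg_distrib]
  exact Finset.sum_congr rfl fun i hi => (nonlocalPairing_skew hp (hq i hi)).symm

theorem nonlocalPairing_deriv_right (p : ℝ → ℝ) {f : ℝ → ℝ} (hf : ContDiff ℝ 1 f)
    (hs : HasCompactSupport f) : nonlocalPairing p (deriv f) = ∫ x, p x * f x := by
  rw [nonlocalPairing, dxInv_deriv hf hs]

/-- Integration by parts in the nonlocal pairing. -/
theorem nonlocalPairing_by_parts {P Q a c p q : ℝ → ℝ} (hP : ContDiff ℝ 1 P)
    (hPs : HasCompactSupport P) (hQ : ContDiff ℝ 1 Q) (hQs : HasCompactSupport Q)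
    (ha : Continuous a) (has : HasCompactSupport a) (hc : Continuous c)
    (hcs : HasCompactSupport c) (hp : Continuous p) (hps : HasCompactSupport p)
    (hq : Continuous q) (hqs : HasCompactSupport q)
    (hPd : ∀ x, deriv P x = p x + a x) (hQd : ∀ x, deriv Q x = q x + c x) :
    nonlocalPairing p q = (∫ x, (p x * Q x + c x * P x)) + nonlocalPairing a c := by
  have ia := ha.integrable_of_hasCompactSupport has (μ := volume)
  have ic := hc.integrable_of_hasCompactSupport hcs (μ := volume)
  have ip := hp.integrable_of_hasCompactSupport hps (μ := volume)
  have iq := hq.integrable_of_hasCompactSupport hqs (μ := volume)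
  -- Here `p = P' - a` and `q = Q' - c`, and `(d/dx)⁻¹` undoes the derivative of a compactly
  -- supported function. Replacing `q` first and `p` second leaves only the pairing of `a` with `c`
  -- nonlocal.
  have h1 : nonlocalPairing p q + nonlocalPairing p c = ∫ x, p x * Q x := by
    rw [← nonlocalPairing_deriv_right p hQ hQs, ← nonlocalPairing_add_right ip iq ic]
    exact congrArg _ (funext fun x => (hQd x).symm)
  have h2 : nonlocalPairing c p + nonlocalPairing c a = ∫ x, c x * P x := by
    rw [← nonlocalPairing_deriv_right c hP hPs, ← nonlocalPairing_add_right ic ip ia]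
    exact congrArg _ (funext fun x => (hPd x).symm)
  have i1 : Integrable fun x => p x * Q x :=
    (hp.mul hQ.continuous).integrable_of_hasCompactSupport hps.mul_right
  have i2 : Integrable fun x => c x * P x :=
    (hc.mul hP.continuous).integrable_of_hasCompactSupport hcs.mul_right
  rw [integral_add i1 i2, ← h1, ← h2,
    nonlocalPairing_skew ic ip, nonlocalPairing_skew ic ia]
  ring

/-- As a double integral against the bounded kernel `halfSign`, the pairing falls under the weighted
rule for differentiation under the integral sign. The kernel is discontinuous but independent of
`t`. -/
theorem SmoothNear.hasDerivAt_nonlocalPairing {p q : ℝ × ℝ → ℝ} {p' q' : ℝ → ℝ} {t₀ : ℝ}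
    (hp : SmoothNear p t₀) (hps : SuppNear p t₀) (hq : SmoothNear q t₀) (hqs : SuppNear q t₀)
    (hp' : ∀ x, HasDerivAt (fun t => p (t, x)) (p' x) t₀)
    (hq' : ∀ x, HasDerivAt (fun t => q (t, x)) (q' x) t₀) :
    HasDerivAt (fun t => nonlocalPairing (fun x => p (t, x)) fun x => q (t, x))
      (nonlocalPairing p' (fun x => q (t₀, x)) + nonlocalPairing (fun x => p (t₀, x)) q') t₀ := by
  have int : ∀ {f : ℝ × ℝ → ℝ} {t : ℝ}, SmoothNear f t → SuppNear f t →
      Integrable fun x => f (t, x) := fun h hs =>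
    h.contDiff_slice.continuous.integrable_of_hasCompactSupport hs.slice
  have ep : p' = fun x => deriv (fun t => p (t, x)) t₀ := funext fun x => (hp' x).deriv.symm
  have eq : q' = fun x => deriv (fun t => q (t, x)) t₀ := funext fun x => (hq' x).deriv.symm
  have ip' : Integrable p' := ep ▸ int hp.dt hps.dt
  have iq' : Integrable q' := eq ▸ int hq.dt hqs.dt
  have ip0 := int hp hps
  have iq0 := int hq hqs
  obtain ⟨R, hR⟩ := hps
  obtain ⟨S, hS⟩ := hqs
  have hev : (fun t => nonlocalPairing (fun x => p (t, x)) fun x => q (t, x)) =ᶠ[𝓝 t₀]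
      fun t => ∫ z : ℝ × ℝ, halfSign z * (p (t, z.1) * q (t, z.2)) := by
    filter_upwards [hp.eventually, hq.eventually, (show SuppNear p t₀ from ⟨R, hR⟩).eventually,
      (show SuppNear q t₀ from ⟨S, hS⟩).eventually] with t h1 h2 h3 h4
    exact nonlocalPairing_eq_prod (int h1 h3) (int h2 h4)
  have hd := hasDerivAt_integral_weight (μ := (volume : Measure (ℝ × ℝ)))
    (f := fun z : ℝ × (ℝ × ℝ) => p (z.1, z.2.1) * q (z.1, z.2.2)) (s := halfSign)
    (f' := fun z => p' z.1 * q (t₀, z.2) + p (t₀, z.1) * q' z.2)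
    (t₀ := t₀) ((isCompact_Icc (a := -R) (b := R)).prod (isCompact_Icc (a := -S) (b := S)))
    measurable_halfSign abs_halfSign_le ?_ ?_ fun z => (hp' z.1).mul (hq' z.2)
  · refine (hd.congr_of_eventuallyEq hev).congr_deriv ?_
    rw [nonlocalPairing_eq_prod ip' iq0, nonlocalPairing_eq_prod ip0 iq', Measure.volume_eq_prod,
      ← integral_add (integrable_halfSign_mul ip' iq0) (integrable_halfSign_mul ip0 iq')]
    simp only [mul_add]
  · filter_upwards [hp, hq] with t h1 h2 z
    have e1 : ContDiffAt ℝ ∞ (fun v : ℝ × (ℝ × ℝ) => p (v.1, v.2.1)) (t, z) :=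
      ContDiffAt.comp (g := p) (f := fun v : ℝ × (ℝ × ℝ) => (v.1, v.2.1)) (t, z) (h1 z.1)
        (by fun_prop)
    have e2 : ContDiffAt ℝ ∞ (fun v : ℝ × (ℝ × ℝ) => q (v.1, v.2.2)) (t, z) :=
      ContDiffAt.comp (g := q) (f := fun v : ℝ × (ℝ × ℝ) => (v.1, v.2.2)) (t, z) (h2 z.2)
        (by fun_prop)
    exact (e1.mul e2).of_le (by simp)
  · filter_upwards [hR, hS] with t h1 h2 z hz
    by_cases hz1 : z.1 ∈ Set.Icc (-R) R
    · have : z.2 ∉ Set.Icc (-S) S := fun h => hz ⟨hz1, h⟩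
      have h0 : q (t, z.2) = 0 := h2 _ (by by_contra! hle; exact this (abs_le.1 hle))
      simp [h0]
    · have h0 : p (t, z.1) = 0 := h1 _ (by by_contra! hle; exact hz1 (abs_le.1 hle))
      simp [h0]

end Nonlocal

/-! ### The bracket as a bilinear form on test covectors, and the shifted coefficients. -/

section Pairing

variable {N : ℕ} {U : Set (Fin N → ℝ)}

/-- Smooth compactly supported covector fields on the line. -/
def IsTest (ξ : ℝ → Fin N → ℝ) : Prop := ContDiff ℝ ∞ ξ ∧ HasCompactSupport ξ

/-- The pairing of `ξ` with the Mokhov–Ferapontov operator applied to `ζ`. -/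
def pairing (g : (Fin N → ℝ) → Fin N → Fin N → ℝ) (b : (Fin N → ℝ) → Fin N → Fin N → Fin N → ℝ)
    (K : ℝ) (u ξ ζ : ℝ → Fin N → ℝ) : ℝ :=
  ∫ x, ∑ i, ξ x i * operator g b K u ζ x i

/-- The density of the local part of the pairing. -/
def localDensity (g : (Fin N → ℝ) → Fin N → Fin N → ℝ)
    (b : (Fin N → ℝ) → Fin N → Fin N → Fin N → ℝ) (u ξ ζ : ℝ → Fin N → ℝ) (x : ℝ) : ℝ :=
  ∑ i, ∑ j, ξ x i * (g (u x) i j * deriv (fun y => ζ y j) x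
    + (∑ k, b (u x) i j k * deriv (fun y => u y k) x) * ζ x j)

/-- The coefficients `gⁱʲ + K uⁱ uʲ`. -/
def shiftG (g : (Fin N → ℝ) → Fin N → Fin N → ℝ) (K : ℝ) (v : Fin N → ℝ) (i j : Fin N) : ℝ :=
  g v i j + K * v i * v j

/-- The coefficients `bⁱʲₖ + K δⁱₖ uʲ`. -/
def shiftB (b : (Fin N → ℝ) → Fin N → Fin N → Fin N → ℝ) (K : ℝ) (v : Fin N → ℝ)
    (i j k : Fin N) : ℝ :=
  b v i j k + K * (if i = k then 1 else 0) * v j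

theorem contDiffOn_shiftG {g : (Fin N → ℝ) → Fin N → Fin N → ℝ} (hg : ContDiffOn ℝ ∞ g U)
    (K : ℝ) : ContDiffOn ℝ ∞ (shiftG g K) U := by
  refine contDiffOn_pi.2 fun i => contDiffOn_pi.2 fun j => ?_
  have h1 := contDiffOn_pi.1 (contDiffOn_pi.1 hg i) j
  have h2 : ContDiff ℝ ∞ fun v : Fin N → ℝ => K * v i * v j := by fun_prop
  exact h1.add h2.contDiffOn

theorem contDiffOn_shiftB {b : (Fin N → ℝ) → Fin N → Fin N → Fin N → ℝ}
    (hb : ContDiffOn ℝ ∞ b U) (K : ℝ) : ContDiffOn ℝ ∞ (shiftB b K) U := by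
  refine contDiffOn_pi.2 fun i => contDiffOn_pi.2 fun j => contDiffOn_pi.2 fun k => ?_
  have h1 := contDiffOn_pi.1 (contDiffOn_pi.1 (contDiffOn_pi.1 hb i) j) k
  have h2 : ContDiff ℝ ∞ fun v : Fin N → ℝ => K * (if i = k then 1 else 0) * v j := by fun_prop
  exact h1.add h2.contDiffOn

theorem continuous_localDensity {g : (Fin N → ℝ) → Fin N → Fin N → ℝ}
    {b : (Fin N → ℝ) → Fin N → Fin N → Fin N → ℝ} (hg : ContDiffOn ℝ ∞ g U)
    (hb : ContDiffOn ℝ ∞ b U) {u ξ ζ : ℝ → Fin N → ℝ} (hu : IsField U u) (hξ : IsTest ξ)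
    (hζ : IsTest ζ) : Continuous (localDensity g b u ξ ζ) := by
  have h1 : Continuous fun x => g (u x) := hg.continuousOn.comp_continuous hu.1.continuous hu.2
  have h2 : Continuous fun x => b (u x) := hb.continuousOn.comp_continuous hu.1.continuous hu.2
  have h3 := hξ.1.continuous
  have h4 := hζ.1.continuous
  have h5 : ∀ j, Continuous fun x => deriv (fun y => ζ y j) x :=
    fun j => (contDiff_deriv_apply hζ.1 j).continuous
  have h6 : ∀ j, Continuous fun x => deriv (fun y => u y j) x :=
    fun j => (contDiff_deriv_apply hu.1 j).continuous
  refine continuous_finsetSum _ fun i _ => continuous_finsetSum _ fun j _ => ?_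
  have h7 : Continuous fun x => ∑ k, b (u x) i j k * deriv (fun y => u y k) x :=
    continuous_finsetSum _ fun k _ =>
      (continuous_pi_iff.1 (continuous_pi_iff.1 (continuous_pi_iff.1 h2 i) j) k).mul (h6 k)
  exact Continuous.mul (f := fun x => ξ x i) (by fun_prop)
    (((continuous_pi_iff.1 (continuous_pi_iff.1 h1 i) j).mul (h5 j)).add
      (h7.mul (g := fun x => ζ x j) (by fun_prop)))

theorem hasCompactSupport_localDensity {g : (Fin N → ℝ) → Fin N → Fin N → ℝ}
    {b : (Fin N → ℝ) → Fin N → Fin N → Fin N → ℝ} {u ξ ζ : ℝ → Fin N → ℝ} (hξ : IsTest ξ) :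
    HasCompactSupport (localDensity g b u ξ ζ) := by
  refine hξ.2.mono' fun x hx => subset_tsupport _ fun h0 => hx ?_
  simp [localDensity, h0]

theorem integrable_localDensity {g : (Fin N → ℝ) → Fin N → Fin N → ℝ}
    {b : (Fin N → ℝ) → Fin N → Fin N → Fin N → ℝ} (hg : ContDiffOn ℝ ∞ g U)
    (hb : ContDiffOn ℝ ∞ b U) {u ξ ζ : ℝ → Fin N → ℝ} (hu : IsField U u) (hξ : IsTest ξ)
    (hζ : IsTest ζ) : Integrable (localDensity g b u ξ ζ) :=
  (continuous_localDensity hg hb hu hξ hζ).integrable_of_hasCompactSupport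
    (hasCompactSupport_localDensity hξ)

theorem pairing_density_eq (g : (Fin N → ℝ) → Fin N → Fin N → ℝ)
    (b : (Fin N → ℝ) → Fin N → Fin N → Fin N → ℝ) (K : ℝ) (u ξ ζ : ℝ → Fin N → ℝ) (x : ℝ) :
    ∑ i, ξ x i * operator g b K u ζ x i = localDensity g b u ξ ζ x +
      K * ∑ i, ∑ j, (ξ x i * deriv (fun y => u y i) x) *
        dxInv (fun y => deriv (fun z => u z j) y * ζ y j) x := by
  simp only [operator, localDensity, Finset.mul_sum, ← Finset.sum_add_distrib]
  exact Finset.sum_congr rfl fun i _ => Finset.sum_congr rfl fun j _ => by ring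

section Coefficients

variable {g : (Fin N → ℝ) → Fin N → Fin N → ℝ} {b : (Fin N → ℝ) → Fin N → Fin N → Fin N → ℝ}
  {u ξ ζ : ℝ → Fin N → ℝ}

theorem integrable_of_contDiff_mul {f h : ℝ → ℝ} (hf : ContDiff ℝ ∞ f) (hh : ContDiff ℝ ∞ h)
    (hs : HasCompactSupport h) : Integrable fun x => f x * h x :=
  (hf.continuous.mul hh.continuous).integrable_of_hasCompactSupport hs.mul_left

theorem IsTest.apply (hξ : IsTest ξ) (i : Fin N) :
    ContDiff ℝ ∞ (fun x => ξ x i) ∧ HasCompactSupport fun x => ξ x i :=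
  ⟨contDiff_pi.1 hξ.1 i, hasCompactSupport_apply hξ.2 i⟩

theorem IsTest.deriv_apply (hξ : IsTest ξ) (i : Fin N) :
    ContDiff ℝ ∞ (deriv fun x => ξ x i) ∧ HasCompactSupport (deriv fun x => ξ x i) :=
  ⟨contDiff_deriv_apply hξ.1 i, (hξ.apply i).2.deriv⟩

theorem integrable_pairing_density (hg : ContDiffOn ℝ ∞ g U) (hb : ContDiffOn ℝ ∞ b U) (K : ℝ)
    (hu : IsField U u) (hξ : IsTest ξ) (hζ : IsTest ζ) :
    Integrable fun x => ∑ i, ξ x i * operator g b K u ζ x i := by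
  simp only [pairing_density_eq]
  refine (integrable_localDensity hg hb hu hξ hζ).add (Integrable.const_mul ?_ K)
  refine integrable_finsetSum _ fun i _ => integrable_finsetSum _ fun j _ => ?_
  refine integrable_mul_dxInv ?_ (integrable_of_contDiff_mul (contDiff_deriv_apply hu.1 j)
    (hζ.apply j).1 (hζ.apply j).2)
  simpa only [mul_comm] using integrable_of_contDiff_mul (contDiff_deriv_apply hu.1 i)
    (hξ.apply i).1 (hξ.apply i).2

theorem pairing_eq_nonlocal (hg : ContDiffOn ℝ ∞ g U) (hb : ContDiffOn ℝ ∞ b U) (K : ℝ)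
    (hu : IsField U u) (hξ : IsTest ξ) (hζ : IsTest ζ) :
    pairing g b K u ξ ζ = (∫ x, localDensity g b u ξ ζ x) +
      K * ∑ i, ∑ j, nonlocalPairing (fun x => ξ x i * deriv (fun y => u y i) x)
        (fun x => deriv (fun y => u y j) x * ζ x j) := by
  have hint : ∀ i j, Integrable fun x => (ξ x i * deriv (fun y => u y i) x) *
        dxInv (fun y => deriv (fun z => u z j) y * ζ y j) x := by
    intro i j
    refine integrable_mul_dxInv ?_ (integrable_of_contDiff_mul (contDiff_deriv_apply hu.1 j)
      (hζ.apply j).1 (hζ.apply j).2)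
    simpa only [mul_comm] using integrable_of_contDiff_mul (contDiff_deriv_apply hu.1 i)
      (hξ.apply i).1 (hξ.apply i).2
  simp only [pairing, pairing_density_eq]
  rw [integral_add (integrable_localDensity hg hb hu hξ hζ) (Integrable.const_mul
    (integrable_finsetSum _ fun i _ => integrable_finsetSum _ fun j _ => hint i j) K),
    integral_const_mul, integral_finsetSum _ fun i _ => integrable_finsetSum _ fun j _ => hint i j]
  congr 2
  refine Finset.sum_congr rfl fun i _ => ?_
  rw [integral_finsetSum _ fun j _ => hint i j]
  rfl

/-- The nonlocal part of the pairing after integration by parts. -/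
def nonlocalPart (u ξ ζ : ℝ → Fin N → ℝ) : ℝ :=
  ∑ i, ∑ j, nonlocalPairing (fun x => u x i * deriv (fun y => ξ y i) x)
    (fun x => u x j * deriv (fun y => ζ y j) x)

/-- Integrating by parts in the nonlocal term shifts the coefficients `g` and `b`. -/
theorem pairing_eq_shift (hg : ContDiffOn ℝ ∞ g U) (hb : ContDiffOn ℝ ∞ b U) (K : ℝ)
    (hu : IsField U u) (hξ : IsTest ξ) (hζ : IsTest ζ) :
    pairing g b K u ξ ζ = (∫ x, localDensity (shiftG g K) (shiftB b K) u ξ ζ x) +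
      K * nonlocalPart u ξ ζ := by
  have hui := fun i => contDiff_pi.1 hu.1 i
  have hudi := fun i => contDiff_deriv_apply hu.1 i
  have hone : (1 : ℕ∞ω) ≤ ∞ := by simp
  -- Integration by parts with `P = uⁱξᵢ` and `Q = uʲζⱼ`. The remaining nonlocal term contains
  -- derivatives of `ξ` and `ζ` only, none of the field.
  have key : ∀ i j, nonlocalPairing (fun x => ξ x i * deriv (fun y => u y i) x)
        (fun x => deriv (fun y => u y j) x * ζ x j) =
      (∫ x, ((ξ x i * deriv (fun y => u y i) x) * (u x j * ζ x j) +
        (u x j * deriv (fun y => ζ y j) x) * (u x i * ξ x i))) +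
      nonlocalPairing (fun x => u x i * deriv (fun y => ξ y i) x)
        (fun x => u x j * deriv (fun y => ζ y j) x) := by
    intro i j
    refine nonlocalPairing_by_parts (((hui i).mul (hξ.apply i).1).of_le hone)
      (hξ.apply i).2.mul_left (((hui j).mul (hζ.apply j).1).of_le hone)
      (hζ.apply j).2.mul_left ((hui i).mul (hξ.deriv_apply i).1).continuous
      (hξ.deriv_apply i).2.mul_left ((hui j).mul (hζ.deriv_apply j).1).continuous
      (hζ.deriv_apply j).2.mul_left ((hξ.apply i).1.mul (hudi i)).continuous
      (hξ.apply i).2.mul_right ((hudi j).mul (hζ.apply j).1).continuous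
      (hζ.apply j).2.mul_left (fun x => ?_) (fun x => ?_)
    · refine ((hasDerivAt_apply hu.1 i x).mul (hasDerivAt_apply hξ.1 i x)).deriv.trans ?_
      ring
    · exact ((hasDerivAt_apply hu.1 j x).mul (hasDerivAt_apply hζ.1 j x)).deriv
  have hint : ∀ i j, Integrable fun x => (ξ x i * deriv (fun y => u y i) x) * (u x j * ζ x j) +
        (u x j * deriv (fun y => ζ y j) x) * (u x i * ξ x i) := by
    intro i j
    refine Integrable.add ?_ ?_
    · exact integrable_of_contDiff_mul ((hξ.apply i).1.mul (hudi i)) ((hui j).mul (hζ.apply j).1)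
        (hζ.apply j).2.mul_left
    · exact integrable_of_contDiff_mul ((hui j).mul (hζ.deriv_apply j).1)
        ((hui i).mul (hξ.apply i).1) (hξ.apply i).2.mul_left
  have hsum : Integrable fun x => ∑ i, ∑ j, ((ξ x i * deriv (fun y => u y i) x) *
      (u x j * ζ x j) + (u x j * deriv (fun y => ζ y j) x) * (u x i * ξ x i)) :=
    integrable_finsetSum _ fun i _ => integrable_finsetSum _ fun j _ => hint i j
  rw [pairing_eq_nonlocal hg hb K hu hξ hζ, nonlocalPart]
  simp only [key, Finset.sum_add_distrib, mul_add]
  rw [← add_assoc]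
  congr 1
  have e1 : ∑ i, ∑ j, ∫ x, ((ξ x i * deriv (fun y => u y i) x) * (u x j * ζ x j) +
        (u x j * deriv (fun y => ζ y j) x) * (u x i * ξ x i)) =
      ∫ x, ∑ i, ∑ j, ((ξ x i * deriv (fun y => u y i) x) * (u x j * ζ x j) +
        (u x j * deriv (fun y => ζ y j) x) * (u x i * ξ x i)) := by
    rw [integral_finsetSum _ fun i _ => integrable_finsetSum _ fun j _ => hint i j]
    exact Finset.sum_congr rfl fun i _ => (integral_finsetSum _ fun j _ => hint i j).symm
  rw [e1, ← integral_const_mul, ← integral_add (integrable_localDensity hg hb hu hξ hζ)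
    (hsum.const_mul K)]
  refine integral_congr_ae (Eventually.of_forall fun x => ?_)
  simp only [localDensity, Finset.mul_sum, ← Finset.sum_add_distrib]
  refine Finset.sum_congr rfl fun i _ => Finset.sum_congr rfl fun j _ => ?_
  -- The two local remainders are `K uⁱuʲ ξᵢζⱼ'` and `K uʲuⁱₓ ξᵢζⱼ`: exactly the shifts of `g` and
  -- of `b`.
  simp only [shiftG, shiftB, add_mul, Finset.sum_add_distrib, mul_ite, ite_mul, mul_one,
    mul_zero, zero_mul, Finset.sum_ite_eq, Finset.mem_univ, if_true]
  ring

end Coefficients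

end Pairing

/-! ### The variation of the pairing with respect to the field. -/

section PairingVariation

variable {N : ℕ} {U : Set (Fin N → ℝ)}
  {G : (Fin N → ℝ) → Fin N → Fin N → ℝ} {Γ : (Fin N → ℝ) → Fin N → Fin N → Fin N → ℝ}

theorem fderiv_eq_sum_pderiv (f : (Fin N → ℝ) → ℝ) (v φ : Fin N → ℝ) :
    fderiv ℝ f v φ = ∑ s, pderiv s f v * φ s := by
  conv_lhs => rw [pi_eq_sum_univ' φ]
  rw [map_sum]
  refine Finset.sum_congr rfl fun s _ => ?_
  rw [map_smul, pderiv, smul_eq_mul, mul_comm]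

/-- The variation of the local density in the direction `φ` of the field. -/
def localVariation (G : (Fin N → ℝ) → Fin N → Fin N → ℝ)
    (Γ : (Fin N → ℝ) → Fin N → Fin N → Fin N → ℝ) (u ξ ζ φ : ℝ → Fin N → ℝ) (x : ℝ) : ℝ :=
  ∑ i, ∑ j, ξ x i * ((∑ s, pderiv s (fun v => G v i j) (u x) * φ x s) * deriv (fun y => ζ y j) x
    + (∑ k, ((∑ s, pderiv s (fun v => Γ v i j k) (u x) * φ x s) * deriv (fun y => u y k) x
      + Γ (u x) i j k * deriv (fun y => φ y k) x)) * ζ x j)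

/-- The variation of the nonlocal part in the direction `φ` of the field. -/
def nonlocalVariation (u ξ ζ φ : ℝ → Fin N → ℝ) : ℝ :=
  ∑ i, ∑ j, (nonlocalPairing (fun x => φ x i * deriv (fun y => ξ y i) x)
      (fun x => u x j * deriv (fun y => ζ y j) x) +
    nonlocalPairing (fun x => u x i * deriv (fun y => ξ y i) x)
      (fun x => φ x j * deriv (fun y => ζ y j) x))

theorem SmoothNear.comp_field {E : Type*} [NormedAddCommGroup E] [NormedSpace ℝ E]
    (hU : IsOpen U) {f : (Fin N → ℝ) → ℝ} (hf : ContDiffOn ℝ ∞ f U) {w : E × ℝ → Fin N → ℝ}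
    {t₀ : E} (hw : FieldNear U w t₀) : SmoothNear (fun p => f (w p)) t₀ := by
  filter_upwards [hw.1, hw.2] with t h1 h2 x
  exact (hf.contDiffAt (hU.mem_nhds (h2 x))).comp (t, x) (h1 x)

theorem hasDerivAt_comp_field (hU : IsOpen U) {f : (Fin N → ℝ) → ℝ} (hf : ContDiffOn ℝ ∞ f U)
    {c : ℝ → Fin N → ℝ} {c' : Fin N → ℝ} {t₀ : ℝ} (hc : HasDerivAt c c' t₀) (hcU : c t₀ ∈ U) :
    HasDerivAt (fun t => f (c t)) (∑ s, pderiv s f (c t₀) * c' s) t₀ := by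
  rw [← fderiv_eq_sum_pderiv]
  exact ((hf.contDiffAt (hU.mem_nhds hcU)).differentiableAt
    (by simp)).hasFDerivAt.comp_hasDerivAt t₀ hc

/-- Leibniz rule under the integral: one term for each covector and one for the field, where the
`x`-derivative of the varied field appears by commuting mixed partials. -/
theorem hasDerivAt_integral_localDensity (hU : IsOpen U) (hG : ContDiffOn ℝ ∞ G U)
    (hΓ : ContDiffOn ℝ ∞ Γ U) {w ξ ζ : ℝ × ℝ → Fin N → ℝ} {t₀ : ℝ} (hw : FieldNear U w t₀)
    (hξ : SmoothNear ξ t₀) (hξs : SuppNear ξ t₀) (hζ : SmoothNear ζ t₀)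
    (hζs : SuppNear ζ t₀) :
    HasDerivAt (fun t => ∫ x, localDensity G Γ (fun y => w (t, y)) (fun y => ξ (t, y))
        (fun y => ζ (t, y)) x)
      ((∫ x, localDensity G Γ (fun y => w (t₀, y)) (fun y => deriv (fun t => ξ (t, y)) t₀)
          (fun y => ζ (t₀, y)) x) +
        (∫ x, localDensity G Γ (fun y => w (t₀, y)) (fun y => ξ (t₀, y))
          (fun y => deriv (fun t => ζ (t, y)) t₀) x) +
        ∫ x, localVariation G Γ (fun y => w (t₀, y)) (fun y => ξ (t₀, y)) (fun y => ζ (t₀, y))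
          (fun y => deriv (fun t => w (t, y)) t₀) x) t₀ := by
  have hGi := fun i j => contDiffOn_pi.1 (contDiffOn_pi.1 hG i) j
  have hΓi := fun i j k => contDiffOn_pi.1 (contDiffOn_pi.1 (contDiffOn_pi.1 hΓ i) j) k
  have hGs := fun i j => SmoothNear.comp_field hU (hGi i j) hw
  have hΓs := fun i j k => SmoothNear.comp_field hU (hΓi i j k) hw
  have tξ : IsTest fun y => ξ (t₀, y) := ⟨hξ.contDiff_slice, hξs.slice⟩
  have tζ : IsTest fun y => ζ (t₀, y) := ⟨hζ.contDiff_slice, hζs.slice⟩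
  have tξ' : IsTest fun y => deriv (fun t => ξ (t, y)) t₀ :=
    ⟨hξ.dt.contDiff_slice, hξs.dt.slice⟩
  have tζ' : IsTest fun y => deriv (fun t => ζ (t, y)) t₀ :=
    ⟨hζ.dt.contDiff_slice, hζs.dt.slice⟩
  set f' : ℝ → ℝ := fun x =>
    localDensity G Γ (fun y => w (t₀, y)) (fun y => deriv (fun t => ξ (t, y)) t₀)
      (fun y => ζ (t₀, y)) x +
    localDensity G Γ (fun y => w (t₀, y)) (fun y => ξ (t₀, y))
      (fun y => deriv (fun t => ζ (t, y)) t₀) x +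
    localVariation G Γ (fun y => w (t₀, y)) (fun y => ξ (t₀, y)) (fun y => ζ (t₀, y))
      (fun y => deriv (fun t => w (t, y)) t₀) x with hf'
  set f : ℝ × ℝ → ℝ := fun p => localDensity G Γ (fun y => w (p.1, y)) (fun y => ξ (p.1, y))
        (fun y => ζ (p.1, y)) p.2 with hf
  have hsm : SmoothNear f t₀ := by
    refine SmoothNear.sum fun i _ => SmoothNear.sum fun j _ => (hξ.apply i).mul ?_
    refine ((hGs i j).mul (hζ.apply j).dx).add (SmoothNear.mul ?_ (hζ.apply j))
    exact SmoothNear.sum fun k _ => (hΓs i j k).mul (hw.1.apply k).dx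
  have hsupp : SuppNear f t₀ :=
    SuppNear.sum fun i _ => SuppNear.sum fun j _ => (hξs.apply i).mul_right _
  have hd : ∀ x, HasDerivAt (fun t => f (t, x)) (f' x) t₀ := by
    intro x
    have hξd := fun i => hasDerivAt_pi.1 (hξ.hasDerivAt_fst x).differentiableAt.hasDerivAt i
    have hζd := fun i => hasDerivAt_pi.1 (hζ.hasDerivAt_fst x).differentiableAt.hasDerivAt i
    have hwd := (hw.1.hasDerivAt_fst x).differentiableAt.hasDerivAt
    have hwU := hw.2.self_of_nhds x
    have hGd := fun i j => hasDerivAt_comp_field hU (hGi i j) hwd hwU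
    have hΓd := fun i j k => hasDerivAt_comp_field hU (hΓi i j k) hwd hwU
    have hζx := fun j => (hζ.apply j).hasDerivAt_dx x
    have hwx := fun j => (hw.1.apply j).hasDerivAt_dx x
    simp only [hζ.deriv_apply] at hζx
    simp only [hw.1.deriv_apply] at hwx
    have hsumd := fun i j => HasDerivAt.fun_sum (u := Finset.univ)
      fun k _ => (hΓd i j k).mul (hwx k)
    have hall := HasDerivAt.fun_sum (u := Finset.univ) fun i _ => HasDerivAt.fun_sum
      (u := Finset.univ) fun j _ => (hξd i).mul
        (((hGd i j).mul (hζx j)).add ((hsumd i j).mul (hζd j)))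
    refine hall.congr_deriv ?_
    simp only [hf', localDensity, localVariation, ← Finset.sum_add_distrib]
    refine Finset.sum_congr rfl fun i _ => Finset.sum_congr rfl fun j _ => ?_
    simp only [Finset.sum_add_distrib, Pi.add_apply, Pi.mul_apply]
    ring
  have i1 := integrable_localDensity hG hΓ hw.isField tξ' tζ
  have i2 := integrable_localDensity hG hΓ hw.isField tξ tζ'
  have i3 : Integrable f' := by
    have : f' = fun x => deriv (fun t => f (t, x)) t₀ := funext fun x => (hd x).deriv.symm
    rw [this]
    exact hsm.dt.contDiff_slice.continuous.integrable_of_hasCompactSupport hsupp.dt.slice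
  -- The field variation is the total derivative in `t` minus two local densities, all integrable,
  -- so no separate continuity argument is needed.
  have i4 : Integrable fun x => localVariation G Γ (fun y => w (t₀, y)) (fun y => ξ (t₀, y))
      (fun y => ζ (t₀, y)) (fun y => deriv (fun t => w (t, y)) t₀) x := by
    refine ((i3.sub i1).sub i2).congr (Eventually.of_forall fun x => ?_)
    simp only [hf', Pi.sub_apply]
    ring
  refine (hsm.hasDerivAt_integral hsupp hd).congr_deriv ?_
  exact (integral_add (i1.add i2) i4).trans (congrArg (· + _) (integral_add i1 i2))

theorem hasDerivAt_nonlocalPart {w ξ ζ : ℝ × ℝ → Fin N → ℝ} {t₀ : ℝ} (hw : SmoothNear w t₀)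
    (hξ : SmoothNear ξ t₀) (hξs : SuppNear ξ t₀) (hζ : SmoothNear ζ t₀)
    (hζs : SuppNear ζ t₀) :
    HasDerivAt (fun t => nonlocalPart (fun y => w (t, y)) (fun y => ξ (t, y))
        (fun y => ζ (t, y)))
      (nonlocalPart (fun y => w (t₀, y)) (fun y => deriv (fun t => ξ (t, y)) t₀)
          (fun y => ζ (t₀, y)) +
        nonlocalPart (fun y => w (t₀, y)) (fun y => ξ (t₀, y))
          (fun y => deriv (fun t => ζ (t, y)) t₀) +
        nonlocalVariation (fun y => w (t₀, y)) (fun y => ξ (t₀, y)) (fun y => ζ (t₀, y))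
          (fun y => deriv (fun t => w (t, y)) t₀)) t₀ := by
  have sm : ∀ {ξ : ℝ × ℝ → Fin N → ℝ}, SmoothNear ξ t₀ → ∀ i, SmoothNear
      (fun p => w p i * deriv (fun y => ξ (p.1, y) i) p.2) t₀ :=
    fun h i => (hw.apply i).mul (h.apply i).dx
  have sp : ∀ {ξ : ℝ × ℝ → Fin N → ℝ}, SuppNear ξ t₀ → ∀ i, SuppNear
      (fun p => w p i * deriv (fun y => ξ (p.1, y) i) p.2) t₀ :=
    fun h i => (h.apply i).dx.mul_left _
  have dv : ∀ {ξ : ℝ × ℝ → Fin N → ℝ}, SmoothNear ξ t₀ → ∀ i x, HasDerivAt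
      (fun t => w (t, x) i * deriv (fun y => ξ (t, y) i) x)
      (deriv (fun t => w (t, x)) t₀ i * deriv (fun y => ξ (t₀, y) i) x +
        w (t₀, x) i * deriv (fun y => deriv (fun t => ξ (t, y)) t₀ i) x) t₀ := by
    intro ξ h i x
    have h1 := hasDerivAt_pi.1 (hw.hasDerivAt_fst x).differentiableAt.hasDerivAt i
    have h2 := (h.apply i).hasDerivAt_dx x
    simp only [h.deriv_apply] at h2
    exact h1.mul h2
  have int : ∀ {a : ℝ → ℝ} {b : ℝ → Fin N → ℝ} (i : Fin N), ContDiff ℝ ∞ a → IsTest b →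
      Integrable fun x => a x * deriv (fun y => b y i) x := fun i ha hb =>
    integrable_of_contDiff_mul ha (hb.deriv_apply i).1 (hb.deriv_apply i).2
  have tξ : IsTest fun y => ξ (t₀, y) := ⟨hξ.contDiff_slice, hξs.slice⟩
  have tζ : IsTest fun y => ζ (t₀, y) := ⟨hζ.contDiff_slice, hζs.slice⟩
  have tξ' : IsTest fun y => deriv (fun t => ξ (t, y)) t₀ :=
    ⟨hξ.dt.contDiff_slice, hξs.dt.slice⟩
  have tζ' : IsTest fun y => deriv (fun t => ζ (t, y)) t₀ :=
    ⟨hζ.dt.contDiff_slice, hζs.dt.slice⟩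
  have cw := fun i => (hw.apply i).contDiff_slice
  have cw' := fun i => (hw.dt.apply i).contDiff_slice
  have hall := HasDerivAt.fun_sum (u := Finset.univ) fun i (_ : i ∈ Finset.univ) =>
    HasDerivAt.fun_sum (u := Finset.univ) fun j (_ : j ∈ Finset.univ) =>
      SmoothNear.hasDerivAt_nonlocalPairing (sm hξ i) (sp hξs i) (sm hζ j) (sp hζs j)
        (dv hξ i) (dv hζ j)
  refine hall.congr_deriv ?_
  simp only [nonlocalPart, nonlocalVariation, ← Finset.sum_add_distrib]
  refine Finset.sum_congr rfl fun i _ => Finset.sum_congr rfl fun j _ => ?_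
  rw [nonlocalPairing_add_left (int i (cw' i) tξ) (int i (cw i) tξ') (int j (cw j) tζ),
    nonlocalPairing_add_right (int i (cw i) tξ) (int j (cw' j) tζ) (int j (cw j) tζ')]
  ring

/-- The variation of the pairing in the direction `φ` of the field, the arguments `ξ` and `ζ`
being fixed. -/
def pairingVariation (g : (Fin N → ℝ) → Fin N → Fin N → ℝ)
    (b : (Fin N → ℝ) → Fin N → Fin N → Fin N → ℝ) (K : ℝ) (u ξ ζ φ : ℝ → Fin N → ℝ) : ℝ :=
  (∫ x, localVariation (shiftG g K) (shiftB b K) u ξ ζ φ x) + K * nonlocalVariation u ξ ζ φ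

/-- The variation is taken in the shifted form of the pairing, whose nonlocal term depends on `u`
without derivatives. The terms in which a covector varies are then converted back to the original
pairing. -/
theorem hasDerivAt_pairing (hU : IsOpen U) {g : (Fin N → ℝ) → Fin N → Fin N → ℝ}
    {b : (Fin N → ℝ) → Fin N → Fin N → Fin N → ℝ} (hg : ContDiffOn ℝ ∞ g U)
    (hb : ContDiffOn ℝ ∞ b U) (K : ℝ) {w ξ ζ : ℝ × ℝ → Fin N → ℝ} {t₀ : ℝ}
    (hw : FieldNear U w t₀) (hξ : SmoothNear ξ t₀) (hξs : SuppNear ξ t₀)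
    (hζ : SmoothNear ζ t₀) (hζs : SuppNear ζ t₀) :
    HasDerivAt (fun t => pairing g b K (fun y => w (t, y)) (fun y => ξ (t, y))
        (fun y => ζ (t, y)))
      (pairing g b K (fun y => w (t₀, y)) (fun y => deriv (fun t => ξ (t, y)) t₀)
          (fun y => ζ (t₀, y)) +
        pairing g b K (fun y => w (t₀, y)) (fun y => ξ (t₀, y))
          (fun y => deriv (fun t => ζ (t, y)) t₀) +
        pairingVariation g b K (fun y => w (t₀, y)) (fun y => ξ (t₀, y)) (fun y => ζ (t₀, y))
          (fun y => deriv (fun t => w (t, y)) t₀)) t₀ := by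
  have tξ : IsTest fun y => ξ (t₀, y) := ⟨hξ.contDiff_slice, hξs.slice⟩
  have tζ : IsTest fun y => ζ (t₀, y) := ⟨hζ.contDiff_slice, hζs.slice⟩
  have tξ' : IsTest fun y => deriv (fun t => ξ (t, y)) t₀ :=
    ⟨hξ.dt.contDiff_slice, hξs.dt.slice⟩
  have tζ' : IsTest fun y => deriv (fun t => ζ (t, y)) t₀ :=
    ⟨hζ.dt.contDiff_slice, hζs.dt.slice⟩
  have h := (hasDerivAt_integral_localDensity hU (contDiffOn_shiftG hg K)
    (contDiffOn_shiftB hb K) hw hξ hξs hζ hζs).add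
    ((hasDerivAt_nonlocalPart hw.1 hξ hξs hζ hζs).const_mul K)
  refine (h.congr_of_eventuallyEq ?_).congr_deriv ?_
  · filter_upwards [hw.eventually, hξ.eventually, hξs.eventually, hζ.eventually,
      hζs.eventually] with t h1 h2 h3 h4 h5
    exact pairing_eq_shift hg hb K h1.isField ⟨h2.contDiff_slice, h3.slice⟩
      ⟨h4.contDiff_slice, h5.slice⟩
  · rw [pairing_eq_shift hg hb K hw.isField tξ' tζ, pairing_eq_shift hg hb K hw.isField tξ tζ',
      pairingVariation]
    ring

end PairingVariation

/-! ### Reduction of the variation along `ηθ'` to algebraic expressions in `Γ`. -/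

section Cyclic

variable {N : ℕ} {U : Set (Fin N → ℝ)}
  {G : (Fin N → ℝ) → Fin N → Fin N → ℝ} {Γ : (Fin N → ℝ) → Fin N → Fin N → Fin N → ℝ}
  {η : Matrix (Fin N) (Fin N) ℝ}

theorem contDiffOn_pderiv (hU : IsOpen U) {f : (Fin N → ℝ) → ℝ} (hf : ContDiffOn ℝ ∞ f U)
    (s : Fin N) : ContDiffOn ℝ ∞ (pderiv s f) U :=
  (hf.fderiv_of_isOpen hU (m := ∞) (by simp)).clm_apply contDiffOn_const

/-- The curvature-like expression `∂ₛ Γⁱʲₖ - ∂ₖ Γⁱʲₛ`. -/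
def curl (Γ : (Fin N → ℝ) → Fin N → Fin N → Fin N → ℝ) (v : Fin N → ℝ) (i j s k : Fin N) : ℝ :=
  pderiv s (fun v => Γ v i j k) v - pderiv k (fun v => Γ v i j s) v

/-- The variation of the local density after integration by parts. -/
def reducedVariation (Γ : (Fin N → ℝ) → Fin N → Fin N → Fin N → ℝ) (u ξ ζ φ : ℝ → Fin N → ℝ)
    (x : ℝ) : ℝ :=
  ∑ i, ∑ j, ∑ s, (ξ x i * Γ (u x) j i s * φ x s * deriv (fun y => ζ y j) x
    - deriv (fun y => ξ y i) x * Γ (u x) i j s * φ x s * ζ x j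
    + ∑ k, ξ x i * ζ x j * curl Γ (u x) i j s k * φ x s * deriv (fun y => u y k) x)

theorem contDiff_comp_field {f : (Fin N → ℝ) → ℝ} (hf : ContDiffOn ℝ ∞ f U) {u : ℝ → Fin N → ℝ}
    (hu : IsField U u) : ContDiff ℝ ∞ fun x => f (u x) :=
  hf.comp_contDiff hu.1 hu.2

theorem integrable_reducedVariation (hU : IsOpen U) (hΓ : ContDiffOn ℝ ∞ Γ U)
    {u ξ ζ φ : ℝ → Fin N → ℝ} (hu : IsField U u) (hξ : IsTest ξ) (hζ : IsTest ζ)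
    (hφ : ContDiff ℝ ∞ φ) : Integrable (reducedVariation Γ u ξ ζ φ) := by
  have hΓi := fun i j k => contDiffOn_pi.1 (contDiffOn_pi.1 (contDiffOn_pi.1 hΓ i) j) k
  have cΓ := fun i j k => (contDiff_comp_field (hΓi i j k) hu).continuous
  have cd := fun i j k s => (contDiff_comp_field (contDiffOn_pderiv hU (hΓi i j k) s) hu).continuous
  have cξ := fun i => (hξ.apply i).1.continuous
  have cξ' := fun i => (hξ.deriv_apply i).1.continuous
  have cζ := fun i => (hζ.apply i).1.continuous
  have cζ' := fun i => (hζ.deriv_apply i).1.continuous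
  have cφ := fun i => (contDiff_pi.1 hφ i).continuous
  have cu' := fun i => (contDiff_deriv_apply hu.1 i).continuous
  refine Continuous.integrable_of_hasCompactSupport ?_ ?_
  · refine continuous_finsetSum _ fun i _ => continuous_finsetSum _ fun j _ =>
      continuous_finsetSum _ fun s _ => ?_
    exact ((((cξ i).mul (cΓ j i s)).mul (cφ s)).mul (cζ' j)).sub
      ((((cξ' i).mul (cΓ i j s)).mul (cφ s)).mul (cζ j)) |>.add
      (continuous_finsetSum _ fun k _ => ((((cξ i).mul (cζ j)).mul
        ((cd i j k s).sub (cd i j s k))).mul (cφ s)).mul (cu' k))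
  · have h1 : HasCompactSupport fun x => fun i => deriv (fun y => ξ y i) x :=
      (SuppNear.pi fun i => ((suppNear_snd hξ.2 (0 : ℝ)).apply i).dx).slice
    have h2 := hξ.2.union h1
    refine HasCompactSupport.intro h2 fun x hx => ?_
    have e1 : ∀ i, ξ x i = 0 := fun i =>
      congrFun (image_eq_zero_of_notMem_tsupport fun h => hx (Or.inl h)) i
    have e2 : ∀ i, deriv (fun y => ξ y i) x = 0 := fun i =>
      congrFun (image_eq_zero_of_notMem_tsupport (f := fun x => fun i => deriv (fun y => ξ y i) x)
        fun h => hx (Or.inr h)) i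
    simp [reducedVariation, e1, e2]

/-- The total derivative of `ξᵢΓⁱʲₛφˢζⱼ` is subtracted, which removes the derivative of `φ`. Of
`∂ₛGⁱʲ = Γⁱʲₛ + Γʲⁱₛ` only `Γʲⁱₛ` survives beside `ζⱼ'`, and the derivatives of `Γ` combine into the
curl. -/
theorem integral_localVariation (hU : IsOpen U) (hΓ : ContDiffOn ℝ ∞ Γ U)
    (hGΓ : ∀ v ∈ U, ∀ i j s, pderiv s (fun v => G v i j) v = Γ v i j s + Γ v j i s)
    {u ξ ζ φ : ℝ → Fin N → ℝ} (hu : IsField U u) (hξ : IsTest ξ) (hζ : IsTest ζ)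
    (hφ : ContDiff ℝ ∞ φ) :
    ∫ x, localVariation G Γ u ξ ζ φ x = ∫ x, reducedVariation Γ u ξ ζ φ x := by
  have hΓi := fun i j k => contDiffOn_pi.1 (contDiffOn_pi.1 (contDiffOn_pi.1 hΓ i) j) k
  have cΓ := fun i j k => contDiff_comp_field (hΓi i j k) hu
  set f : ℝ → ℝ := fun x => ∑ i, ∑ j, ∑ s, ξ x i * Γ (u x) i j s * φ x s * ζ x j with hf
  have hfc : ContDiff ℝ ∞ f :=
    ContDiff.sum fun i _ => ContDiff.sum fun j _ => ContDiff.sum fun s _ =>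
      (((hξ.apply i).1.mul (cΓ i j s)).mul (contDiff_pi.1 hφ s)).mul (hζ.apply j).1
  have hfs : HasCompactSupport f := by
    refine hξ.2.mono' fun x hx => subset_tsupport _ fun h0 => hx ?_
    simp [hf, h0]
  have hfd : ∀ x, HasDerivAt f (∑ i, ∑ j, ∑ s,
      (deriv (fun y => ξ y i) x * Γ (u x) i j s * φ x s * ζ x j
        + ξ x i * (∑ k, pderiv k (fun v => Γ v i j s) (u x) * deriv (fun y => u y k) x)
          * φ x s * ζ x j
        + ξ x i * Γ (u x) i j s * deriv (fun y => φ y s) x * ζ x j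
        + ξ x i * Γ (u x) i j s * φ x s * deriv (fun y => ζ y j) x)) x := by
    intro x
    refine HasDerivAt.fun_sum fun i _ => HasDerivAt.fun_sum fun j _ =>
      HasDerivAt.fun_sum fun s _ => ?_
    have hud : HasDerivAt u (fun k => deriv (fun y => u y k) x) x :=
      hasDerivAt_pi.2 fun k => hasDerivAt_apply hu.1 k x
    refine ((((hasDerivAt_apply hξ.1 i x).mul (hasDerivAt_comp_field hU (hΓi i j s) hud
      (hu.2 x))).mul (hasDerivAt_apply hφ s x)).mul (hasDerivAt_apply hζ.1 j x)).congr_deriv ?_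
    simp only [Pi.mul_apply]
    ring
  have hzero : ∫ x, deriv f x = 0 :=
    integral_eq_zero_of_hasDerivAt (fun x => (hfd x).differentiableAt.hasDerivAt)
      (hfc.continuous_deriv (by simp)) hfs
  have hfi : Integrable (deriv f) :=
    (hfc.continuous_deriv (by simp)).integrable_of_hasCompactSupport hfs.deriv
  rw [← add_zero (∫ x, reducedVariation Γ u ξ ζ φ x), ← hzero,
    ← integral_add (integrable_reducedVariation hU hΓ hu hξ hζ hφ) hfi]
  refine integral_congr_ae (Eventually.of_forall fun x => ?_)
  simp only [(hfd x).deriv, localVariation, reducedVariation, ← Finset.sum_add_distrib]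
  refine Finset.sum_congr rfl fun i _ => Finset.sum_congr rfl fun j _ => ?_
  simp only [hGΓ _ (hu.2 x), curl]
  have e1 : ∑ s, ∑ k, ξ x i * ζ x j * (pderiv s (fun v => Γ v i j k) (u x)) * φ x s *
        deriv (fun y => u y k) x =
      ∑ k, ∑ s, ξ x i * ζ x j * (pderiv s (fun v => Γ v i j k) (u x)) * φ x s *
        deriv (fun y => u y k) x := Finset.sum_comm
  simp only [mul_sub, sub_mul, mul_add, add_mul, Finset.sum_add_distrib, Finset.sum_sub_distrib,
    Finset.mul_sum, Finset.sum_mul] at e1 ⊢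
  rw [e1]
  have e2 : ∑ k, ∑ s, ξ x i * ζ x j * (pderiv s (fun v => Γ v i j k) (u x)) * φ x s *
        deriv (fun y => u y k) x = ∑ k, ∑ s, ξ x i * (pderiv s (fun v => Γ v i j k) (u x) *
          φ x s * deriv (fun y => u y k) x * ζ x j) :=
    Finset.sum_congr rfl fun k _ => Finset.sum_congr rfl fun s _ => by ring
  have e3 : ∑ k, ∑ s, ξ x i * ζ x j * (pderiv s (fun v => Γ v i j k) (u x)) * φ x k *
        deriv (fun y => u y s) x = ∑ k, ∑ s, ξ x i * (pderiv s (fun v => Γ v i j k) (u x) *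
          deriv (fun y => u y s) x) * φ x k * ζ x j :=
    Finset.sum_congr rfl fun k _ => Finset.sum_congr rfl fun s _ => by ring
  rw [e2, e3]
  simp only [← mul_assoc]
  ring

/-- The trilinear form `Γʲⁱₛ ηˢᵗ aᵢ bⱼ cₜ`. -/
def triForm (Γ : Fin N → Fin N → Fin N → ℝ) (η : Matrix (Fin N) (Fin N) ℝ) (a b c : Fin N → ℝ) :
    ℝ :=
  ∑ i, ∑ j, ∑ t, (∑ s, Γ j i s * η s t) * a i * b j * c t

/-- In the cyclic sum the six trilinear terms occur in pairs of opposite sign, the two members of a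
pair differing by exchange of the last two arguments. This symmetry is what cancels them. -/
theorem triForm_symm {Γ : Fin N → Fin N → Fin N → ℝ}
    (h : ∀ i j t, ∑ s, Γ i j s * η s t = ∑ s, Γ t j s * η s i) (a b c : Fin N → ℝ) :
    triForm Γ η a b c = triForm Γ η a c b := by
  unfold triForm
  refine Finset.sum_congr rfl fun i _ => ?_
  rw [Finset.sum_comm]
  refine Finset.sum_congr rfl fun t _ => Finset.sum_congr rfl fun j _ => ?_
  rw [h j i t]
  ring

/-- The part of the reduced variation that contains the curl of `Γ`. -/
def curlForm (Γ : (Fin N → ℝ) → Fin N → Fin N → Fin N → ℝ) (u ξ ζ φ : ℝ → Fin N → ℝ)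
    (x : ℝ) : ℝ :=
  ∑ i, ∑ j, ∑ s, ∑ k, ξ x i * ζ x j * curl Γ (u x) i j s k * φ x s * deriv (fun y => u y k) x

theorem reducedVariation_etaD (Γ : (Fin N → ℝ) → Fin N → Fin N → Fin N → ℝ)
    (u ξ ζ θ : ℝ → Fin N → ℝ) (x : ℝ) :
    reducedVariation Γ u ξ ζ (etaD η θ) x =
      triForm (Γ (u x)) η (ξ x) (fun j => deriv (fun y => ζ y j) x)
        (fun t => deriv (fun y => θ y t) x)
      - triForm (Γ (u x)) η (ζ x) (fun j => deriv (fun y => ξ y j) x)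
        (fun t => deriv (fun y => θ y t) x)
      + curlForm Γ u ξ ζ (etaD η θ) x := by
  simp only [reducedVariation, curlForm, Finset.sum_add_distrib, Finset.sum_sub_distrib]
  congr 2
  · refine Finset.sum_congr rfl fun i _ => Finset.sum_congr rfl fun j _ => ?_
    simp only [etaD, Finset.mul_sum, Finset.sum_mul]
    rw [Finset.sum_comm]
    exact Finset.sum_congr rfl fun t _ => Finset.sum_congr rfl fun s _ => by ring
  · rw [triForm, Finset.sum_comm]
    refine Finset.sum_congr rfl fun j _ => Finset.sum_congr rfl fun i _ => ?_
    simp only [etaD, Finset.mul_sum, Finset.sum_mul]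
    rw [Finset.sum_comm]
    exact Finset.sum_congr rfl fun t _ => Finset.sum_congr rfl fun s _ => by ring

theorem nonlocalVariation_eq {u ξ ζ φ : ℝ → Fin N → ℝ} (hu : ContDiff ℝ ∞ u) (hξ : IsTest ξ)
    (hζ : IsTest ζ) (hφ : ContDiff ℝ ∞ φ) :
    nonlocalVariation u ξ ζ φ =
      nonlocalPairing (fun x => ∑ i, φ x i * deriv (fun y => ξ y i) x)
        (fun x => ∑ j, u x j * deriv (fun y => ζ y j) x) +
      nonlocalPairing (fun x => ∑ i, u x i * deriv (fun y => ξ y i) x)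
        (fun x => ∑ j, φ x j * deriv (fun y => ζ y j) x) := by
  have int : ∀ {a b : ℝ → Fin N → ℝ} (i : Fin N), ContDiff ℝ ∞ a → IsTest b →
      Integrable fun x => a x i * deriv (fun y => b y i) x := fun i ha hb =>
    integrable_of_contDiff_mul (contDiff_pi.1 ha i) (hb.deriv_apply i).1 (hb.deriv_apply i).2
  have key : ∀ {a c : ℝ → Fin N → ℝ}, ContDiff ℝ ∞ a → ContDiff ℝ ∞ c →
      nonlocalPairing (fun x => ∑ i, a x i * deriv (fun y => ξ y i) x)
        (fun x => ∑ j, c x j * deriv (fun y => ζ y j) x) =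
      ∑ i, ∑ j, nonlocalPairing (fun x => a x i * deriv (fun y => ξ y i) x)
        (fun x => c x j * deriv (fun y => ζ y j) x) := by
    intro a c ha hc
    rw [nonlocalPairing_sum_left (fun i _ => int i ha hξ)
      (integrable_finsetSum _ fun j _ => int j hc hζ)]
    exact Finset.sum_congr rfl fun i _ => nonlocalPairing_sum_right (int i ha hξ)
      fun j _ => int j hc hζ
  rw [key hφ hu, key hu hφ, nonlocalVariation]
  simp only [Finset.sum_add_distrib]

/-- The nonlocal parts cancel in the cyclic sum of the variations along `η dθ/dx`. -/
theorem nonlocalVariation_cyclic (hη : η.IsSymm) {u ξ ζ θ : ℝ → Fin N → ℝ}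
    (hu : ContDiff ℝ ∞ u) (hξ : IsTest ξ) (hζ : IsTest ζ) (hθ : IsTest θ) :
    nonlocalVariation u ξ ζ (etaD η θ) + nonlocalVariation u ζ θ (etaD η ξ) +
      nonlocalVariation u θ ξ (etaD η ζ) = 0 := by
  -- The contraction `ηⁱʲαⱼ'βᵢ'` is symmetric in `α` and `β`. Hence the cyclic sum contains three
  -- pairs of nonlocal pairings with the same two entries in opposite order.
  have hsymm : ∀ α β : ℝ → Fin N → ℝ, (fun x => ∑ i, etaD η α x i * deriv (fun y => β y i) x) =
      fun x => ∑ i, etaD η β x i * deriv (fun y => α y i) x := by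
    intro α β
    ext x
    simp only [etaD, Finset.sum_mul]
    rw [Finset.sum_comm]
    refine Finset.sum_congr rfl fun i _ => Finset.sum_congr rfl fun j _ => ?_
    rw [hη.apply]
    ring
  have int : ∀ {a b : ℝ → Fin N → ℝ}, ContDiff ℝ ∞ a → IsTest b →
      Integrable fun x => ∑ i, a x i * deriv (fun y => b y i) x := fun ha hb =>
    integrable_finsetSum _ fun i _ =>
    integrable_of_contDiff_mul (contDiff_pi.1 ha i) (hb.deriv_apply i).1 (hb.deriv_apply i).2
  have e : ∀ {α : ℝ → Fin N → ℝ}, IsTest α → ContDiff ℝ ∞ (etaD η α) :=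
    fun h => contDiff_etaD h.1
  rw [nonlocalVariation_eq hu hξ hζ (e hθ), nonlocalVariation_eq hu hζ hθ (e hξ),
    nonlocalVariation_eq hu hθ hξ (e hζ), hsymm θ ξ, hsymm θ ζ, hsymm ξ ζ,
    nonlocalPairing_skew (int hu hξ) (int (e hζ) hθ),
    nonlocalPairing_skew (int hu hζ) (int (e hξ) hθ),
    nonlocalPairing_skew (int hu hθ) (int (e hζ) hξ)]
  ring

end Cyclic

/-! ### Test covectors, cutoffs and special fields. -/

section TestFunctions

variable {N : ℕ} {U : Set (Fin N → ℝ)}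

/-- The covector field with the single nonzero component `f` at the index `i`. -/
def singleField (i : Fin N) (f : ℝ → ℝ) (x : ℝ) : Fin N → ℝ := Pi.single i (f x)

theorem isTest_singleField (i : Fin N) {f : ℝ → ℝ} (hf : ContDiff ℝ ∞ f)
    (hs : HasCompactSupport f) : IsTest (singleField i f) := by
  refine ⟨contDiff_pi.2 fun j => ?_, ?_⟩
  · by_cases h : j = i
    · subst h
      simpa [singleField] using hf
    · simpa [singleField, h] using contDiff_const
  · exact hs.comp_left (g := fun a : ℝ => (Pi.single i a : Fin N → ℝ)) (by simp)

theorem deriv_singleField (i : Fin N) (f : ℝ → ℝ) (x : ℝ) (j : Fin N) :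
    deriv (fun y => singleField i f y j) x = (Pi.single i (deriv f x) : Fin N → ℝ) j := by
  by_cases h : j = i
  · subst h
    simp [singleField]
  · simp [singleField, h]

/-- `χ` plays the role of the constant function `1`, which is not compactly supported. The pointwise
alternative lets integrands be compared case by case: either `χ` acts as `1` or everything built
from `f` and `f'` is zero. -/
theorem exists_cutoff {f : ℝ → ℝ} (hs : HasCompactSupport f) :
    ∃ χ : ℝ → ℝ, ContDiff ℝ ∞ χ ∧ HasCompactSupport χ ∧
      ∀ x, (χ x = 1 ∧ deriv χ x = 0) ∨ (f x = 0 ∧ deriv f x = 0) := by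
  obtain ⟨R, hR⟩ := hs.isCompact.isBounded.exists_norm_le
  let ρ : ContDiffBump (0 : ℝ) := ⟨|R| + 1, |R| + 2, by positivity, by linarith⟩
  refine ⟨ρ, ρ.contDiff, ρ.hasCompactSupport, fun x => ?_⟩
  by_cases hx : x ∈ tsupport f
  · left
    have h1 : x ∈ Metric.ball (0 : ℝ) (|R| + 1) := by
      rw [mem_ball_zero_iff]
      linarith [hR x hx, le_abs_self R]
    have h2 : ρ =ᶠ[𝓝 x] fun _ => 1 := ρ.eventuallyEq_one_of_mem_ball h1
    exact ⟨h2.self_of_nhds, by simp [h2.deriv_eq]⟩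
  · right
    exact ⟨image_eq_zero_of_notMem_tsupport hx,
      image_eq_zero_of_notMem_tsupport fun h => hx (tsupport_deriv_subset h)⟩

theorem exists_test_deriv_ne : ∃ h : ℝ → ℝ, ContDiff ℝ ∞ h ∧ HasCompactSupport h ∧
    ∫ x, deriv h x * deriv h x ≠ 0 := by
  let ρ : ContDiffBump (0 : ℝ) := ⟨1, 2, by norm_num, by norm_num⟩
  refine ⟨ρ, ρ.contDiff, ρ.hasCompactSupport, fun h0 => ?_⟩
  have h1 := eq_zero_of_integral_mul_self (ρ.contDiff.continuous_deriv (n := 1) (by simp))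
    ρ.hasCompactSupport.deriv h0
  have h2 := is_const_of_deriv_eq_zero (ρ.contDiff.differentiable (n := 1) (by simp))
    (fun x => congrFun h1 x) 0 3
  have h3 : ρ 0 = 1 := ρ.one_of_mem_closedBall (by simp [ρ.rIn_pos.le])
  have h4 : ρ 3 = 0 := ρ.zero_of_le_dist (by norm_num [Real.dist_eq])
  rw [h3, h4] at h2
  exact one_ne_zero h2

theorem isField_const {p : Fin N → ℝ} (hp : p ∈ U) : IsField U fun _ => p :=
  ⟨contDiff_const, fun _ => hp⟩

/-- Through each point of `U` there is a field that varies only in the `l`-th coordinate, with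
unit speed at the point and compactly supported velocity. -/
theorem exists_field_through (hU : IsOpen U) {p : Fin N → ℝ} (hp : p ∈ U) (l : Fin N) :
    ∃ ψ : ℝ → ℝ, ContDiff ℝ ∞ ψ ∧ HasCompactSupport ψ ∧ ψ 0 = 0 ∧ deriv ψ 0 = 1 ∧
      IsField U fun x => p + singleField l ψ x := by
  obtain ⟨δ, hδ, hball⟩ := Metric.isOpen_iff.1 hU p hp
  -- The displacement `x ρ(x)` has slope one at the origin, and `|x ρ(x)| < δ` everywhere because
  -- `ρ` vanishes for `|x| ≥ δ`.
  let ρ : ContDiffBump (0 : ℝ) := ⟨δ / 2, δ, half_pos hδ, half_lt_self hδ⟩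
  have hψ : ContDiff ℝ ∞ fun x : ℝ => x * ρ x := contDiff_id.mul ρ.contDiff
  have hψs : HasCompactSupport fun x : ℝ => x * ρ x := ρ.hasCompactSupport.mul_left
  refine ⟨fun x => x * ρ x, hψ, hψs, by simp, ?_, ?_, fun x => hball ?_⟩
  · have : (fun x : ℝ => x * ρ x) =ᶠ[𝓝 0] fun x => x := by
      filter_upwards [ρ.eventuallyEq_one] with x hx
      simp [hx]
    simp [this.deriv_eq]
  · exact contDiff_const.add (isTest_singleField l hψ hψs).1
  · rw [mem_ball_iff_norm, add_sub_cancel_left, singleField, Pi.norm_single]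
    by_cases hx : x ∈ Metric.ball (0 : ℝ) δ
    · rw [mem_ball_zero_iff] at hx
      rw [norm_mul, Real.norm_of_nonneg ρ.nonneg]
      calc ‖x‖ * ρ x ≤ ‖x‖ * 1 := by gcongr; exact ρ.le_one
        _ < δ := by simpa using hx
    · have h0 : ρ x = 0 := by
        rw [← Function.notMem_support, ρ.support_eq]
        exact hx
      simpa [h0] using hδ

theorem deriv_add_singleField (p : Fin N → ℝ) (l : Fin N) (ψ : ℝ → ℝ) (x : ℝ) (k : Fin N) :
    deriv (fun y => (p + singleField l ψ y) k) x = (Pi.single l (deriv ψ x) : Fin N → ℝ) k := by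
  rw [← deriv_singleField]
  simp only [Pi.add_apply, deriv_const_add]

/-- A smooth compactly supported function is orthogonal to all derivatives of test functions
only if it vanishes. -/
theorem eq_zero_of_integral_mul_deriv {F : ℝ → ℝ} (hF : ContDiff ℝ ∞ F)
    (hs : HasCompactSupport F)
    (h : ∀ k : ℝ → ℝ, ContDiff ℝ ∞ k → HasCompactSupport k → ∫ x, F x * deriv k x = 0) :
    F = 0 := by
  obtain ⟨χ, hχ, hχs, hχF⟩ := exists_cutoff hs
  -- An antiderivative of `F` need not have compact support. After multiplication by `χ` it does,
  -- and its derivative is still `F` on the support of `F`, so it can serve as `k` and gives `∫F² =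
  -- 0`.
  set Φ : ℝ → ℝ := fun x => ∫ y in (0 : ℝ)..x, F y with hΦ
  have hd : ∀ x, HasDerivAt Φ (F x) x := fun x =>
    intervalIntegral.integral_hasDerivAt_right (hF.continuous.intervalIntegrable _ _)
      hF.continuous.aestronglyMeasurable.stronglyMeasurableAtFilter hF.continuous.continuousAt
  have hΦc : ContDiff ℝ ∞ Φ := by
    refine contDiff_infty_iff_deriv.2 ⟨fun x => (hd x).differentiableAt, ?_⟩
    rwa [show deriv Φ = F from funext fun x => (hd x).deriv]
  refine eq_zero_of_integral_mul_self hF.continuous hs ?_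
  rw [← h _ (hχ.mul hΦc) hχs.mul_right]
  refine integral_congr_ae (Eventually.of_forall fun x => ?_)
  have hm : deriv (fun x => χ x * Φ x) x = deriv χ x * Φ x + χ x * F x :=
    ((hχ.differentiable (by simp) x).hasDerivAt.mul (hd x)).deriv
  rcases hχF x with ⟨h1, h2⟩ | ⟨h1, _⟩
  · simp only [hm, h1, h2]
    ring
  · simp only [h1, zero_mul]

end TestFunctions

/-! ### What skewness of the bracket says about `g` and `b`. -/

section Symmetry

variable {N : ℕ} {U : Set (Fin N → ℝ)}
  {g : (Fin N → ℝ) → Fin N → Fin N → ℝ} {b : (Fin N → ℝ) → Fin N → Fin N → Fin N → ℝ} {K : ℝ}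

theorem localDensity_singleField (i j : Fin N) (f h : ℝ → ℝ) (u : ℝ → Fin N → ℝ) (x : ℝ) :
    localDensity g b u (singleField i f) (singleField j h) x =
      f x * (g (u x) i j * deriv h x +
        (∑ k, b (u x) i j k * deriv (fun y => u y k) x) * h x) := by
  simp only [localDensity, deriv_singleField]
  rw [Finset.sum_eq_single i, Finset.sum_eq_single j]
  · simp [singleField]
  · intro j' _ hj
    simp [singleField, hj]
  · simp
  · intro i' _ hi
    simp [singleField, hi]
  · simp

/-- The nonlocal part is skew by itself, so skewness of the pairing is a condition on the local part
alone. -/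
theorem integral_localDensity_skew (hg : ContDiffOn ℝ ∞ g U) (hb : ContDiffOn ℝ ∞ b U)
    {u ξ ζ : ℝ → Fin N → ℝ} (hu : IsField U u) (hξ : IsTest ξ) (hζ : IsTest ζ)
    (h : pairing g b K u ξ ζ = -pairing g b K u ζ ξ) :
    ∫ x, (localDensity g b u ξ ζ x + localDensity g b u ζ ξ x) = 0 := by
  have int : ∀ {α : ℝ → Fin N → ℝ}, IsTest α → ∀ i,
      Integrable fun x => deriv (fun y => u y i) x * α x i := fun hα i =>
    integrable_of_contDiff_mul (contDiff_deriv_apply hu.1 i) (hα.apply i).1 (hα.apply i).2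
  have hnl : ∑ i, ∑ j, nonlocalPairing (fun x => ξ x i * deriv (fun y => u y i) x)
        (fun x => deriv (fun y => u y j) x * ζ x j) =
      -∑ i, ∑ j, nonlocalPairing (fun x => ζ x i * deriv (fun y => u y i) x)
        (fun x => deriv (fun y => u y j) x * ξ x j) := by
    rw [Finset.sum_comm]
    simp only [← Finset.sum_neg_distrib]
    refine Finset.sum_congr rfl fun j _ => Finset.sum_congr rfl fun i _ => ?_
    simp only [mul_comm (ξ _ i), mul_comm (ζ _ j)]
    exact nonlocalPairing_skew (int hξ i) (int hζ j)
  rw [pairing_eq_nonlocal hg hb K hu hξ hζ, pairing_eq_nonlocal hg hb K hu hζ hξ, hnl] at h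
  rw [integral_add (integrable_localDensity hg hb hu hξ hζ)
    (integrable_localDensity hg hb hu hζ hξ)]
  linarith

/-- At a constant field only `g` contributes. The covectors `k'` in slot `i` and `k` in slot `j`
give `(gⁱʲ - gʲⁱ)∫(k')² = 0` after an integration by parts. -/
theorem symm_of_skew (hg : ContDiffOn ℝ ∞ g U) (hb : ContDiffOn ℝ ∞ b U)
    (h : ∀ u ξ ζ, IsField U u → IsTest ξ → IsTest ζ →
      pairing g b K u ξ ζ = -pairing g b K u ζ ξ) {p : Fin N → ℝ} (hp : p ∈ U) (i j : Fin N) :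
    g p i j = g p j i := by
  obtain ⟨k, hk, hks, hne⟩ := exists_test_deriv_ne
  have hk' : ContDiff ℝ ∞ (deriv k) := (contDiff_infty_iff_deriv.1 hk).2
  have t1 := isTest_singleField i hk' hks.deriv
  have t2 := isTest_singleField j hk hks
  have h0 := integral_localDensity_skew hg hb (isField_const hp) t1 t2
    (h _ _ _ (isField_const hp) t1 t2)
  simp only [localDensity_singleField, deriv_const, mul_zero, Finset.sum_const_zero, zero_mul,
    add_zero] at h0
  have h1 : ∫ x, (deriv k x * deriv k x + k x * deriv (deriv k) x) = 0 := by
    refine integral_eq_zero_of_hasDerivAt (f := fun x => k x * deriv k x) (fun x => ?_) ?_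
      hks.mul_right
    · exact (hk.differentiable (by simp) x).hasDerivAt.mul
        (hk'.differentiable (by simp) x).hasDerivAt
    · exact (hk'.continuous.mul hk'.continuous).add
        (hk.continuous.mul (hk'.continuous_deriv (by simp)))
  have i1 : Integrable fun x => deriv k x * deriv k x :=
    integrable_of_contDiff_mul hk' hk' hks.deriv
  have i2 : Integrable fun x => k x * deriv (deriv k) x :=
    integrable_of_contDiff_mul hk (contDiff_infty_iff_deriv.1 hk').2 hks.deriv.deriv
  rw [integral_add i1 i2] at h1
  have h2 : g p i j * (∫ x, deriv k x * deriv k x) +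
      g p j i * ∫ x, k x * deriv (deriv k) x = 0 := by
    rw [← integral_const_mul, ← integral_const_mul,
      ← integral_add (i1.const_mul _) (i2.const_mul _), ← h0]
    exact integral_congr_ae (Eventually.of_forall fun x => by ring)
  have h3 : (g p i j - g p j i) * ∫ x, deriv k x * deriv k x = 0 := by
    linear_combination h2 - g p j i * h1
  exact sub_eq_zero.1 ((mul_eq_zero.1 h3).resolve_right hne)

/-- Along a field moving only in the `l`-th coordinate, symmetry of `g` makes the `g`-terms a total
derivative up to `-∂ₗg`. The defect `F = (bⁱʲₗ + bʲⁱₗ - ∂ₗgⁱʲ)ψ'` is used as its own test function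
against a cutoff, so that `∫F² = 0`; at `x = 0` the field passes through `p` with `ψ' = 1`. -/
theorem pderiv_of_skew (hU : IsOpen U) (hg : ContDiffOn ℝ ∞ g U) (hb : ContDiffOn ℝ ∞ b U)
    (h : ∀ u ξ ζ, IsField U u → IsTest ξ → IsTest ζ →
      pairing g b K u ξ ζ = -pairing g b K u ζ ξ) {p : Fin N → ℝ} (hp : p ∈ U)
    (i j l : Fin N) : pderiv l (fun v => g v i j) p = b p i j l + b p j i l := by
  obtain ⟨ψ, hψ, hψs, hψ0, hψ1, hu⟩ := exists_field_through hU hp l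
  set u : ℝ → Fin N → ℝ := fun x => p + singleField l ψ x with hudef
  have hψ' : ContDiff ℝ ∞ (deriv ψ) := (contDiff_infty_iff_deriv.1 hψ).2
  have hgi := contDiffOn_pi.1 (contDiffOn_pi.1 hg i) j
  have hbi := fun i j => contDiffOn_pi.1 (contDiffOn_pi.1 (contDiffOn_pi.1 hb i) j) l
  have hux : ∀ x k, deriv (fun y => u y k) x = (Pi.single l (deriv ψ x) : Fin N → ℝ) k :=
    fun x k => deriv_add_singleField p l ψ x k
  set F : ℝ → ℝ := fun x =>
    (b (u x) i j l + b (u x) j i l - pderiv l (fun v => g v i j) (u x)) * deriv ψ x with hFdef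
  have hF : ContDiff ℝ ∞ F :=
    (((contDiff_comp_field (hbi i j) hu).add (contDiff_comp_field (hbi j i) hu)).sub
      (contDiff_comp_field (contDiffOn_pderiv hU hgi l) hu)).mul hψ'
  have hFs : HasCompactSupport F := hψs.deriv.mul_left
  obtain ⟨χ, hχ, hχs, hχF⟩ := exists_cutoff hFs
  have t1 := isTest_singleField i hF hFs
  have t2 := isTest_singleField j hχ hχs
  have h0 := integral_localDensity_skew hg hb hu t1 t2 (h _ _ _ hu t1 t2)
  have hsum : ∀ (c : Fin N → ℝ) x, ∑ k, c k * (Pi.single l (deriv ψ x) : Fin N → ℝ) k =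
      c l * deriv ψ x := fun c x => by simp [Pi.single_apply]
  have hgu := contDiff_comp_field hgi hu
  have hgd : ∀ x, HasDerivAt (fun y => g (u y) i j)
      (pderiv l (fun v => g v i j) (u x) * deriv ψ x) x := by
    intro x
    have hud : HasDerivAt u (fun k => deriv (fun y => u y k) x) x :=
      hasDerivAt_pi.2 fun k => hasDerivAt_apply hu.1 k x
    have := hasDerivAt_comp_field hU hgi hud (hu.2 x)
    simp only [hux, hsum] at this
    exact this
  have h1 : ∫ x, deriv (fun x => F x * g (u x) i j * χ x) x = 0 := by
    have hc := (hF.mul hgu).mul hχ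
    exact integral_eq_zero_of_hasDerivAt (fun x => (hc.differentiable (by simp) x).hasDerivAt)
      (hc.continuous_deriv (by simp)) hχs.mul_left
  have h2 : ∀ x, deriv (fun x => F x * g (u x) i j * χ x) x =
      (deriv F x * g (u x) i j + F x * (pderiv l (fun v => g v i j) (u x) * deriv ψ x)) * χ x
        + F x * g (u x) i j * deriv χ x := fun x =>
    (((hF.differentiable (by simp) x).hasDerivAt.mul (hgd x)).mul
      (hχ.differentiable (by simp) x).hasDerivAt).deriv
  have hFF : ∫ x, F x * F x = 0 := by
    have i1 : Integrable (deriv fun x => F x * g (u x) i j * χ x) :=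
      ((((hF.mul hgu).mul hχ).continuous_deriv (by simp)).integrable_of_hasCompactSupport
        hχs.mul_left.deriv)
    have i2 := (integrable_localDensity hg hb hu t1 t2).add
      (integrable_localDensity hg hb hu t2 t1)
    have h3 := (integral_sub i2 i1).trans (congrArg₂ (· - ·) h0 h1)
    rw [sub_zero] at h3
    rw [← h3]
    refine integral_congr_ae (Eventually.of_forall fun x => ?_)
    simp only [Pi.add_apply, localDensity_singleField, hux, hsum, h2]
    rw [symm_of_skew hg hb h (hu.2 x) j i]
    have hFx : F x = (b (u x) i j l + b (u x) j i l - pderiv l (fun v => g v i j) (u x)) *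
      deriv ψ x := rfl
    rcases hχF x with ⟨e1, e2⟩ | ⟨e1, e2⟩
    · rw [e1, e2]
      linear_combination F x * hFx
    · rw [e1, e2]
      ring
  have hF0 := congrFun (eq_zero_of_integral_mul_self hF.continuous hFs hFF) 0
  have hu0 : u 0 = p := by simp [hudef, singleField, hψ0]
  simp only [hFdef, hψ1, hu0, Pi.zero_apply, mul_one] at hF0
  linarith

end Symmetry

/-! ### Vanishing of the cyclic variation as conditions on `Γ`. -/

section Structure

variable {N : ℕ} {U : Set (Fin N → ℝ)} {η : Matrix (Fin N) (Fin N) ℝ}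
  {g : (Fin N → ℝ) → Fin N → Fin N → ℝ} {b : (Fin N → ℝ) → Fin N → Fin N → Fin N → ℝ} {K : ℝ}

theorem pderiv_add {f h : (Fin N → ℝ) → ℝ} {v : Fin N → ℝ} (hf : DifferentiableAt ℝ f v)
    (hh : DifferentiableAt ℝ h v) (s : Fin N) :
    pderiv s (fun v => f v + h v) v = pderiv s f v + pderiv s h v := by
  rw [pderiv, fderiv_fun_add hf hh]
  rfl

theorem pderiv_quadratic (K : ℝ) (i j s : Fin N) (v : Fin N → ℝ) :
    pderiv s (fun v : Fin N → ℝ => K * v i * v j) v =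
      K * (if i = s then 1 else 0) * v j + K * (if j = s then 1 else 0) * v i := by
  have hi : HasFDerivAt (fun v : Fin N → ℝ => v i) (ContinuousLinearMap.proj (R := ℝ) i) v :=
    (ContinuousLinearMap.proj (R := ℝ) (φ := fun _ : Fin N => ℝ) i).hasFDerivAt
  have hj : HasFDerivAt (fun v : Fin N → ℝ => v j) (ContinuousLinearMap.proj (R := ℝ) j) v :=
    (ContinuousLinearMap.proj (R := ℝ) (φ := fun _ : Fin N => ℝ) j).hasFDerivAt
  rw [pderiv, ((hi.const_mul K).fun_mul hj).fderiv]
  simp [Pi.single_apply]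
  ring_nf

/-- The derivative of `K uⁱuʲ` is the sum of the shift of `b` and its transpose, so the relation
between `g` and `b` survives the shift. -/
theorem pderiv_shiftG (hU : IsOpen U) (hg : ContDiffOn ℝ ∞ g U)
    (h : ∀ v ∈ U, ∀ i j s, pderiv s (fun v => g v i j) v = b v i j s + b v j i s) :
    ∀ v ∈ U, ∀ i j s, pderiv s (fun v => shiftG g K v i j) v =
      shiftB b K v i j s + shiftB b K v j i s := by
  intro v hv i j s
  have hgi := (contDiffOn_pi.1 (contDiffOn_pi.1 hg i) j).contDiffAt (hU.mem_nhds hv)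
  have h2 : ContDiff ℝ ∞ fun v : Fin N → ℝ => K * v i * v j := by fun_prop
  simp only [shiftG, shiftB]
  rw [pderiv_add (hgi.differentiableAt (by simp)) (h2.differentiable (by simp) v), h v hv,
    pderiv_quadratic]
  ring

/-- The cyclic sum of the variations of the pairing along `η dθ/dx`. -/
def cyclicVariation (g : (Fin N → ℝ) → Fin N → Fin N → ℝ)
    (b : (Fin N → ℝ) → Fin N → Fin N → Fin N → ℝ) (K : ℝ) (η : Matrix (Fin N) (Fin N) ℝ)
    (u ξ ζ θ : ℝ → Fin N → ℝ) : ℝ :=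
  pairingVariation g b K u ξ ζ (etaD η θ) + pairingVariation g b K u ζ θ (etaD η ξ) +
    pairingVariation g b K u θ ξ (etaD η ζ)

/-- The nonlocal parts cancel in the cyclic sum, so `K` enters only through `Γ`. -/
theorem cyclicVariation_eq (hU : IsOpen U) (hη : η.IsSymm) (hg : ContDiffOn ℝ ∞ g U)
    (hb : ContDiffOn ℝ ∞ b U)
    (h : ∀ v ∈ U, ∀ i j s, pderiv s (fun v => g v i j) v = b v i j s + b v j i s)
    {u ξ ζ θ : ℝ → Fin N → ℝ} (hu : IsField U u) (hξ : IsTest ξ) (hζ : IsTest ζ)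
    (hθ : IsTest θ) :
    cyclicVariation g b K η u ξ ζ θ =
      ∫ x, (reducedVariation (shiftB b K) u ξ ζ (etaD η θ) x +
        reducedVariation (shiftB b K) u ζ θ (etaD η ξ) x +
        reducedVariation (shiftB b K) u θ ξ (etaD η ζ) x) := by
  have hΓ := contDiffOn_shiftB hb K
  have hGΓ := pderiv_shiftG (K := K) hU hg h
  have e : ∀ {α : ℝ → Fin N → ℝ}, IsTest α → ContDiff ℝ ∞ (etaD η α) :=
    fun h => contDiff_etaD h.1
  have i1 := integrable_reducedVariation hU hΓ hu hξ hζ (e hθ)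
  have i2 := integrable_reducedVariation hU hΓ hu hζ hθ (e hξ)
  have i3 := integrable_reducedVariation hU hΓ hu hθ hξ (e hζ)
  have hnl := nonlocalVariation_cyclic hη hu.1 hξ hζ hθ
  have hsum := (integral_add (i1.add i2) i3).trans (congrArg (· + _) (integral_add i1 i2))
  refine Eq.trans ?_ hsum.symm
  rw [cyclicVariation, pairingVariation, pairingVariation, pairingVariation,
    integral_localVariation hU hΓ hGΓ hu hξ hζ (e hθ),
    integral_localVariation hU hΓ hGΓ hu hζ hθ (e hξ),
    integral_localVariation hU hΓ hGΓ hu hθ hξ (e hζ)]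
  linear_combination K * hnl

theorem cyclicVariation_eq_zero (hU : IsOpen U) (hη : η.IsSymm) (hg : ContDiffOn ℝ ∞ g U)
    (hb : ContDiffOn ℝ ∞ b U)
    (h : ∀ v ∈ U, ∀ i j s, pderiv s (fun v => g v i j) v = b v i j s + b v j i s)
    (hsymm : ∀ v ∈ U, ∀ i j t, ∑ s, shiftB b K v i j s * η s t = ∑ s, shiftB b K v t j s * η s i)
    (hcurl : ∀ v ∈ U, ∀ i j s k, curl (shiftB b K) v i j s k = 0)
    {u ξ ζ θ : ℝ → Fin N → ℝ} (hu : IsField U u) (hξ : IsTest ξ) (hζ : IsTest ζ)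
    (hθ : IsTest θ) : cyclicVariation g b K η u ξ ζ θ = 0 := by
  rw [cyclicVariation_eq hU hη hg hb h hu hξ hζ hθ]
  refine integral_eq_zero_of_ae (Eventually.of_forall fun x => ?_)
  have hc : ∀ α β φ : ℝ → Fin N → ℝ, curlForm (shiftB b K) u α β φ x = 0 := fun α β φ => by
    simp [curlForm, hcurl (u x) (hu.2 x)]
  have ht := fun a c d => triForm_symm (hsymm (u x) (hu.2 x)) a c d
  simp only [reducedVariation_etaD, hc, Pi.zero_apply]
  rw [ht (ξ x) (fun j => deriv (fun y => ζ y j) x), ht (ζ x) (fun j => deriv (fun y => ξ y j) x),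
    ht (θ x) (fun j => deriv (fun y => ζ y j) x)]
  ring

theorem triForm_single (Γ : Fin N → Fin N → Fin N → ℝ) (i j t : Fin N) (a c d : ℝ) :
    triForm Γ η (Pi.single i a) (Pi.single j c) (Pi.single t d) =
      (∑ s, Γ j i s * η s t) * a * c * d := by
  unfold triForm
  rw [Finset.sum_eq_single i, Finset.sum_eq_single j, Finset.sum_eq_single t]
  · simp
  all_goals simp +contextual

theorem etaD_singleField (t : Fin N) (f : ℝ → ℝ) (x : ℝ) (s : Fin N) :
    etaD η (singleField t f) x s = η s t * deriv f x := by
  simp only [etaD, deriv_singleField]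
  rw [Finset.sum_eq_single t]
  · simp
  all_goals simp +contextual

theorem curlForm_singleField (Γ : (Fin N → ℝ) → Fin N → Fin N → Fin N → ℝ)
    (u : ℝ → Fin N → ℝ) (i j t : Fin N) (f h k : ℝ → ℝ) (x : ℝ) :
    curlForm Γ u (singleField i f) (singleField j h) (etaD η (singleField t k)) x =
      f x * h x * deriv k x *
        ∑ s, ∑ r, curl Γ (u x) i j s r * η s t * deriv (fun y => u y r) x := by
  simp only [curlForm, etaD_singleField]
  rw [Finset.sum_eq_single i, Finset.sum_eq_single j]
  · simp only [singleField, Pi.single_eq_same, Finset.mul_sum]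
    exact Finset.sum_congr rfl fun s _ => Finset.sum_congr rfl fun r _ => by ring
  all_goals simp +contextual [singleField]

theorem reducedVariation_singleField (Γ : (Fin N → ℝ) → Fin N → Fin N → Fin N → ℝ)
    (u : ℝ → Fin N → ℝ) (i j t : Fin N) (f h k : ℝ → ℝ) (x : ℝ) :
    reducedVariation Γ u (singleField i f) (singleField j h) (etaD η (singleField t k)) x =
      (∑ s, Γ (u x) j i s * η s t) * f x * deriv h x * deriv k x
      - (∑ s, Γ (u x) i j s * η s t) * h x * deriv f x * deriv k x
      + f x * h x * deriv k x *
        ∑ s, ∑ r, curl Γ (u x) i j s r * η s t * deriv (fun y => u y r) x := by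
  rw [reducedVariation_etaD, curlForm_singleField]
  simp only [deriv_singleField]
  congr 2
  · exact triForm_single (Γ (u x)) i j t (f x) (deriv h x) (deriv k x)
  · exact triForm_single (Γ (u x)) j i t (h x) (deriv f x) (deriv k x)

/-- A constant field removes the curl terms. With a cutoff `χ` in slot `i` and the same `k` in slots
`j` and `t`, terms containing `χ'` drop out, and the two terms with `χ` undifferentiated give the
required difference times `∫(k')²`. -/
theorem shiftB_symm_of_cyclic (hU : IsOpen U) (hη : η.IsSymm) (hg : ContDiffOn ℝ ∞ g U)
    (hb : ContDiffOn ℝ ∞ b U)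
    (h : ∀ v ∈ U, ∀ i j s, pderiv s (fun v => g v i j) v = b v i j s + b v j i s)
    (hcyc : ∀ u ξ ζ θ, IsField U u → IsTest ξ → IsTest ζ → IsTest θ →
      cyclicVariation g b K η u ξ ζ θ = 0) {p : Fin N → ℝ} (hp : p ∈ U) (j i t : Fin N) :
    ∑ s, shiftB b K p j i s * η s t = ∑ s, shiftB b K p t i s * η s j := by
  obtain ⟨k, hk, hks, hne⟩ := exists_test_deriv_ne
  obtain ⟨χ, hχ, hχs, hχk⟩ := exists_cutoff hks
  have t1 := isTest_singleField i hχ hχs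
  have t2 := isTest_singleField j hk hks
  have t3 := isTest_singleField t hk hks
  have h0 := hcyc _ _ _ _ (isField_const hp) t1 t2 t3
  rw [cyclicVariation_eq hU hη hg hb h (isField_const hp) t1 t2 t3] at h0
  have h1 : (∑ s, shiftB b K p j i s * η s t - ∑ s, shiftB b K p t i s * η s j) *
      ∫ x, deriv k x * deriv k x = 0 := by
    rw [← integral_const_mul, ← h0]
    refine integral_congr_ae (Eventually.of_forall fun x => ?_)
    simp only [reducedVariation_singleField, deriv_const, mul_zero, Finset.sum_const_zero]
    rcases hχk x with ⟨e1, e2⟩ | ⟨e1, e2⟩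
    · rw [e1, e2]
      ring
    · rw [e1, e2]
      ring
  exact sub_eq_zero.1 ((mul_eq_zero.1 h1).resolve_right hne)

theorem contDiffOn_curl (hU : IsOpen U) {Γ : (Fin N → ℝ) → Fin N → Fin N → Fin N → ℝ}
    (hΓ : ContDiffOn ℝ ∞ Γ U) (i j s k : Fin N) :
    ContDiffOn ℝ ∞ (fun v => curl Γ v i j s k) U := by
  have hΓi := fun k => contDiffOn_pi.1 (contDiffOn_pi.1 (contDiffOn_pi.1 hΓ i) j) k
  exact (contDiffOn_pderiv hU (hΓi k) s).sub (contDiffOn_pderiv hU (hΓi s) k)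

/-- With cutoffs in slots `i` and `j` and `k` in slot `t`, every trilinear term differentiates at
least one cutoff. Only the curl contracted with `η` remains, integrated against `k'`; as `k` is
arbitrary, it vanishes along the field. -/
theorem curl_shiftB_of_cyclic (hU : IsOpen U) (hη : η.IsSymm) (hdet : η.det ≠ 0)
    (hg : ContDiffOn ℝ ∞ g U) (hb : ContDiffOn ℝ ∞ b U)
    (h : ∀ v ∈ U, ∀ i j s, pderiv s (fun v => g v i j) v = b v i j s + b v j i s)
    (hcyc : ∀ u ξ ζ θ, IsField U u → IsTest ξ → IsTest ζ → IsTest θ →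
      cyclicVariation g b K η u ξ ζ θ = 0) {p : Fin N → ℝ} (hp : p ∈ U) (i j s l : Fin N) :
    curl (shiftB b K) p i j s l = 0 := by
  have hsymm := fun v (hv : v ∈ U) => shiftB_symm_of_cyclic hU hη hg hb h hcyc hv
  -- The third covector enters only through `ηθ'`, so the test reaches the curl contracted with `η`;
  -- nondegeneracy of `η` removes the contraction.
  suffices hvec : Matrix.vecMul (fun s => curl (shiftB b K) p i j s l) η = 0 from
    congrFun (Matrix.eq_zero_of_vecMul_eq_zero hdet hvec) s
  ext t
  obtain ⟨ψ, hψ, hψs, hψ0, hψ1, hu⟩ := exists_field_through hU hp l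
  set u : ℝ → Fin N → ℝ := fun x => p + singleField l ψ x with hudef
  have hψ' : ContDiff ℝ ∞ (deriv ψ) := (contDiff_infty_iff_deriv.1 hψ).2
  have hux : ∀ x k, deriv (fun y => u y k) x = (Pi.single l (deriv ψ x) : Fin N → ℝ) k :=
    fun x k => deriv_add_singleField p l ψ x k
  set F : ℝ → ℝ := fun x => (∑ s, curl (shiftB b K) (u x) i j s l * η s t) * deriv ψ x with hFdef
  have hF : ContDiff ℝ ∞ F := by
    refine ContDiff.mul (ContDiff.sum fun s _ => ContDiff.mul ?_ contDiff_const) hψ'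
    exact contDiff_comp_field (contDiffOn_curl hU (contDiffOn_shiftB hb K) i j s l) hu
  have hFs : HasCompactSupport F := hψs.deriv.mul_left
  have hF0 : F = 0 := by
    refine eq_zero_of_integral_mul_deriv hF hFs fun k hk hks => ?_
    obtain ⟨χ, hχ, hχs, hχk⟩ := exists_cutoff hks
    have t1 := isTest_singleField i hχ hχs
    have t2 := isTest_singleField j hχ hχs
    have t3 := isTest_singleField t hk hks
    rw [← hcyc _ _ _ _ hu t1 t2 t3, cyclicVariation_eq hU hη hg hb h hu t1 t2 t3]
    refine integral_congr_ae (Eventually.of_forall fun x => ?_)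
    have hsum : ∑ s, ∑ r, curl (shiftB b K) (u x) i j s r * η s t *
        (Pi.single l (deriv ψ x) : Fin N → ℝ) r = F x := by
      simp [hFdef, Pi.single_apply, Finset.sum_mul]
    simp only [reducedVariation_singleField, hux, hsum]
    rw [hsymm (u x) (hu.2 x) t i j, hsymm (u x) (hu.2 x) t j i]
    rcases hχk x with ⟨e1, e2⟩ | ⟨e1, e2⟩
    · rw [e1, e2]
      ring
    · rw [e1, e2]
      ring
  have h0 := congrFun hF0 0
  have hu0 : u 0 = p := by simp [hudef, singleField, hψ0]
  simp only [hFdef, hψ1, hu0, Pi.zero_apply, mul_one] at h0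
  simpa [Matrix.vecMul, dotProduct] using h0

end Structure

/-! ### The mixed Jacobi identity and compatibility. -/

section MixedJacobi

variable {N : ℕ} {U : Set (Fin N → ℝ)} {η : Matrix (Fin N) (Fin N) ℝ}
  {g : (Fin N → ℝ) → Fin N → Fin N → ℝ} {b : (Fin N → ℝ) → Fin N → Fin N → Fin N → ℝ} {K : ℝ}

theorem bracket_eq_pairing (I J : Functional N) (u : ℝ → Fin N → ℝ) :
    bracket g b K I J u = pairing g b K u (varDeriv I u) (varDeriv J u) :=
  rfl

theorem bracket_linFunctional {ξ ζ u : ℝ → Fin N → ℝ} (hξ : IsTest ξ) (hζ : IsTest ζ)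
    (hu : Continuous u) :
    bracket g b K (linFunctional ξ) (linFunctional ζ) u = pairing g b K u ξ ζ := by
  rw [bracket_eq_pairing, (hasVarDeriv_linFunctional hξ.1 hξ.2 hu).varDeriv_eq,
    (hasVarDeriv_linFunctional hζ.1 hζ.2 hu).varDeriv_eq]

/-- Every test covector is the variational derivative of a linear functional, so skewness on
functionals becomes skewness of the pairing. -/
theorem IsPoissonBracket.pairing_skew (hP : IsPoissonBracket U (bracket g b K))
    (u ξ ζ : ℝ → Fin N → ℝ) (hu : IsField U u) (hξ : IsTest ξ) (hζ : IsTest ζ) :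
    pairing g b K u ξ ζ = -pairing g b K u ζ ξ := by
  rw [← bracket_linFunctional hξ hζ hu.1.continuous,
    ← bracket_linFunctional hζ hξ hu.1.continuous]
  exact hP.skew _ _ (isSmoothFunctional_linFunctional U hξ.1 hξ.2)
    (isSmoothFunctional_linFunctional U hζ.1 hζ.2) u hu

theorem IsSmoothFunctional.isTest_varDeriv {F : Functional N} (hF : IsSmoothFunctional U F)
    {u : ℝ → Fin N → ℝ} (hu : IsField U u) : IsTest (varDeriv F u) :=
  ⟨hF.contDiff_varDeriv hu, hF.hasCompactSupport_varDeriv hu⟩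

theorem IsTest.etaD {ξ : ℝ → Fin N → ℝ} (hξ : IsTest ξ) : IsTest (etaD η ξ) :=
  ⟨contDiff_etaD hξ.1, hasCompactSupport_etaD hξ.2⟩

theorem IsSmoothFunctional.isTest_secondVar (hU : IsOpen U) {F : Functional N}
    (hF : IsSmoothFunctional U F) {u ψ : ℝ → Fin N → ℝ} (hu : IsField U u) (hψ : IsTest ψ) :
    IsTest (secondVar F u ψ) :=
  ⟨hF.contDiff_secondVar hU hu hψ.1 hψ.2, hF.hasCompactSupport_secondVar hU hu hψ.1 hψ.2⟩

theorem pairing_sub_left (hg : ContDiffOn ℝ ∞ g U) (hb : ContDiffOn ℝ ∞ b U)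
    {u ξ ξ' ζ : ℝ → Fin N → ℝ} (hu : IsField U u) (hξ : IsTest ξ) (hξ' : IsTest ξ')
    (hζ : IsTest ζ) :
    pairing g b K u (ξ - ξ') ζ = pairing g b K u ξ ζ - pairing g b K u ξ' ζ := by
  rw [pairing, pairing, pairing, ← integral_sub (integrable_pairing_density hg hb K hu hξ hζ)
    (integrable_pairing_density hg hb K hu hξ' hζ)]
  simp only [Pi.sub_apply, sub_mul, Finset.sum_sub_distrib]

/-- The derivative of the bracket of two smooth functionals in the direction of a test
variation. -/
theorem hasDerivAt_bracket (hU : IsOpen U) (hg : ContDiffOn ℝ ∞ g U) (hb : ContDiffOn ℝ ∞ b U)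
    {I J : Functional N} (hI : IsSmoothFunctional U I) (hJ : IsSmoothFunctional U J)
    {u φ : ℝ → Fin N → ℝ} (hu : IsField U u) (hφ : IsTest φ) :
    HasDerivAt (fun ε : ℝ => bracket g b K I J (u + ε • φ))
      (pairing g b K u (secondVar I u φ) (varDeriv J u) +
        pairing g b K u (varDeriv I u) (secondVar J u φ) +
        pairingVariation g b K u (varDeriv I u) (varDeriv J u) φ) 0 := by
  have hw := hu.fieldNear hU hφ.1 hφ.2
  have h := hasDerivAt_pairing hU hg hb K hw (hI.smoothNear_varDeriv hw)
    (hI.suppNear_varDeriv hw) (hJ.smoothNear_varDeriv hw) (hJ.suppNear_varDeriv hw)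
  have hd : ∀ y, deriv (fun t : ℝ => u y + t • φ y) 0 = φ y := fun y => by
    simpa using (((hasDerivAt_id (0 : ℝ)).smul_const (φ y)).const_add (u y)).deriv
  simp only [zero_smul, add_zero, hd] at h
  exact h

theorem bracket_constBracket (hU : IsOpen U) (hη : η.IsSymm) (hg : ContDiffOn ℝ ∞ g U)
    (hb : ContDiffOn ℝ ∞ b U) {I J L : Functional N} (hI : IsSmoothFunctional U I)
    (hJ : IsSmoothFunctional U J) (hL : IsSmoothFunctional U L) {u : ℝ → Fin N → ℝ}
    (hu : IsField U u) :
    bracket g b K (constBracket η I J) L u =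
      pairing g b K u (secondVar I u (etaD η (varDeriv J u))) (varDeriv L u) -
      pairing g b K u (secondVar J u (etaD η (varDeriv I u))) (varDeriv L u) := by
  rw [bracket_eq_pairing, (constBracket_hasVarDeriv hU hη hI hJ hu).varDeriv_eq, constBracketVar,
    pairing_sub_left hg hb hu (hI.isTest_secondVar hU hu (hJ.isTest_varDeriv hu).etaD)
      (hJ.isTest_secondVar hU hu (hI.isTest_varDeriv hu).etaD) (hL.isTest_varDeriv hu)]

/-- The constant bracket with `L` is the derivative in the direction `η d/dx (δL/δu)`, a test
direction. The chain rule therefore replaces any explicit variational derivative of the first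
bracket. -/
theorem constBracket_bracket (hU : IsOpen U) (hg : ContDiffOn ℝ ∞ g U)
    (hb : ContDiffOn ℝ ∞ b U)
    (hskew : ∀ u ξ ζ, IsField U u → IsTest ξ → IsTest ζ →
      pairing g b K u ξ ζ = -pairing g b K u ζ ξ) {I J L : Functional N}
    (hI : IsSmoothFunctional U I)
    (hJ : IsSmoothFunctional U J) (hL : IsSmoothFunctional U L)
    (hIJ : IsSmoothFunctional U (bracket g b K I J)) {u : ℝ → Fin N → ℝ} (hu : IsField U u) :
    constBracket η (bracket g b K I J) L u =
      pairing g b K u (secondVar I u (etaD η (varDeriv L u))) (varDeriv J u) -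
      pairing g b K u (secondVar J u (etaD η (varDeriv L u))) (varDeriv I u) +
      pairingVariation g b K u (varDeriv I u) (varDeriv J u) (etaD η (varDeriv L u)) := by
  have hφ : IsTest (etaD η (varDeriv L u)) := (hL.isTest_varDeriv hu).etaD
  rw [constBracket_apply, ((hIJ.hasVarDeriv hu).2.2 _ hφ.1 hφ.2).unique
    (hasDerivAt_bracket hU hg hb hI hJ hu hφ),
    hskew u _ _ hu (hI.isTest_varDeriv hu) (hJ.isTest_secondVar hU hu hφ)]
  ring

/-- The mixed part of the Jacobi identity for a linear combination of a Mokhov–Ferapontov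
bracket with the constant bracket. -/
theorem mixed_jacobi (hU : IsOpen U) (hη : η.IsSymm) (hg : ContDiffOn ℝ ∞ g U)
    (hb : ContDiffOn ℝ ∞ b U)
    (hskew : ∀ u ξ ζ, IsField U u → IsTest ξ → IsTest ζ →
      pairing g b K u ξ ζ = -pairing g b K u ζ ξ)
    (hsm : ∀ I J, IsSmoothFunctional U I → IsSmoothFunctional U J →
      IsSmoothFunctional U (bracket g b K I J))
    (hsymm : ∀ v ∈ U, ∀ i j t, ∑ s, shiftB b K v i j s * η s t = ∑ s, shiftB b K v t j s * η s i)
    (hcurl : ∀ v ∈ U, ∀ i j s k, curl (shiftB b K) v i j s k = 0)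
    {I J L : Functional N} (hI : IsSmoothFunctional U I)
    (hJ : IsSmoothFunctional U J) (hL : IsSmoothFunctional U L) {u : ℝ → Fin N → ℝ}
    (hu : IsField U u) :
    (bracket g b K (constBracket η I J) L u + constBracket η (bracket g b K I J) L u) +
    (bracket g b K (constBracket η J L) I u + constBracket η (bracket g b K J L) I u) +
    (bracket g b K (constBracket η L I) J u + constBracket η (bracket g b K L I) J u) = 0 := by
  have hcyc := cyclicVariation_eq_zero hU hη hg hb
    (fun v hv i j s => pderiv_of_skew hU hg hb hskew hv i j s) hsymm hcurl hu
    (hI.isTest_varDeriv hu) (hJ.isTest_varDeriv hu) (hL.isTest_varDeriv hu)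
  rw [cyclicVariation] at hcyc
  rw [bracket_constBracket hU hη hg hb hI hJ hL hu, bracket_constBracket hU hη hg hb hJ hL hI hu,
    bracket_constBracket hU hη hg hb hL hI hJ hu,
    constBracket_bracket hU hg hb hskew hI hJ hL (hsm I J hI hJ) hu,
    constBracket_bracket hU hg hb hskew hJ hL hI (hsm J L hJ hL) hu,
    constBracket_bracket hU hg hb hskew hL hI hJ (hsm L I hL hI) hu]
  -- Each second-variation pairing, such as that of `secondVar I` along `ηδJ` with `δL`, occurs
  -- twice with opposite signs: once from an inner and once from an outer constant bracket.
  linear_combination hcyc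

theorem curl_const_zero (v : Fin N → ℝ) (i j s k : Fin N) :
    curl (shiftB (fun _ _ _ _ => 0) 0) v i j s k = 0 := by
  simp [curl, shiftB, pderiv]

/-- The constant bracket is the case `g = η`, `b = 0`, `K = 0` of the first bracket; mixed with
itself, it gives twice its Jacobi identity. Here `Γ = 0`, so both conditions hold trivially. -/
theorem constBracket_jacobi (hU : IsOpen U) (hη : η.IsSymm) {I J L : Functional N}
    (hI : IsSmoothFunctional U I) (hJ : IsSmoothFunctional U J) (hL : IsSmoothFunctional U L)
    {u : ℝ → Fin N → ℝ} (hu : IsField U u) :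
    constBracket η (constBracket η I J) L u + constBracket η (constBracket η J L) I u +
      constBracket η (constBracket η L I) J u = 0 := by
  have h := mixed_jacobi (g := fun _ i j => η i j) (b := fun _ _ _ _ => 0) (K := 0) hU hη
    contDiffOn_const contDiffOn_const ?_
    (fun I J hI hJ => isSmoothFunctional_constBracket hU hη hI hJ) ?_
    (fun v _ => curl_const_zero v) hI hJ hL hu
  · linarith
  · intro u ξ ζ _ hξ hζ
    simp only [pairing, operator_const]
    exact integral_mul_etaD hη hξ.1 hξ.2 hζ.1 hζ.2
  · intro v _ i j t
    simp [shiftB]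

/-- A linear combination of a Poisson Mokhov–Ferapontov bracket with the constant bracket is
Poisson if the mixed Jacobi identity holds. -/
theorem compatible_of_structure (hU : IsOpen U) (hη : η.IsSymm) (hg : ContDiffOn ℝ ∞ g U)
    (hb : ContDiffOn ℝ ∞ b U) (hP : IsPoissonBracket U (bracket g b K))
    (hsymm : ∀ v ∈ U, ∀ i j t, ∑ s, shiftB b K v i j s * η s t = ∑ s, shiftB b K v t j s * η s i)
    (hcurl : ∀ v ∈ U, ∀ i j s k, curl (shiftB b K) v i j s k = 0) :
    Compatible U (bracket g b K) (constBracket η) := by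
  intro c₁ c₂
  have hs2 := fun I J (hI : IsSmoothFunctional U I) (hJ : IsSmoothFunctional U J) =>
    isSmoothFunctional_constBracket hU hη hI hJ
  refine ⟨fun I J hI hJ => ?_, fun I J L hI hJ hL u hu => ?_, fun c I J hI hJ u hu => ?_,
    fun I J hI hJ u hu => ?_, fun I J L hI hJ hL u hu => ?_, fun I J L hI hJ hL u hu => ?_⟩
  · exact ((hP.smooth I J hI hJ).smul c₁).add ((hs2 I J hI hJ).smul c₂)
  · simp only [hP.add_left I J L hI hJ hL u hu, constBracket_add_left hI hJ hL hu]
    ring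
  · simp only [hP.smul_left c I J hI hJ u hu, constBracket_smul_left c hI hu]
    ring
  · simp only [hP.skew I J hI hJ u hu, constBracket_skew hη hI hJ hu]
    ring
  · simp only [hP.leibniz I J L hI hJ hL u hu, constBracket_leibniz hI hJ hL hu]
    ring
  · have hl1 : ∀ I J L, IsSmoothFunctional U I → IsSmoothFunctional U J →
        IsSmoothFunctional U L →
        bracket g b K (fun v => c₁ * bracket g b K I J v + c₂ * constBracket η I J v) L u =
          c₁ * bracket g b K (bracket g b K I J) L u +
          c₂ * bracket g b K (constBracket η I J) L u := by
      intro I J L hI hJ hL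
      have s1 := hP.smooth I J hI hJ
      have s2 := hs2 I J hI hJ
      rw [← hP.smul_left c₁ _ _ s1 hL u hu, ← hP.smul_left c₂ _ _ s2 hL u hu,
        ← hP.add_left _ _ _ (s1.smul c₁) (s2.smul c₂) hL u hu]
      rfl
    have hl2 : ∀ I J L, IsSmoothFunctional U I → IsSmoothFunctional U J →
        IsSmoothFunctional U L →
        constBracket η (fun v => c₁ * bracket g b K I J v + c₂ * constBracket η I J v) L u =
          c₁ * constBracket η (bracket g b K I J) L u +
          c₂ * constBracket η (constBracket η I J) L u := by
      intro I J L hI hJ hL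
      have s1 := hP.smooth I J hI hJ
      have s2 := hs2 I J hI hJ
      rw [← constBracket_smul_left c₁ s1 hu, ← constBracket_smul_left c₂ s2 hu,
        ← constBracket_add_left (s1.smul c₁) (s2.smul c₂) hL hu]
      rfl
    -- The coefficients of `c₁²`, `c₂²` and `c₁c₂` in the Jacobi sum vanish separately.
    have j1 := hP.jacobi I J L hI hJ hL u hu
    have j2 := constBracket_jacobi hU hη hI hJ hL hu
    have j3 := mixed_jacobi hU hη hg hb hP.pairing_skew hP.smooth hsymm hcurl hI hJ hL hu
    simp only [hl1 I J L hI hJ hL, hl1 J L I hJ hL hI, hl1 L I J hL hI hJ,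
      hl2 I J L hI hJ hL, hl2 J L I hJ hL hI, hl2 L I J hL hI hJ]
    linear_combination c₁ * c₁ * j1 + c₂ * c₂ * j2 + c₁ * c₂ * j3

/-- For compatible brackets the cyclic sum of the variations vanishes. -/
theorem cyclicVariation_of_compatible (hU : IsOpen U) (hη : η.IsSymm) (hg : ContDiffOn ℝ ∞ g U)
    (hb : ContDiffOn ℝ ∞ b U) (hP : IsPoissonBracket U (bracket g b K))
    (hC : Compatible U (bracket g b K) (constBracket η)) (u ξ ζ θ : ℝ → Fin N → ℝ)
    (hu : IsField U u) (hξ : IsTest ξ) (hζ : IsTest ζ) (hθ : IsTest θ) :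
    cyclicVariation g b K η u ξ ζ θ = 0 := by
  have hlin : ∀ {α : ℝ → Fin N → ℝ}, IsTest α → IsSmoothFunctional U (linFunctional α) :=
    fun h => isSmoothFunctional_linFunctional U h.1 h.2
  have hv : ∀ {α : ℝ → Fin N → ℝ}, IsTest α → varDeriv (linFunctional α) u = α :=
    fun h => (hasVarDeriv_linFunctional h.1 h.2 hu.1.continuous).varDeriv_eq
  have hsec : ∀ {α φ : ℝ → Fin N → ℝ}, IsTest α → IsTest φ →
      secondVar (linFunctional α) u φ = 0 := by
    intro α φ hα hφ
    ext1 x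
    have : (fun s : ℝ => varDeriv (linFunctional α) (u + s • φ) x) = fun _ => α x := by
      ext1 s
      rw [(hasVarDeriv_linFunctional hα.1 hα.2
        (hu.1.continuous.add (hφ.1.continuous.const_smul s))).varDeriv_eq]
    simp [secondVar, this]
  have hpz : ∀ α : ℝ → Fin N → ℝ, pairing g b K u 0 α = 0 := fun α => by simp [pairing]
  have key : ∀ {α β γ : ℝ → Fin N → ℝ}, IsTest α → IsTest β → IsTest γ →
      constBracket η (bracket g b K (linFunctional α) (linFunctional β)) (linFunctional γ) u =
        pairingVariation g b K u α β (etaD η γ) := by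
    intro α β γ hα hβ hγ
    rw [constBracket_bracket hU hg hb hP.pairing_skew (hlin hα) (hlin hβ) (hlin hγ)
      (hP.smooth _ _ (hlin hα) (hlin hβ)) hu, hv hα, hv hβ, hv hγ, hsec hα hγ.etaD,
      hsec hβ hγ.etaD, hpz, hpz]
    ring
  -- The constant bracket of two linear functionals does not depend on the field, so its variational
  -- derivative is zero and it contributes nothing as an inner bracket.
  have hconst : ∀ {α β γ : ℝ → Fin N → ℝ}, IsTest α → IsTest β → IsTest γ →
      bracket g b K (constBracket η (linFunctional α) (linFunctional β)) (linFunctional γ) u = 0 ∧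
      constBracket η (constBracket η (linFunctional α) (linFunctional β)) (linFunctional γ) u
        = 0 := by
    intro α β γ hα hβ hγ
    have h0 : varDeriv (constBracket η (linFunctional α) (linFunctional β)) u = 0 := by
      rw [(constBracket_hasVarDeriv hU hη (hlin hα) (hlin hβ) hu).varDeriv_eq, constBracketVar,
        hv hα, hv hβ, hsec hα hβ.etaD, hsec hβ hα.etaD, sub_zero]
    constructor
    · rw [bracket_eq_pairing, h0, hpz]
    · rw [constBracket_apply, h0]
      simp
  have hlin2 : ∀ {α β γ : ℝ → Fin N → ℝ}, IsTest α → IsTest β → IsTest γ →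
      bracket g b K (fun v => 1 * bracket g b K (linFunctional α) (linFunctional β) v +
          1 * constBracket η (linFunctional α) (linFunctional β) v) (linFunctional γ) u =
        bracket g b K (bracket g b K (linFunctional α) (linFunctional β)) (linFunctional γ) u ∧
      constBracket η (fun v => 1 * bracket g b K (linFunctional α) (linFunctional β) v +
          1 * constBracket η (linFunctional α) (linFunctional β) v) (linFunctional γ) u =
        pairingVariation g b K u α β (etaD η γ) := by
    intro α β γ hα hβ hγ
    have s1 := hP.smooth _ _ (hlin hα) (hlin hβ)
    have s2 := isSmoothFunctional_constBracket hU hη (hlin hα) (hlin hβ)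
    have e1 := hP.add_left _ _ _ s1 s2 (hlin hγ) u hu
    have e2 := constBracket_add_left (η := η) s1 s2 (hlin hγ) hu
    rw [(hconst hα hβ hγ).1, add_zero] at e1
    rw [(hconst hα hβ hγ).2, add_zero, key hα hβ hγ] at e2
    simp only [one_mul]
    exact ⟨e1, e2⟩
  -- For linear functionals the Jacobi sum of `{,}₁ + {,}₂` is that of `{,}₁` plus the cyclic
  -- variation, so subtracting the two identities isolates the latter.
  have j1 := hP.jacobi _ _ _ (hlin hξ) (hlin hζ) (hlin hθ) u hu
  have j2 := (hC 1 1).jacobi _ _ _ (hlin hξ) (hlin hζ) (hlin hθ) u hu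
  simp only [(hlin2 hξ hζ hθ).1, (hlin2 hξ hζ hθ).2, (hlin2 hζ hθ hξ).1, (hlin2 hζ hθ hξ).2,
    (hlin2 hθ hξ hζ).1, (hlin2 hθ hξ hζ).2] at j2
  rw [cyclicVariation]
  linear_combination j2 - j1

end MixedJacobi

/-! ### The Poincaré lemma and construction of the potentials. -/

section Potentials

variable {N : ℕ} {U V : Set (Fin N → ℝ)} {η : Matrix (Fin N) (Fin N) ℝ}
  {g : (Fin N → ℝ) → Fin N → Fin N → ℝ} {b : (Fin N → ℝ) → Fin N → Fin N → Fin N → ℝ} {K : ℝ}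

theorem pderiv_congr {f h : (Fin N → ℝ) → ℝ} (hV : IsOpen V) (hfh : ∀ v ∈ V, f v = h v)
    {v : Fin N → ℝ} (hv : v ∈ V) (s : Fin N) : pderiv s f v = pderiv s h v := by
  have : f =ᶠ[𝓝 v] h := by
    filter_upwards [hV.mem_nhds hv] with z hz using hfh z hz
  rw [pderiv, pderiv, this.fderiv_eq]

theorem _root_.ContDiffOn.differentiableAt_of_isOpen {f : (Fin N → ℝ) → ℝ} (hV : IsOpen V)
    (hf : ContDiffOn ℝ ∞ f V) {v : Fin N → ℝ} (hv : v ∈ V) : DifferentiableAt ℝ f v :=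
  (hf.contDiffAt (hV.mem_nhds hv)).differentiableAt (by simp)

theorem pderiv_sum_mul {f : Fin N → (Fin N → ℝ) → ℝ} {v : Fin N → ℝ}
    (hf : ∀ r, DifferentiableAt ℝ (f r) v) (c : Fin N → ℝ) (s : Fin N) :
    pderiv s (fun v => ∑ r, c r * f r v) v = ∑ r, c r * pderiv s (f r) v := by
  have h : HasFDerivAt (fun v => ∑ r, c r * f r v) (∑ r, c r • fderiv ℝ (f r) v) v :=
    HasFDerivAt.fun_sum fun r _ => (hf r).hasFDerivAt.const_mul (c r)
  rw [pderiv, h.fderiv]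
  simp [pderiv]

theorem pderiv_comm {f : (Fin N → ℝ) → ℝ} (hV : IsOpen V) (hf : ContDiffOn ℝ ∞ f V)
    {v : Fin N → ℝ} (hv : v ∈ V) (s k : Fin N) :
    pderiv s (pderiv k f) v = pderiv k (pderiv s f) v := by
  have hc := hf.contDiffAt (hV.mem_nhds hv)
  have hd : DifferentiableAt ℝ (fderiv ℝ f) v :=
    (hc.fderiv_right (m := ∞) (by simp)).differentiableAt (by simp)
  have key : ∀ s k, pderiv s (pderiv k f) v =
      fderiv ℝ (fderiv ℝ f) v (Pi.single s 1) (Pi.single k 1) := by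
    intro s k
    have h0 : HasFDerivAt (fun y => fderiv ℝ f y (Pi.single k (1 : ℝ)))
        ((fderiv ℝ (fderiv ℝ f) v).flip (Pi.single k 1)) v := by
      simpa using hd.hasFDerivAt.clm_apply (hasFDerivAt_const (Pi.single k (1 : ℝ)) v)
    have h1 : HasFDerivAt (pderiv k f) _ v := h0
    rw [pderiv, h1.fderiv]
    rfl
  rw [key, key]
  exact hc.isSymmSndFDerivAt
    (by rw [minSmoothness_of_isRCLikeNormedField]; exact WithTop.coe_le_coe.2 le_top) _ _

/-- The Poincaré lemma for `1`-forms in coordinates. -/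
theorem exists_potential (hV : IsOpen V) (hconv : Convex ℝ V) {f : Fin N → (Fin N → ℝ) → ℝ}
    (hf : ∀ k, ContDiffOn ℝ ∞ (f k) V)
    (hclosed : ∀ v ∈ V, ∀ k l, pderiv l (f k) v = pderiv k (f l) v) :
    ∃ h : (Fin N → ℝ) → ℝ, ContDiffOn ℝ ∞ h V ∧ ∀ v ∈ V, ∀ k, pderiv k h v = f k v := by
  set form : (Fin N → ℝ) → (Fin N → ℝ) →L[ℝ] ℝ :=
    fun v => ∑ k, f k v • ContinuousLinearMap.proj (R := ℝ) (φ := fun _ : Fin N => ℝ) k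
    with hform
  have hsm : ContDiffOn ℝ ∞ form V :=
    ContDiffOn.sum fun k _ => (hf k).smul contDiffOn_const
  have hd : ∀ v ∈ V, HasFDerivAt form (∑ k, (fderiv ℝ (f k) v).smulRight
      (ContinuousLinearMap.proj (R := ℝ) (φ := fun _ : Fin N => ℝ) k)) v := fun v hv =>
    HasFDerivAt.fun_sum fun k _ =>
      HasFDerivAt.smul_const ((hf k).differentiableAt_of_isOpen hV hv).hasFDerivAt
        (ContinuousLinearMap.proj (R := ℝ) (φ := fun _ : Fin N => ℝ) k :
          (Fin N → ℝ) →L[ℝ] ℝ)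
  obtain ⟨h, hh⟩ := hconv.exists_forall_hasFDerivAt_of_fderiv_symmetric hV
    (hsm.differentiableOn (by simp)) (fun v hv x y => by
      rw [(hd v hv).fderiv]
      simp only [sum_apply, ContinuousLinearMap.smulRight_apply,
        smul_apply, ContinuousLinearMap.proj_apply, smul_eq_mul,
        fderiv_eq_sum_pderiv, Finset.sum_mul]
      rw [Finset.sum_comm]
      refine Finset.sum_congr rfl fun k _ => Finset.sum_congr rfl fun l _ => ?_
      rw [hclosed v hv]
      ring)
  refine ⟨h, ?_, fun v hv k => ?_⟩
  · refine (contDiffOn_infty_iff_fderiv_of_isOpen hV).2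
      ⟨fun v hv => (hh v hv).differentiableAt.differentiableWithinAt, ?_⟩
    exact hsm.congr fun v hv => (hh v hv).fderiv
  · rw [pderiv, (hh v hv).fderiv]
    simp [hform, Pi.single_apply]

theorem eq_of_pderiv_eq (hV : IsOpen V) (hconv : Convex ℝ V) {f h : (Fin N → ℝ) → ℝ}
    (hf : ContDiffOn ℝ ∞ f V) (hh : ContDiffOn ℝ ∞ h V)
    (hd : ∀ v ∈ V, ∀ k, pderiv k f v = pderiv k h v) {p v : Fin N → ℝ} (hp : p ∈ V)
    (hv : v ∈ V) : f v - h v = f p - h p := by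
  refine hV.is_const_of_fderiv_eq_zero (f := fun v => f v - h v) hconv.isPreconnected
    ((hf.sub hh).differentiableOn (by simp)) (fun z hz => ?_) hv hp
  have e := fderiv_fun_sub (hf.differentiableAt_of_isOpen hV hz)
    (hh.differentiableAt_of_isOpen hV hz)
  rw [e]
  ext y
  simp [fderiv_eq_sum_pderiv, hd z hz]

/-- On a ball, the curl condition integrates `η⁻¹Γ` once, to functions `Pʲₛ`. The symmetry condition
makes `Pʲₛ dvˢ` closed, and a second integration gives `Hʲ`. In between, constants of integration
are chosen so that `G`, and not only its derivatives, comes out right. -/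
theorem exists_potentials_of_structure (hU : IsOpen U) (hη : η.IsSymm) (hdet : η.det ≠ 0)
    (hg : ContDiffOn ℝ ∞ g U) (hb : ContDiffOn ℝ ∞ b U)
    (hgs : ∀ v ∈ U, ∀ i j, g v i j = g v j i)
    (h : ∀ v ∈ U, ∀ i j s, pderiv s (fun v => g v i j) v = b v i j s + b v j i s)
    (hsymm : ∀ v ∈ U, ∀ i j t, ∑ s, shiftB b K v i j s * η s t = ∑ s, shiftB b K v t j s * η s i)
    (hcurl : ∀ v ∈ U, ∀ i j s k, curl (shiftB b K) v i j s k = 0)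
    {p : Fin N → ℝ} (hp : p ∈ U) :
    ∃ V : Set (Fin N → ℝ), IsOpen V ∧ p ∈ V ∧ V ⊆ U ∧
      ∃ H : Fin N → (Fin N → ℝ) → ℝ, (∀ i, ContDiffOn ℝ ∞ (H i) V) ∧
        ∀ u ∈ V,
          (∀ i j, g u i j =
            ∑ s, η i s * pderiv s (H j) u + ∑ s, η j s * pderiv s (H i) u - K * u i * u j) ∧
          (∀ i j k, b u i j k =
            ∑ s, η i s * pderiv s (pderiv k (H j)) u - K * (if i = k then 1 else 0) * u j) := by
  obtain ⟨δ, hδ, hball⟩ := Metric.isOpen_iff.1 hU p hp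
  have hV : IsOpen (Metric.ball p δ) := Metric.isOpen_ball
  have hconv : Convex ℝ (Metric.ball p δ) := convex_ball p δ
  set V := Metric.ball p δ with hVdef
  have hpV : p ∈ V := Metric.mem_ball_self hδ
  have hunit : IsUnit η.det := isUnit_iff_ne_zero.2 hdet
  have hΓ := (contDiffOn_shiftB hb K).mono hball
  have hΓi := fun i j k => contDiffOn_pi.1 (contDiffOn_pi.1 (contDiffOn_pi.1 hΓ i) j) k
  have hGi := fun i j => contDiffOn_pi.1 (contDiffOn_pi.1 ((contDiffOn_shiftG hg K).mono hball) i) j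
  set T : Fin N → Fin N → Fin N → (Fin N → ℝ) → ℝ :=
    fun j s k v => ∑ i, η⁻¹ s i * shiftB b K v i j k with hT
  have hTc : ∀ j s k, ContDiffOn ℝ ∞ (T j s k) V := fun j s k =>
    ContDiffOn.sum fun i _ => contDiffOn_const.mul (hΓi i j k)
  have hηT : ∀ i j k v, ∑ s, η i s * T j s k v = shiftB b K v i j k := by
    intro i j k v
    have : η.mulVec ((η⁻¹).mulVec fun i => shiftB b K v i j k) = fun i => shiftB b K v i j k := by
      rw [Matrix.mulVec_mulVec, Matrix.mul_nonsing_inv _ hunit, Matrix.one_mulVec]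
    exact congrFun this i
  -- For fixed `j`, symmetry of `Aη` is equivalent to symmetry of `η⁻¹A = η⁻¹(Aη)η⁻¹`, a congruence
  -- by the symmetric matrix `η⁻¹`.
  have hTsymm : ∀ v ∈ V, ∀ j s k, T j s k v = T j k s v := by
    intro v hv j s k
    set A : Matrix (Fin N) (Fin N) ℝ := Matrix.of fun i k => shiftB b K v i j k with hA
    have h1 : A * η = (A * η).transpose := by
      ext i t
      simpa [Matrix.mul_apply, hA] using hsymm v (hball hv) i j t
    have h2 : η⁻¹ * A = (η⁻¹ * A).transpose := by
      rw [Matrix.transpose_mul, hη.eq] at h1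
      have hinv : (η⁻¹).transpose = η⁻¹ := by rw [Matrix.transpose_nonsing_inv, hη.eq]
      rw [Matrix.transpose_mul, hinv]
      calc η⁻¹ * A = η⁻¹ * (A * η) * η⁻¹ := by
            rw [Matrix.mul_assoc, Matrix.mul_assoc, Matrix.mul_nonsing_inv _ hunit,
              Matrix.mul_one]
        _ = A.transpose * η⁻¹ := by
            rw [h1, ← Matrix.mul_assoc, Matrix.nonsing_inv_mul _ hunit, Matrix.one_mul]
    have h3 := congrFun (congrFun h2 s) k
    simpa [Matrix.mul_apply, hA] using h3
  have hpot : ∀ j s, ∃ P : (Fin N → ℝ) → ℝ, ContDiffOn ℝ ∞ P V ∧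
      ∀ v ∈ V, ∀ k, pderiv k P v = T j s k v := by
    intro j s
    refine exists_potential hV hconv (fun k => hTc j s k) fun v hv k l => ?_
    have hdiff := fun k i => (hΓi i j k).differentiableAt_of_isOpen hV hv
    simp only [hT]
    rw [pderiv_sum_mul (hdiff k), pderiv_sum_mul (hdiff l)]
    refine Finset.sum_congr rfl fun i _ => ?_
    have := hcurl v (hball hv) i j l k
    rw [curl, sub_eq_zero] at this
    rw [this]
  choose P hPc hPd using hpot
  -- `c` is the error at `p` in the formula for `G`. It is symmetric, so adding `½η⁻¹c` to `P`
  -- contributes `½c` through each of the two transposed sums and corrects the error exactly,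
  -- without changing derivatives.
  set c : Fin N → Fin N → ℝ := fun i j =>
    shiftG g K p i j - (∑ s, η i s * P j s p + ∑ s, η j s * P i s p) with hc
  have hcs : ∀ i j, c i j = c j i := by
    intro i j
    simp only [hc, shiftG, hgs p hp i j]
    ring
  set Q : Fin N → Fin N → (Fin N → ℝ) → ℝ := fun j s v =>
    P j s v + 1 / 2 * ∑ r, η⁻¹ s r * c r j with hQ
  have hQc : ∀ j s, ContDiffOn ℝ ∞ (Q j s) V := fun j s => (hPc j s).add contDiffOn_const
  have hQd : ∀ v ∈ V, ∀ j s k, pderiv k (Q j s) v = T j s k v := by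
    intro v hv j s k
    rw [← hPd j s v hv k, pderiv, pderiv, hQ, fderiv_add_const]
  have hQη : ∀ i j v, ∑ s, η i s * Q j s v = ∑ s, η i s * P j s v + 1 / 2 * c i j := by
    intro i j v
    have : η.mulVec ((η⁻¹).mulVec fun r => c r j) = fun r => c r j := by
      rw [Matrix.mulVec_mulVec, Matrix.mul_nonsing_inv _ hunit, Matrix.one_mulVec]
    have h1 : ∑ s, η i s * ∑ r, η⁻¹ s r * c r j = c i j := congrFun this i
    rw [← h1, Finset.mul_sum, ← Finset.sum_add_distrib]
    exact Finset.sum_congr rfl fun s _ => by simp only [hQ]; ring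
  -- Both sides have derivative `Γⁱʲₖ + Γʲⁱₖ`, so on the ball they differ by a constant, and `c` was
  -- chosen to make that constant zero.
  have hGQ : ∀ v ∈ V, ∀ i j, shiftG g K v i j = ∑ s, η i s * Q j s v + ∑ s, η j s * Q i s v := by
    intro v hv i j
    have hPη : ∀ i j, ContDiffOn ℝ ∞ (fun v => ∑ s, η i s * P j s v) V := fun i j =>
      ContDiffOn.sum fun s _ => contDiffOn_const.mul (hPc j s)
    have := eq_of_pderiv_eq hV hconv (hGi i j) ((hPη i j).add (hPη j i)) (fun z hz k => ?_) hpV hv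
    · rw [hQη, hQη, hcs j i]
      have hcv : c i j = shiftG g K p i j - (∑ s, η i s * P j s p + ∑ s, η j s * P i s p) := rfl
      linarith
    · have hPz := fun j s => (hPc j s).differentiableAt_of_isOpen hV hz
      rw [pderiv_shiftG hU hg h z (hball hz), pderiv_add
        ((hPη i j).differentiableAt_of_isOpen hV hz) ((hPη j i).differentiableAt_of_isOpen hV hz),
        pderiv_sum_mul (hPz j), pderiv_sum_mul (hPz i)]
      simp only [hPd _ _ z hz, hηT]
  have hH : ∀ j, ∃ H : (Fin N → ℝ) → ℝ, ContDiffOn ℝ ∞ H V ∧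
      ∀ v ∈ V, ∀ s, pderiv s H v = Q j s v := by
    intro j
    refine exists_potential hV hconv (fun s => hQc j s) fun v hv k l => ?_
    rw [hQd v hv, hQd v hv, hTsymm v hv]
  choose H hHc hHd using hH
  refine ⟨V, hV, hpV, hball, H, hHc, fun u hu => ⟨fun i j => ?_, fun i j k => ?_⟩⟩
  · have := hGQ u hu i j
    simp only [hHd _ u hu, ← this, shiftG]
    ring
  · have h1 : ∀ s, pderiv s (pderiv k (H j)) u = T j s k u := by
      intro s
      rw [pderiv_congr hV (fun v hv => hHd j v hv k) hu, hQd u hu, hTsymm u hu]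
    simp only [h1, hηT, shiftB]
    ring

/-- In terms of `H`, `Γη` is the Hessian of `Hʲ` multiplied by `η` on both sides, hence symmetric,
and the curl is a commutator of third partial derivatives. -/
theorem structure_of_potentials (hη : η.IsSymm) (hV : IsOpen V)
    {H : Fin N → (Fin N → ℝ) → ℝ} (hH : ∀ i, ContDiffOn ℝ ∞ (H i) V)
    (hbH : ∀ u ∈ V, ∀ i j k, b u i j k =
      ∑ s, η i s * pderiv s (pderiv k (H j)) u - K * (if i = k then 1 else 0) * u j)
    {v : Fin N → ℝ} (hv : v ∈ V) :
    (∀ i j t, ∑ s, shiftB b K v i j s * η s t = ∑ s, shiftB b K v t j s * η s i) ∧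
      ∀ i j s k, curl (shiftB b K) v i j s k = 0 := by
  have hΓ : ∀ u ∈ V, ∀ i j k, shiftB b K u i j k =
      ∑ r, η i r * pderiv r (pderiv k (H j)) u := by
    intro u hu i j k
    rw [shiftB, hbH u hu]
    ring
  constructor
  · intro i j t
    simp only [hΓ v hv, Finset.sum_mul]
    rw [Finset.sum_comm]
    refine Finset.sum_congr rfl fun r _ => Finset.sum_congr rfl fun s _ => ?_
    rw [pderiv_comm hV (hH j) hv, hη.apply t s, hη.apply r i]
    ring
  · intro i j s k
    have hd : ∀ k r, DifferentiableAt ℝ (pderiv r (pderiv k (H j))) v := fun k r =>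
      (contDiffOn_pderiv hV (contDiffOn_pderiv hV (hH j) k) r).differentiableAt_of_isOpen hV hv
    rw [curl, pderiv_congr hV (fun u hu => hΓ u hu i j k) hv,
      pderiv_congr hV (fun u hu => hΓ u hu i j s) hv, pderiv_sum_mul (hd k),
      pderiv_sum_mul (hd s), sub_eq_zero]
    refine Finset.sum_congr rfl fun r _ => ?_
    rw [pderiv_congr hV (fun u hu => pderiv_comm hV (hH j) hu r k) hv,
      pderiv_comm hV (contDiffOn_pderiv hV (hH j) r) hv,
      pderiv_congr hV (fun u hu => pderiv_comm hV (hH j) hu s r) hv]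

end Potentials

end HydroBracket
end

/-! ### The equivalence of compatibility and existence of local potentials. -/

open HydroBracket in
theorem theorem1 {N : ℕ} (U : Set (Fin N → ℝ)) (hU : IsOpen U)
    (η : Matrix (Fin N) (Fin N) ℝ) (hη : η.IsSymm) (hdet : η.det ≠ 0)
    (K₁ : ℝ) (g₁ : (Fin N → ℝ) → Fin N → Fin N → ℝ)
    (b₁ : (Fin N → ℝ) → Fin N → Fin N → Fin N → ℝ)
    (hg₁ : ContDiffOn ℝ ∞ g₁ U) (hb₁ : ContDiffOn ℝ ∞ b₁ U)
    (hP : IsPoissonBracket U (bracket g₁ b₁ K₁)) :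
    Compatible U (bracket g₁ b₁ K₁) (bracket (fun _ i j => η i j) (fun _ _ _ _ => 0) 0) ↔
      ∀ p ∈ U, ∃ V : Set (Fin N → ℝ), IsOpen V ∧ p ∈ V ∧ V ⊆ U ∧
        ∃ H : Fin N → (Fin N → ℝ) → ℝ, (∀ i, ContDiffOn ℝ ∞ (H i) V) ∧
          ∀ u ∈ V,
            (∀ i j, g₁ u i j =
              ∑ s, η i s * pderiv s (H j) u + ∑ s, η j s * pderiv s (H i) u
                - K₁ * u i * u j) ∧
            (∀ i j k, b₁ u i j k =
              ∑ s, η i s * pderiv s (pderiv k (H j)) u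
                - K₁ * (if i = k then 1 else 0) * u j) := by
  have hgs : ∀ v ∈ U, ∀ i j, g₁ v i j = g₁ v j i := fun v hv i j =>
    symm_of_skew hg₁ hb₁ hP.pairing_skew hv i j
  have hgd : ∀ v ∈ U, ∀ i j s, pderiv s (fun v => g₁ v i j) v = b₁ v i j s + b₁ v j i s :=
    fun v hv i j s => pderiv_of_skew hU hg₁ hb₁ hP.pairing_skew hv i j s
  constructor
  · intro hC p hp
    have hcyc := cyclicVariation_of_compatible hU hη hg₁ hb₁ hP hC
    exact exists_potentials_of_structure hU hη hdet hg₁ hb₁ hgs hgd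
      (fun v hv => shiftB_symm_of_cyclic hU hη hg₁ hb₁ hgd hcyc hv)
      (fun v hv => curl_shiftB_of_cyclic hU hη hdet hg₁ hb₁ hgd hcyc hv) hp
  · intro hloc
    -- The two conditions on `Γ` are pointwise and do not mention `H`, so local potentials,
    -- unrelated on different neighbourhoods, give them on all of `U`.
    have hstr : ∀ v ∈ U,
        (∀ i j t, ∑ s, shiftB b₁ K₁ v i j s * η s t = ∑ s, shiftB b₁ K₁ v t j s * η s i) ∧
          ∀ i j s k, curl (shiftB b₁ K₁) v i j s k = 0 := by
      intro v hv
      obtain ⟨V, hV, hvV, _, H, hH, hgb⟩ := hloc v hv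
      exact structure_of_potentials hη hV hH (fun u hu => (hgb u hu).2) hvV
    exact compatible_of_structure hU hη hg₁ hb₁ hP (fun v hv => (hstr v hv).1)
      (fun v hv => (hstr v hv).2)
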